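/- Let $D>1$, $k\ge 4$ and $\ell\ge 1$ be integers, and let $\chi \pmod D$ be a primitive Dirichlet character with $\chi(-1)=(-1)^k$. Write $\ell=\ell_0\ell'$, where $\ell_0=(\ell,D^\infty)$ is the largest divisor of $\ell$ all of whose prime factors divide $D$, so that $(\ell',D)=1$. Let $S_k(D,\chi)$ be the space of holomorphic cusp forms of weight $k$, level $D$ and nebentypus $\chi$, with the Petersson norm $\|f\|^2=\int_{\Gamma_0(D)\backslash\mathbb H}|f(z)|^2y^k\,\frac{dx\,dy}{y^2}$ and the corresponding inner product; it is finite-dimensional. For $f\in S_k(D,\chi)$ let $a_f(n)$ be its normalized Fourier coefficients, $f(z)=\sum_{n\ge1}a_f(n)n^{(k-1)/2}e(nz)$ with $e(z)=e^{2\pi i z}$. Then for every $g\in C_c^\infty(0,\infty)$ and every orthogonal basis $\mathcal B_k(D,\chi)$ of $S_k(D,\chi)$, $$\sum_{f\in\mathcal B_k(D,\chi)}^{h}\overline{a_f(\ell)}\sum_{n=1}^\infty a_f(n)g(n)=\frac{i^k\chi(-1)\epsilon_\chi}{D^{1/2}}\sum_{f\in\mathcal B_k(D,\chi)}^{h}a_f(\ell')\,\overline{\chi}(\ell')\sum_{n=1}^\infty\overline{a_f(\ell_0Dn)}\,(\mathcal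 H_kg)\!\left(\frac nD\right),$$ where all series on the right converge absolutely. Here $$(\mathcal H_kg)(a)=2\pi\int_0^\infty g(x)J_{k-1}(4\pi\sqrt{ax})\,dx\quad(a>0),$$ with $J_{k-1}$ the Bessel function of the first kind, $\epsilon_\chi=D^{-1/2}\sum_{\alpha \bmod D}\chi(\alpha)e(\alpha/D)$ is the normalized Gauss sum, and the harmonic average is $$\sum_{f\in\mathcal B_k(D,\chi)}^{h}\alpha_f=\frac{\Gamma(k-1)}{(4\pi)^{k-1}}\sum_{f\in\mathcal B_k(D,\chi)}\frac{\alpha_f}{\|f\|^2}.$$ -/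

import Mathlib

open scoped MatrixGroups ComplexConjugate ContDiff
open UpperHalfPlane

noncomputable section

namespace AveragedVoronoi

/-- The space `S_k(D, χ)` of holomorphic cusp forms of weight `k`, level `D` and nebentypus `χ`:
the cusp forms `f` for `Γ₁(D)` such that `f((az + b)/(cz + d)) = χ(d) (cz + d)^k f(z)` for all
matrices `(a, b; c, d)` in `Γ₀(D)`. -/
def cuspForms (D k : ℕ) (χ : DirichletCharacter ℂ D) :
    Submodule ℂ (CuspForm ((CongruenceSubgroup.Gamma1 D).map
      (Matrix.SpecialLinearGroup.mapGL ℝ)) (k : ℤ)) where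
  carrier := {f | ∀ γ ∈ CongruenceSubgroup.Gamma0 D, ∀ z : ℍ,
    f (γ • z) = χ ((γ 1 1 : ℤ) : ZMod D) * (((γ 1 0 : ℤ) : ℂ) * (z : ℂ) + ((γ 1 1 : ℤ) : ℂ)) ^ k
      * f z}
  add_mem' {f g} hf hg γ hγ z := by
    simp only [add_apply, hf γ hγ z, hg γ hγ z]
    ring
  zero_mem' γ _ z := by simp
  smul_mem' c f hf γ hγ z := by
    have h : ∀ w : ℍ, (c • f) w = c * f w := fun _ => rfl
    rw [h, h, hf γ hγ z]
    ring

/-- The Petersson inner product `∫_{Γ₀(D)\ℍ} conj (f z) g(z) y^k dx dy / y²`.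
The quotient `Γ₀(D)\ℍ` is cut into the translates `σ⁻¹𝒟` of the standard fundamental domain `𝒟`
of `SL(2, ℤ)`, where `σ` runs over representatives of the cosets `σ Γ₀(D)`; the integrand is
`Γ₀(D)`-invariant for `f, g` in `S_k(D, χ)`, so the representatives do not matter.
The measure `volume` on `ℍ` is `dx dy / y²`. -/
def peterssonInner (D k : ℕ) (f g : ℍ → ℂ) : ℂ :=
  ∑ᶠ σ : SL(2, ℤ) ⧸ CongruenceSubgroup.Gamma0 D,
    ∫ z in ModularGroup.fd, petersson (k : ℤ) f g (σ.out⁻¹ • z)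

/-- The squared Petersson norm `‖f‖²`. -/
def peterssonNormSq (D k : ℕ) (f : ℍ → ℂ) : ℝ :=
  (peterssonInner D k f f).re

/-- The normalized Fourier coefficient `a_f(n)`, `n ≥ 1`, where
`f(z) = ∑ a_f(n) n^((k-1)/2) e(nz)`. -/
def fourierCoeff (k : ℕ) (f : ℍ → ℂ) (n : ℕ) : ℂ :=
  (qExpansion 1 f).coeff n / (((n : ℝ) ^ (((k : ℝ) - 1) / 2) : ℝ) : ℂ)

/-- The Bessel function `J_m` of integral order `m ≥ 0`. -/
def besselJ (m : ℕ) (x : ℝ) : ℝ :=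
  ∑' j : ℕ, (-1 : ℝ) ^ j / ((j.factorial : ℝ) * ((j + m).factorial : ℝ)) * (x / 2) ^ (2 * j + m)

/-- The Hankel transform `(H_k g)(a) = 2π ∫_0^∞ g(x) J_{k-1}(4π √(a x)) dx`, for `k ≥ 1`. -/
def hankel (k : ℕ) (g : ℝ → ℂ) (a : ℝ) : ℂ :=
  2 * (Real.pi : ℂ) * ∫ x in Set.Ioi (0 : ℝ),
    g x * ((besselJ (k - 1) (4 * Real.pi * √(a * x)) : ℝ) : ℂ)

/-- The normalized Gauss sum `ε_χ = D^(-1/2) ∑_{α mod D} χ(α) e(α/D)`. -/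
def normGaussSum (D : ℕ) [NeZero D] (χ : DirichletCharacter ℂ D) : ℂ :=
  gaussSum χ ZMod.stdAddChar / ((√(D : ℝ) : ℝ) : ℂ)

/-- The harmonic average `Γ(k-1) / (4π)^(k-1) ∑_i α_i / ‖f_i‖²` over a (finite) family `f_i`. -/
def harmonicSum {ι : Type*} (D k : ℕ) (f : ι → ℍ → ℂ) (α : ι → ℂ) : ℂ :=
  ((Real.Gamma ((k : ℝ) - 1) / (4 * Real.pi) ^ (k - 1) : ℝ) : ℂ) *
    ∑ᶠ i, α i / ((peterssonNormSq D k (f i) : ℝ) : ℂ)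

end AveragedVoronoi

end

/-!
# The averaged Voronoi formula

Write `A_f(n)` for the unnormalized Fourier coefficients (`coef`), `V` for `S_k(D, χ)` regarded as a
space of functions (`formSpace`), and `J` for the weight `k` slash action of the matrix
`(0, 1; D, 0)` of determinant `-D` (`fricke`). `J` is conjugate linear: it is a multiple of the
Fricke involution composed with the conjugation of Fourier coefficients. That is why it maps
`S_k(D, χ)` to itself and not to `S_k(D, χ̄)`. For an orthogonal basis `(f_i)` the form
`p_m = ∑ conj(A_i(m)) f_i / ‖f_i‖²` (`kernelForm`) represents the functional `h ↦ A_h(m)`, so both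
sides of the theorem involve only forms `p_m`: the left side is a sum over the coefficients of
`p_ℓ`, the right side one over the coefficients of `p_ℓ'` of index `ℓ₀ D n`.

Analysis enters only through the classical Voronoi formula (`voronoi`) that relates the
coefficients of `J q` and of `q`, for a single form `q ∈ V`. To prove it, write
`g(x) x^(-(k-1)/2)` as `∫ H(t) e(x(t + i)) dt` with a Schwartz function `H` and integrate `H` against
the two expansions of `J q` on the line `Im z = 1`, at the cusps `∞` and `0`
(`IsLineTransform.summation_formula`). The integral of `H(t) z^(-k) e(-a/z)`, `z = t + i`, is computed
by expanding the exponential in powers of `1/z`; this produces the power series of the Bessel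
function (`IsLineTransform.integral_kernel`).

Put `p_m = J q_m`. It remains to compare the coefficients of `p_ℓ'` with those of `q_ℓ`. Consider the
complex bilinear form `B(F, H) = ⟨J F, H⟩`, for which `q_m` represents `h ↦ A_h(m)`.
* `B` is symmetric (`peterssonInner_fricke_comm`); hence `A_{q_m}(n) = A_{q_n}(m)`.
* For `d ∣ D^∞` the operator `U_d : A(n) ↦ A(dn)` is self-adjoint for `B`
  (`peterssonInner_fricke_opU`); hence `A_{q_m}(dn) = A_{q_{dm}}(n)`.
* On indices `n` prime to `D`, the coefficients of `J U_D F` are those of `F`, conjugated and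
  multiplied by `χ(n)` and a Gauss sum (`coef_opU_fricke`).

Together these facts express `A_{p_ℓ'}(D ℓ₀ n)` through `A_{q_ℓ'}(ℓ₀ n) = A_{q_ℓ}(n)`
(`IsFrickeKernel.coef_fricke`, `IsFrickeKernel.coef_mul`), and `τ(χ) τ(χ̄) = χ(-1) D` makes the
constants agree. No Hecke eigenforms, Poincaré series or Kloosterman sums are needed.

The remaining parts supply foundations: inner products are computed by integrating against weights
on `ℍ` whose sums over the orbits of the group are constant (`IsFundWeight`), which replace
fundamental domains, and the finiteness of the basis comes from the Sturm bound in level one,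
applied to the norm of a form (`finiteDimensional_cuspForms`).
-/

noncomputable section

namespace AveragedVoronoi

open MeasureTheory
open scoped ENNReal Pointwise ModularForm Manifold
open CongruenceSubgroup Matrix.SpecialLinearGroup

/-! ### The standard fundamental domain -/

section

instance : Countable SL(2, ℤ) :=
  Function.Injective.countable (f := fun g : SL(2, ℤ) => fun i j => g i j) fun _ _ e =>
    Matrix.SpecialLinearGroup.ext _ _ fun i j => congrFun (congrFun e i) j

lemma measurableSet_fd : MeasurableSet ModularGroup.fd := by
  have h : IsClosed ModularGroup.fd := by
    simp only [ModularGroup.fd, Set.ofPred_and]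
    refine IsClosed.inter (isClosed_le continuous_const ?_) (isClosed_le ?_ continuous_const)
    · exact Complex.continuous_normSq.comp continuous_coe
    · exact continuous_re.abs
  exact h.measurableSet

lemma volume_null_of_image_null {s : Set ℍ} (h : volume (UpperHalfPlane.coe '' s) = 0) :
    volume s = 0 := by
  rw [volume_eq_lintegral]
  exact setLIntegral_measure_zero _ _ h

lemma volume_complex_re_eq (c : ℝ) : volume {z : ℂ | z.re = c} = 0 := by
  have h := Complex.volume_preserving_equiv_real_prod.measure_preimage
    (s := {c} ×ˢ Set.univ) (by measurability)
  have h2 : Complex.measurableEquivRealProd ⁻¹' ({c} ×ˢ Set.univ) = {z : ℂ | z.re = c} := by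
    ext z; simp
  rw [h2] at h
  rw [h, Measure.volume_eq_prod, Measure.prod_prod]
  simp

/-- The points of `ℍ` on the three curves `re z = ± 1/2`, `|z| = 1` form a null set, hence almost
no `SL(2, ℤ)`-orbit meets them. -/
lemma ae_forall_smul_notMem_boundary :
    ∀ᵐ z : ℍ, ∀ g : SL(2, ℤ), (g • z).re ≠ -1 / 2 ∧ (g • z).re ≠ 1 / 2 ∧ ‖((g • z : ℍ) : ℂ)‖ ≠ 1 := by
  rw [ae_all_iff]
  intro g
  have h0 : ∀ᵐ z : ℍ, z.re ≠ -1 / 2 ∧ z.re ≠ 1 / 2 ∧ ‖(z : ℂ)‖ ≠ 1 := by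
    have key : ∀ s : Set ℂ, volume s = 0 → ∀ᵐ z : ℍ, (z : ℂ) ∉ s := by
      intro s hs
      rw [ae_iff]
      refine volume_null_of_image_null (measure_mono_null ?_ hs)
      rintro _ ⟨z, hz, rfl⟩
      simpa using hz
    filter_upwards [key _ (volume_complex_re_eq (-1 / 2)), key _ (volume_complex_re_eq (1 / 2)),
      key _ (Measure.addHaar_sphere volume (0 : ℂ) 1)] with z h1 h2 h3
    exact ⟨h1, h2, by simpa using h3⟩
  have hq := (measurePreserving_smul (Matrix.SpecialLinearGroup.mapGL ℝ g)
    (volume : Measure ℍ)).quasiMeasurePreserving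
  exact hq.ae h0

/-- Almost every `z` is moved into the standard fundamental domain by exactly two elements
`± g` of `SL(2, ℤ)`. -/
lemma tsum_indicator_fd :
    ∀ᵐ z : ℍ, ∑' g : SL(2, ℤ), ModularGroup.fd.indicator (fun _ => (1 : ℝ≥0∞)) (g • z) = 2 := by
  filter_upwards [ae_forall_smul_notMem_boundary] with z hz
  obtain ⟨g₀, hg₀⟩ := ModularGroup.exists_smul_mem_fd z
  have hne : g₀ ≠ -g₀ := by
    intro h
    have h' := congrArg (fun g : SL(2, ℤ) => (g 0 0, g 0 1)) h
    simp only [Matrix.SpecialLinearGroup.coe_neg, Matrix.neg_apply, Prod.mk.injEq] at h'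
    have h2 := g₀.det_coe
    rw [Matrix.det_fin_two] at h2
    have e0 : g₀ 0 0 = 0 := by omega
    have e1 : g₀ 0 1 = 0 := by omega
    rw [e0, e1] at h2
    simp at h2
  -- Off the boundary, a group element that maps one point of the domain to another one is `± 1`.
  have hsupp : ∀ g ∉ ({g₀, -g₀} : Finset SL(2, ℤ)),
      ModularGroup.fd.indicator (fun _ => (1 : ℝ≥0∞)) (g • z) = 0 := by
    intro g hg
    refine Set.indicator_of_notMem (fun hmem => hg ?_) _
    have e : (g * g₀⁻¹) • (g₀ • z) = g • z := by
      rw [mul_smul, inv_smul_smul]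
    obtain ⟨b1, b2, b3⟩ := hz g₀
    have hc := ModularGroup.cases_of_mem_fd_smul_mem_fd hg₀ (g := g * g₀⁻¹) (e ▸ hmem)
    have hρ : g₀ • z ≠ UpperHalfPlane.ρ := by
      intro h
      apply b1
      rw [h]; simp [UpperHalfPlane.ρ]
    have hρ' : g₀ • z ≠ (1 : ℝ) +ᵥ UpperHalfPlane.ρ := by
      intro h
      apply b2
      rw [h]; simp [UpperHalfPlane.ρ]; norm_num
    have : g * g₀⁻¹ = 1 ∨ g * g₀⁻¹ = -1 := by tauto
    rcases this with h | h
    · simp [mul_inv_eq_one.mp h]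
    · have : g = -g₀ := by
        rw [mul_inv_eq_iff_eq_mul] at h
        rw [h]; simp
      simp [this]
  rw [tsum_eq_sum hsupp, Finset.sum_pair hne, Set.indicator_of_mem hg₀,
    Set.indicator_of_mem (by rwa [ModularGroup.SL_neg_smul])]
  norm_num

/-- The domain has finite area, as it lies in the strip `|x| ≤ 1/2`, `y > 1/2`. -/
lemma volume_fd_lt_top : volume ModularGroup.fd < ⊤ := by
  rw [volume_eq_lintegral]
  set s : Set ℂ := Complex.measurableEquivRealProd ⁻¹' (Set.Icc (-1 / 2) (1 / 2) ×ˢ Set.Ioi (1 / 2))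
  have hsub : UpperHalfPlane.coe '' ModularGroup.fd ⊆ s := by
    rintro _ ⟨z, hz, rfl⟩
    have h1 := abs_le.mp hz.2
    have h2 := ModularGroup.three_le_four_mul_im_sq_of_mem_fd hz
    have h3 := z.im_pos
    refine ⟨⟨?_, ?_⟩, ?_⟩
    · have : -1 / 2 ≤ z.re := by linarith [h1.1]
      simpa using this
    · simpa using h1.2
    · have : 1 / 2 < z.im := by nlinarith
      simpa using this
  refine (lintegral_mono_set hsub).trans_lt ?_
  have hm : Measurable fun p : ℝ × ℝ => (((1 / ‖p.2‖₊) ^ 2 : NNReal) : ℝ≥0∞) := by fun_prop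
  have e := Complex.volume_preserving_equiv_real_prod.setLIntegral_comp_preimage
    (s := Set.Icc (-1 / 2) (1 / 2) ×ˢ Set.Ioi (1 / 2))
    (measurableSet_Icc.prod measurableSet_Ioi) hm
  have e' : ∫⁻ z in s, (((1 / ‖z.im‖₊) ^ 2 : NNReal) : ℝ≥0∞) =
      ∫⁻ p in Set.Icc (-1 / 2 : ℝ) (1 / 2) ×ˢ Set.Ioi (1 / 2 : ℝ),
        (((1 / ‖p.2‖₊) ^ 2 : NNReal) : ℝ≥0∞) := e
  rw [e', Measure.volume_eq_prod, ← Measure.prod_restrict, lintegral_prod _ hm.aemeasurable]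
  simp only [lintegral_const, MeasurableSet.univ, Measure.restrict_apply, Set.univ_inter,
    Real.volume_Icc]
  refine ENNReal.mul_lt_top ?_ ENNReal.ofReal_lt_top
  have hint : IntegrableOn (fun y : ℝ => y ^ (-2 : ℝ)) (Set.Ioi (1 / 2)) :=
    integrableOn_Ioi_rpow_of_lt (by norm_num) (by norm_num)
  refine lt_of_le_of_lt (le_of_eq ?_) hint.hasFiniteIntegral
  refine lintegral_congr fun y => ?_
  have e2 : y ^ (-2 : ℝ) = (y ^ 2)⁻¹ := by
    rw [show (-2 : ℝ) = ((-2 : ℤ) : ℝ) by norm_num, Real.rpow_intCast]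
    rfl
  simp only [e2, enorm_eq_nnnorm]
  simp

end

/-! ### Integration over `Γ\ℍ` by weights -/

section

/-- A *fundamental weight* for a subgroup `Γ` of `SL(2, ℤ)`: a nonnegative function `w` on `ℍ` with
`∑_{γ ∈ Γ} w(γz) = 2` for almost all `z`. Integrating a `Γ`-invariant function against
`w(z) dx dy / y²` amounts to integrating it over `Γ\ℍ` (when `-1 ∈ Γ`, which explains the `2`).
In contrast to fundamental domains, weights are easy to transport and to add up. -/
structure IsFundWeight (Γ : Subgroup SL(2, ℤ)) (w : ℍ → ℝ≥0∞) : Prop where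
  measurable : Measurable w
  tsum_eq : ∀ᵐ z : ℍ, ∑' γ : Γ, w ((γ : SL(2, ℤ)) • z) = 2

/-- The measure `w(z) dx dy / y²`. -/
def weightMeasure (w : ℍ → ℝ≥0∞) : Measure ℍ := volume.withDensity w

lemma measurePreserving_SL (g : SL(2, ℤ)) :
    MeasurePreserving (fun z : ℍ => g • z) (volume : Measure ℍ) volume :=
  measurePreserving_smul (Matrix.SpecialLinearGroup.mapGL ℝ g) volume

lemma measurable_SL (g : SL(2, ℤ)) : Measurable (fun z : ℍ => g • z) :=
  (measurePreserving_SL g).measurable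

lemma measurable_GL (g : GL (Fin 2) ℝ) : Measurable (fun z : ℍ => g • z) :=
  (measurePreserving_smul g (volume : Measure ℍ)).measurable

lemma lintegral_SL_smul (g : SL(2, ℤ)) {F : ℍ → ℝ≥0∞} (hF : Measurable F) :
    ∫⁻ z, F (g • z) = ∫⁻ z, F z :=
  (measurePreserving_SL g).lintegral_comp hF

namespace IsFundWeight

variable {Γ : Subgroup SL(2, ℤ)} {w w' : ℍ → ℝ≥0∞}

/-- Insert the factor `2 = ∑ w'(γz)`. -/
lemma lintegral_mul_eq_aux (hw : IsFundWeight Γ w) (hw' : IsFundWeight Γ w') {F : ℍ → ℝ≥0∞}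
    (hF : Measurable F) :
    ∑' γ : Γ, ∫⁻ z, F z * w z * w' ((γ : SL(2, ℤ)) • z) = 2 * ∫⁻ z, F z * w z := by
  have hm : ∀ γ : Γ, AEMeasurable (fun z => F z * w z * w' ((γ : SL(2, ℤ)) • z)) :=
    fun γ => ((hF.mul hw.measurable).mul
      (hw'.measurable.comp (measurable_SL (γ : SL(2, ℤ))))).aemeasurable
  have hm' : Measurable fun z => F z * w z := hF.mul hw.measurable
  rw [← lintegral_tsum hm, ← lintegral_const_mul _ hm']
  refine lintegral_congr_ae ?_
  filter_upwards [hw'.tsum_eq] with z hz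
  rw [ENNReal.tsum_mul_left, hz, mul_comm]

/-- Unfolding: the integral of an invariant function does not depend on the weight. -/
lemma lintegral_mul_eq (hw : IsFundWeight Γ w) (hw' : IsFundWeight Γ w') {F : ℍ → ℝ≥0∞}
    (hF : Measurable F) (hinv : ∀ γ ∈ Γ, ∀ z, F (γ • z) = F z) :
    ∫⁻ z, F z * w z = ∫⁻ z, F z * w' z := by
  have h1 := lintegral_mul_eq_aux hw hw' hF
  have h2 := lintegral_mul_eq_aux hw' hw hF
  have h3 : ∑' γ : Γ, ∫⁻ z, F z * w z * w' ((γ : SL(2, ℤ)) • z) =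
      ∑' γ : Γ, ∫⁻ z, F z * w' z * w ((γ : SL(2, ℤ)) • z) := by
    rw [← (Equiv.inv Γ).tsum_eq]
    refine tsum_congr fun γ => ?_
    have hm : Measurable fun z => F z * w z * w' ((γ : SL(2, ℤ))⁻¹ • z) :=
      (hF.mul hw.measurable).mul (hw'.measurable.comp (measurable_SL _))
    -- Substitute `γz` for `z` in the term that belongs to `γ⁻¹`.
    refine (lintegral_SL_smul (γ : SL(2, ℤ)) hm).symm.trans (lintegral_congr fun z => ?_)
    simp only [inv_smul_smul, hinv _ γ.2]
    ring
  rw [h3, h2] at h1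
  exact ((ENNReal.mul_right_inj two_ne_zero ENNReal.ofNat_ne_top).mp h1).symm

/-- An invariant function has the same distribution with respect to all weights, which carries the
comparison of lower Lebesgue integrals over to Bochner integrals, without integrability
assumptions. -/
lemma map_weightMeasure_eq (hw : IsFundWeight Γ w) (hw' : IsFundWeight Γ w') {F : ℍ → ℂ}
    (hF : Measurable F) (hinv : ∀ γ ∈ Γ, ∀ z, F (γ • z) = F z) :
    (weightMeasure w).map F = (weightMeasure w').map F := by
  have key : ∀ w : ℍ → ℝ≥0∞, ∀ s : Set ℂ, MeasurableSet s →
      (weightMeasure w).map F s = ∫⁻ z, (F ⁻¹' s).indicator (fun _ => 1) z * w z := by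
    intro w s hs
    rw [Measure.map_apply hF hs, weightMeasure, withDensity_apply _ (hF hs),
      ← lintegral_indicator (hF hs)]
    refine lintegral_congr fun z => ?_
    by_cases hz : z ∈ F ⁻¹' s <;> simp [Set.indicator, hz]
  ext s hs
  rw [key w s hs, key w' s hs]
  refine hw.lintegral_mul_eq hw' (measurable_const.indicator (hF hs)) fun γ hγ z => ?_
  have e : γ • z ∈ F ⁻¹' s ↔ z ∈ F ⁻¹' s := by rw [Set.mem_preimage, hinv γ hγ z, Set.mem_preimage]
  by_cases hz : z ∈ F ⁻¹' s
  · rw [Set.indicator_of_mem hz, Set.indicator_of_mem (e.mpr hz)]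
  · rw [Set.indicator_of_notMem hz, Set.indicator_of_notMem (mt e.mp hz)]

lemma integral_eq (hw : IsFundWeight Γ w) (hw' : IsFundWeight Γ w') {F : ℍ → ℂ}
    (hF : Measurable F) (hinv : ∀ γ ∈ Γ, ∀ z, F (γ • z) = F z) :
    ∫ z, F z ∂(weightMeasure w) = ∫ z, F z ∂(weightMeasure w') := by
  have h : ∀ w, ∫ z, F z ∂(weightMeasure w) = ∫ x, x ∂((weightMeasure w).map F) := fun w =>
    (integral_map hF.aemeasurable aestronglyMeasurable_id).symm
  rw [h, h, map_weightMeasure_eq hw hw' hF hinv]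

/-- Transport of a weight along an element of `GL(2, ℝ)` that conjugates `Γ'` into `Γ`. -/
lemma comp_smul (hw : IsFundWeight Γ w) {Γ' : Subgroup SL(2, ℤ)} (g : GL (Fin 2) ℝ) (φ : Γ' ≃ Γ)
    (hφ : ∀ (γ : Γ') (z : ℍ), g • ((γ : SL(2, ℤ)) • z) = (φ γ : SL(2, ℤ)) • (g • z)) :
    IsFundWeight Γ' fun z => w (g • z) where
  measurable := hw.measurable.comp (measurable_GL g)
  tsum_eq := by
    have hq := (measurePreserving_smul g (volume : Measure ℍ)).quasiMeasurePreserving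
    filter_upwards [hq.ae hw.tsum_eq] with z hz
    simp only [hφ]
    rw [φ.tsum_eq fun γ : Γ => w ((γ : SL(2, ℤ)) • (g • z)), hz]

/-- If `Γ` is the disjoint union of the cosets `s_i Γ'`, a weight for `Γ` gives one for `Γ'`. -/
lemma sum_cosets (hw : IsFundWeight Γ w) {Γ' : Subgroup SL(2, ℤ)} {ι : Type*} [Fintype ι]
    (s : ι → SL(2, ℤ)) (φ : ι × Γ' ≃ Γ) (hφ : ∀ p, (φ p : SL(2, ℤ)) = s p.1 * p.2) :
    IsFundWeight Γ' fun z => ∑ i, w (s i • z) where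
  measurable := Finset.measurable_sum _ fun i _ => hw.measurable.comp (measurable_SL _)
  tsum_eq := by
    filter_upwards [hw.tsum_eq] with z hz
    rw [Summable.tsum_finsetSum fun _ _ => ENNReal.summable]
    rw [← hz, ← φ.tsum_eq]
    simp only [hφ, mul_smul]
    rw [ENNReal.tsum_prod (f := fun i (γ : Γ') => w (s i • (γ : SL(2, ℤ)) • z)), tsum_fintype]

end IsFundWeight

lemma integral_weightMeasure_comp {w : ℍ → ℝ≥0∞} (g : GL (Fin 2) ℝ) (F : ℍ → ℂ)
    (hw : Measurable w) :
    ∫ z, F (g • z) ∂(weightMeasure fun z => w (g • z)) = ∫ z, F z ∂(weightMeasure w) := by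
  have hmp : MeasurePreserving (fun z : ℍ => g • z) (weightMeasure fun z => w (g • z))
      (weightMeasure w) := by
    refine ⟨measurable_GL g, ?_⟩
    ext s hs
    rw [Measure.map_apply (measurable_GL g) hs, weightMeasure, weightMeasure,
      withDensity_apply _ hs, withDensity_apply _ (measurable_GL g hs)]
    exact (measurePreserving_smul g (volume : Measure ℍ)).setLIntegral_comp_preimage hs hw
  exact hmp.integral_comp (MeasurableEquiv.smul g).measurableEmbedding F

lemma weightMeasure_sum {ι : Type*} [Fintype ι] (w : ι → ℍ → ℝ≥0∞) (hw : ∀ i, Measurable (w i)) :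
    weightMeasure (fun z => ∑ i, w i z) = ∑ i, weightMeasure (w i) := by
  ext s hs
  simp only [weightMeasure, Measure.coe_finsetSum, Finset.sum_apply, withDensity_apply _ hs]
  exact lintegral_finsetSum _ fun i _ => hw i

/-- The weight that cuts `Γ\ℍ` into translates of the standard fundamental domain. -/
def fdWeight (Γ : Subgroup SL(2, ℤ)) [Γ.FiniteIndex] (z : ℍ) : ℝ≥0∞ :=
  letI := Γ.fintypeQuotientOfFiniteIndex
  ∑ σ : SL(2, ℤ) ⧸ Γ, ModularGroup.fd.indicator (fun _ => (1 : ℝ≥0∞)) (σ.out • z)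

section fdWeight

variable (Γ : Subgroup SL(2, ℤ)) [Γ.FiniteIndex]

lemma measurable_indicator_fd_smul (g : SL(2, ℤ)) :
    Measurable fun z : ℍ => ModularGroup.fd.indicator (fun _ => (1 : ℝ≥0∞)) (g • z) :=
  (measurable_const.indicator measurableSet_fd).comp (measurable_SL g)

lemma isFundWeight_fdWeight : IsFundWeight Γ (fdWeight Γ) := by
  let := Γ.fintypeQuotientOfFiniteIndex
  have htop : IsFundWeight ⊤ (ModularGroup.fd.indicator fun _ => (1 : ℝ≥0∞)) := by
    refine ⟨measurable_const.indicator measurableSet_fd, ?_⟩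
    filter_upwards [tsum_indicator_fd] with z hz
    rw [← hz]
    exact (Subgroup.topEquiv (G := SL(2, ℤ))).toEquiv.tsum_eq
      (fun g => ModularGroup.fd.indicator (fun _ => (1 : ℝ≥0∞)) (g • z))
  have hbij : Function.Bijective fun p : (SL(2, ℤ) ⧸ Γ) × Γ =>
      (⟨p.1.out * p.2, trivial⟩ : (⊤ : Subgroup SL(2, ℤ))) := by
    constructor
    · rintro ⟨a, x⟩ ⟨b, y⟩ h
      have h' : a.out * (x : SL(2, ℤ)) = b.out * y := congrArg Subtype.val h
      have hab : a = b := by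
        have := congrArg (QuotientGroup.mk : SL(2, ℤ) → SL(2, ℤ) ⧸ Γ) h'
        simpa [QuotientGroup.mk_mul_of_mem] using this
      subst hab
      simpa using h'
    · rintro ⟨g, -⟩
      have hm : ((g : SL(2, ℤ) ⧸ Γ).out)⁻¹ * g ∈ Γ := by
        rw [← QuotientGroup.eq]; simp
      exact ⟨(g, ⟨_, hm⟩), by simp⟩
  exact htop.sum_cosets (fun σ : SL(2, ℤ) ⧸ Γ => σ.out) (Equiv.ofBijective _ hbij) fun _ => rfl

lemma weightMeasure_indicator_smul (g : SL(2, ℤ)) (F : ℍ → ℂ) :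
    ∫ z, F z ∂(weightMeasure fun z => ModularGroup.fd.indicator (fun _ => (1 : ℝ≥0∞)) (g • z)) =
      ∫ z in ModularGroup.fd, F (g⁻¹ • z) := by
  have h := integral_weightMeasure_comp (Matrix.SpecialLinearGroup.mapGL ℝ g)
    (fun z => F (g⁻¹ • z)) (w := ModularGroup.fd.indicator fun _ => (1 : ℝ≥0∞))
    (measurable_const.indicator measurableSet_fd)
  have h1 : weightMeasure (ModularGroup.fd.indicator fun _ => (1 : ℝ≥0∞)) =
      volume.restrict ModularGroup.fd := by
    rw [weightMeasure, withDensity_indicator measurableSet_fd]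
    exact withDensity_one
  rw [h1] at h
  rw [← h]
  have e : ∀ z : ℍ, g⁻¹ • (Matrix.SpecialLinearGroup.mapGL ℝ g • z) = z := fun z =>
    inv_smul_smul g z
  simp only [e]
  rfl

instance : IsFiniteMeasure (weightMeasure (fdWeight Γ)) := by
  let := Γ.fintypeQuotientOfFiniteIndex
  refine ⟨?_⟩
  rw [weightMeasure, withDensity_apply _ MeasurableSet.univ, Measure.restrict_univ]
  unfold fdWeight
  rw [lintegral_finsetSum _ fun σ _ => measurable_indicator_fd_smul _]
  refine ENNReal.sum_lt_top.mpr fun σ _ => ?_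
  rw [lintegral_SL_smul _ (measurable_const.indicator measurableSet_fd),
    lintegral_indicator measurableSet_fd]
  simpa using volume_fd_lt_top

/-- The Petersson inner product as the integral against one finite measure. -/
lemma peterssonInner_eq_integral (D k : ℕ) [NeZero D] (f h : ℍ → ℂ)
    (hint : Integrable (petersson k f h) (weightMeasure (fdWeight (CongruenceSubgroup.Gamma0 D)))) :
    peterssonInner D k f h =
      ∫ z, petersson k f h z ∂(weightMeasure (fdWeight (CongruenceSubgroup.Gamma0 D))) := by
  let := (CongruenceSubgroup.Gamma0 D).fintypeQuotientOfFiniteIndex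
  unfold peterssonInner fdWeight
  unfold fdWeight at hint
  rw [weightMeasure_sum _ fun σ => measurable_indicator_fd_smul _] at hint ⊢
  rw [integral_finsetSum_measure (fun i _ => ?_), finsum_eq_sum_of_fintype]
  · simp only [weightMeasure_indicator_smul]
  · exact integrable_finsetSum_measure.mp hint i (Finset.mem_univ i)

/-- An invariant null set of the weight measure is a null set. -/
lemma IsFundWeight.volume_eq_zero {Γ : Subgroup SL(2, ℤ)} {w : ℍ → ℝ≥0∞} (hw : IsFundWeight Γ w)
    {s : Set ℍ} (hs : MeasurableSet s) (hinv : ∀ γ ∈ Γ, ∀ z, γ • z ∈ s ↔ z ∈ s)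
    (h0 : weightMeasure w s = 0) : volume s = 0 := by
  have h1 : ∫⁻ z, s.indicator w z = 0 := by
    rwa [lintegral_indicator hs, ← withDensity_apply _ hs]
  have h2 : ∀ γ : Γ, ∫⁻ z, s.indicator w ((γ : SL(2, ℤ)) • z) = 0 := fun γ => by
    rw [lintegral_SL_smul _ (hw.measurable.indicator hs), h1]
  have h3 : ∫⁻ z, ∑' γ : Γ, s.indicator w ((γ : SL(2, ℤ)) • z) = 0 := by
    have hm : ∀ γ : Γ, AEMeasurable (fun z => s.indicator w ((γ : SL(2, ℤ)) • z)) := fun γ =>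
      ((hw.measurable.indicator hs).comp (measurable_SL (γ : SL(2, ℤ)))).aemeasurable
    rw [lintegral_tsum hm]
    simp only [h2, tsum_zero]
  have h4 : ∫⁻ z, s.indicator (fun _ => (2 : ℝ≥0∞)) z = 0 := by
    rw [← h3]
    refine lintegral_congr_ae ?_
    filter_upwards [hw.tsum_eq] with z hz
    by_cases hzs : z ∈ s
    · simp only [Set.indicator, hinv _ (Subtype.prop _), hzs, if_true, hz]
    · simp only [Set.indicator, hinv _ (Subtype.prop _), hzs, if_false, tsum_zero]
  rw [lintegral_indicator hs] at h4
  simpa using h4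

instance : (volume : Measure ℍ).IsOpenPosMeasure := by
  refine ⟨fun U hU hne h0 => ?_⟩
  have h1 : ((volume : Measure ℂ).comap UpperHalfPlane.coe) U = 0 := by
    have hi : Measurable fun z : ℍ => NNReal.mk z.im z.im_pos.le :=
      continuous_im.measurable.subtype_mk
    have hm : Measurable fun z : ℍ => (((1 / NNReal.mk z.im z.im_pos.le) ^ 2 : NNReal) : ℝ≥0∞) :=
      ((measurable_const.div hi).pow_const 2).coe_nnreal_ennreal
    rw [volume_def, withDensity_apply_eq_zero hm] at h0
    convert h0 using 2
    rw [Set.inter_eq_right.mpr]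
    intro z _
    have : NNReal.mk z.im z.im_pos.le ≠ 0 := NNReal.ne_iff.mp z.im_ne_zero
    exact ENNReal.coe_ne_zero.mpr (pow_ne_zero _ (one_div_ne_zero this))
  have := Measure.IsOpenPosMeasure.comap (volume : Measure ℂ) isOpenEmbedding_coe
  exact (hU.measure_ne_zero _ hne) h1

end fdWeight

end

/-! ### Forms with nebentypus as functions on the upper half-plane -/

section

/-- The image of `GL(2, ℚ)` in `GL(2, ℝ)`. -/
def ratGL : Subgroup (GL (Fin 2) ℝ) :=
  (Matrix.GeneralLinearGroup.map (n := Fin 2) (Rat.castHom ℝ)).range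

lemma mem_ratGL_of_int {A : GL (Fin 2) ℝ} (M : Matrix (Fin 2) (Fin 2) ℤ)
    (h : ∀ i j, A i j = M i j) : A ∈ ratGL := by
  have hA : A.1 = M.map (Int.cast : ℤ → ℝ) := by ext i j; exact h i j
  have hdet : M.det ≠ 0 := by
    intro h0
    apply A.det_ne_zero
    have e := Int.cast_det (R := ℝ) M
    rw [h0] at e
    rw [hA, ← e, Int.cast_zero]
  have hq : (M.map (Int.cast : ℤ → ℚ)).det ≠ 0 := by
    rw [← Int.cast_det]; exact_mod_cast hdet
  refine ⟨Matrix.GeneralLinearGroup.mkOfDetNeZero _ hq, ?_⟩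
  ext i j
  simp [Matrix.GeneralLinearGroup.mkOfDetNeZero, h]

lemma mapGL_mem_ratGL (γ : SL(2, ℤ)) : mapGL ℝ γ ∈ ratGL :=
  mem_ratGL_of_int γ.1 fun i j => by simp [mapGL]

/-- The space `S_k(D, χ)`, as a space of functions on `ℍ`. Vanishing at the cusps is expressed by
vanishing at `i∞` of all translates by `GL(2, ℚ)`, a condition that is visibly preserved by the
slash action of rational matrices. -/
def formSpace (D k : ℕ) (χ : DirichletCharacter ℂ D) : Submodule ℂ (ℍ → ℂ) where
  carrier := {F | MDiff F ∧
    (∀ γ ∈ Gamma0 D, F ∣[(k : ℤ)] (mapGL ℝ γ) = χ ((γ 1 1 : ℤ) : ZMod D) • F) ∧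
    ∀ A ∈ ratGL, IsZeroAtImInfty (F ∣[(k : ℤ)] A)}
  add_mem' {F G} hF hG := by
    refine ⟨hF.1.add hG.1, fun γ hγ => ?_, fun A hA => ?_⟩
    · rw [SlashAction.add_slash, hF.2.1 γ hγ, hG.2.1 γ hγ, smul_add]
    · rw [SlashAction.add_slash]
      exact (hF.2.2 A hA).add (hG.2.2 A hA)
  zero_mem' := by
    refine ⟨mdifferentiable_const, fun γ hγ => ?_, fun A hA => ?_⟩
    · simp
    · rw [SlashAction.zero_slash]
      exact Filter.zero_zeroAtFilter _
  smul_mem' c F hF := by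
    refine ⟨hF.1.const_smul c, fun γ hγ => ?_, fun A hA => ?_⟩
    · rw [ModularForm.smul_slash, hF.2.1 γ hγ, smul_comm]
      congr 1
      simp [σ]
    · rw [ModularForm.smul_slash]
      exact (hF.2.2 A hA).smul _

variable {D k : ℕ} {χ : DirichletCharacter ℂ D}

lemma isCusp_ratGL_smul_infty {A : GL (Fin 2) ℝ} (hA : A ∈ ratGL) :
    IsCusp (A • OnePoint.infty) 𝒮ℒ := by
  obtain ⟨B, rfl⟩ := hA
  rw [isCusp_SL2Z_iff]
  exact ⟨B • OnePoint.infty, by rw [← Rat.coe_castHom, OnePoint.map_smul, OnePoint.map_infty]⟩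

lemma slash_mapGL_iff {F : ℍ → ℂ} (γ : SL(2, ℤ)) (c : ℂ) :
    F ∣[(k : ℤ)] (mapGL ℝ γ) = c • F ↔ ∀ z : ℍ,
      F (γ • z) = c * (((γ 1 0 : ℤ) : ℂ) * (z : ℂ) + ((γ 1 1 : ℤ) : ℂ)) ^ k * F z := by
  rw [funext_iff]
  refine forall_congr' fun z => ?_
  have h := ModularForm.SL_slash_apply (k := (k : ℤ)) F γ z
  rw [ModularForm.SL_slash] at h
  have hd := denom_ne_zero (γ : GL (Fin 2) ℝ) z
  have hd' : denom (γ : GL (Fin 2) ℝ) z = ((γ 1 0 : ℤ) : ℂ) * (z : ℂ) + ((γ 1 1 : ℤ) : ℂ) :=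
    ModularGroup.denom_apply γ z
  change (F ∣[(k : ℤ)] (γ : GL (Fin 2) ℝ)) z = _ ↔ _
  rw [h, ← hd', zpow_neg, zpow_natCast, mul_inv_eq_iff_eq_mul₀ (pow_ne_zero _ hd), Pi.smul_apply,
    smul_eq_mul]
  constructor <;> intro h' <;> rw [h'] <;> ring

lemma coe_mem_formSpace [NeZero D] {f : CuspForm ((Gamma1 D).map (mapGL ℝ)) (k : ℤ)}
    (hf : f ∈ cuspForms D k χ) : ⇑f ∈ formSpace D k χ := by
  refine ⟨f.holo', fun γ hγ => (slash_mapGL_iff γ _).mpr (hf γ hγ), fun A hA => ?_⟩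
  have hc := isCusp_ratGL_smul_infty hA
  rw [← Subgroup.IsArithmetic.isCusp_iff_isCusp_SL2Z ((Gamma1 D).map (mapGL ℝ))] at hc
  exact f.zero_at_cusps' hc A rfl

lemma exists_cuspForm_of_mem_formSpace [NeZero D] {F : ℍ → ℂ} (hF : F ∈ formSpace D k χ) :
    ∃ f ∈ cuspForms D k χ, ⇑f = F := by
  let f : CuspForm ((Gamma1 D).map (mapGL ℝ)) (k : ℤ) :=
    { toFun := F
      slash_action_eq' := by
        rintro _ ⟨γ, hγ, rfl⟩
        rw [hF.2.1 γ (Gamma1_in_Gamma0 D hγ), ((Gamma1_mem D γ).mp hγ).2.1, map_one, one_smul]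
      holo' := hF.1
      zero_at_cusps' := by
        intro c hc
        rw [Subgroup.IsArithmetic.isCusp_iff_isCusp_SL2Z] at hc
        rw [OnePoint.isZeroAt_iff_forall_SL2Z hc]
        exact fun γ _ => hF.2.2 _ (mapGL_mem_ratGL γ) }
  exact ⟨f, fun γ hγ => (slash_mapGL_iff γ _).mp (hF.2.1 γ hγ), rfl⟩

lemma smul_slash_of_pos (c : ℂ) (F : ℍ → ℂ) {A : GL (Fin 2) ℝ} (hA : 0 < A.det.val) :
    (c • F) ∣[(k : ℤ)] A = c • (F ∣[(k : ℤ)] A) := by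
  rw [ModularForm.smul_slash, σ, if_pos hA]; rfl

lemma smul_slash_of_neg (c : ℂ) (F : ℍ → ℂ) {A : GL (Fin 2) ℝ} (hA : A.det.val < 0) :
    (c • F) ∣[(k : ℤ)] A = conj c • (F ∣[(k : ℤ)] A) := by
  rw [ModularForm.smul_slash, σ, if_neg hA.not_gt]; rfl

/-! ### The operators -/

/-- The matrix `(0, 1; D, 0)`. As its determinant is negative, it acts on `ℍ` by the
antiholomorphic involution `z ↦ 1 / (D z̄)`, and by the weight `k` slash action, up to a scalar, as
the Fricke involution followed by complex conjugation of the Fourier coefficients. -/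
def fricke (D : ℕ) [NeZero D] : GL (Fin 2) ℝ :=
  Matrix.GeneralLinearGroup.mkOfDetNeZero !![0, 1; (D : ℝ), 0] (by simp [NeZero.ne D])

/-- The matrix `(1, b; 0, d)`. -/
def upperGL (d : ℕ) [NeZero d] (b : ℤ) : GL (Fin 2) ℝ :=
  Matrix.GeneralLinearGroup.mkOfDetNeZero !![1, (b : ℝ); 0, (d : ℝ)] (by simp [NeZero.ne d])

/-- The matrix `(d, 0; 0, 1)`. -/
def dilGL (d : ℕ) [NeZero d] : GL (Fin 2) ℝ :=
  Matrix.GeneralLinearGroup.mkOfDetNeZero !![(d : ℝ), 0; 0, 1] (by simp [NeZero.ne d])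

/-- The operator `U_d`, which replaces the Fourier coefficients `A(n)` by `A(dn)`. In the weight `k`
slash action used here `(1, b; 0, d)` carries the factor `d⁻¹`, so no normalization is needed. -/
def opU (k d : ℕ) [NeZero d] (F : ℍ → ℂ) : ℍ → ℂ :=
  ∑ j : ZMod d, F ∣[(k : ℤ)] (upperGL d (j.val : ℤ))

@[simp] lemma val_fricke [NeZero D] : (fricke D).val = !![0, 1; (D : ℝ), 0] := rfl
@[simp] lemma val_upperGL (d : ℕ) [NeZero d] (b : ℤ) :
    (upperGL d b).val = !![1, (b : ℝ); 0, (d : ℝ)] := rfl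
@[simp] lemma val_dilGL (d : ℕ) [NeZero d] : (dilGL d).val = !![(d : ℝ), 0; 0, 1] := rfl

lemma val_mapGL (γ : SL(2, ℤ)) :
    (mapGL ℝ γ).val = !![((γ 0 0 : ℤ) : ℝ), ((γ 0 1 : ℤ) : ℝ); ((γ 1 0 : ℤ) : ℝ), ((γ 1 1 : ℤ) : ℝ)] := by
  ext i j
  fin_cases i <;> fin_cases j <;> simp [mapGL]

lemma det_fricke [NeZero D] : (fricke D).det.val = -(D : ℝ) := by
  simp [Matrix.GeneralLinearGroup.val_det_apply]

lemma det_fricke_neg [NeZero D] : (fricke D).det.val < 0 := by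
  rw [det_fricke]; simpa using NeZero.pos D

lemma det_upperGL (d : ℕ) [NeZero d] (b : ℤ) : (upperGL d b).det.val = d := by
  simp [Matrix.GeneralLinearGroup.val_det_apply]

lemma det_dilGL (d : ℕ) [NeZero d] : (dilGL d).det.val = d := by
  simp [Matrix.GeneralLinearGroup.val_det_apply]

lemma fricke_mem_ratGL [NeZero D] : fricke D ∈ ratGL :=
  mem_ratGL_of_int !![0, 1; (D : ℤ), 0] fun i j => by
    fin_cases i <;> fin_cases j <;> simp

lemma upperGL_mem_ratGL (d : ℕ) [NeZero d] (b : ℤ) : upperGL d b ∈ ratGL :=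
  mem_ratGL_of_int !![1, b; 0, (d : ℤ)] fun i j => by
    fin_cases i <;> fin_cases j <;> simp

lemma slash_isZeroAtImInfty {F : ℍ → ℂ} (hF : F ∈ formSpace D k χ) {A B : GL (Fin 2) ℝ}
    (hA : A ∈ ratGL) (hB : B ∈ ratGL) :
    IsZeroAtImInfty ((F ∣[(k : ℤ)] A) ∣[(k : ℤ)] B) := by
  rw [← SlashAction.slash_mul]
  exact hF.2.2 _ (mul_mem hA hB)

lemma Gamma0_dvd {γ : SL(2, ℤ)} (hγ : γ ∈ Gamma0 D) : (D : ℤ) ∣ γ 1 0 :=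
  (ZMod.intCast_zmod_eq_zero_iff_dvd _ _).mp (Gamma0_mem.mp hγ)

lemma mem_Gamma0_of_dvd {γ : SL(2, ℤ)} (h : (D : ℤ) ∣ γ 1 0) : γ ∈ Gamma0 D :=
  Gamma0_mem.mpr ((ZMod.intCast_zmod_eq_zero_iff_dvd _ _).mpr h)

lemma det_eq (γ : SL(2, ℤ)) : γ 0 0 * γ 1 1 - γ 0 1 * γ 1 0 = 1 := by
  have := γ.det_coe
  rwa [Matrix.det_fin_two] at this

lemma exists_SL {a b c d : ℤ} (h : a * d - b * c = 1) :
    ∃ γ : SL(2, ℤ), γ 0 0 = a ∧ γ 0 1 = b ∧ γ 1 0 = c ∧ γ 1 1 = d :=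
  ⟨⟨!![a, b; c, d], by rw [Matrix.det_fin_two_of, h]⟩, rfl, rfl, rfl, rfl⟩

/-- The diagonal entries of an element of `Γ₀(D)` are inverse to each other modulo `D`. -/
lemma char_mul_char {γ : SL(2, ℤ)} (hγ : γ ∈ Gamma0 D) :
    χ ((γ 0 0 : ℤ) : ZMod D) * χ ((γ 1 1 : ℤ) : ZMod D) = 1 := by
  have h := congrArg (Int.cast : ℤ → ZMod D) (det_eq γ)
  push_cast at h
  rw [Gamma0_mem.mp hγ, mul_zero, sub_zero] at h
  rw [← map_mul, h, map_one]

lemma char_mul_conj {γ : SL(2, ℤ)} (hγ : γ ∈ Gamma0 D) [NeZero D] :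
    conj (χ ((γ 1 1 : ℤ) : ZMod D)) * χ ((γ 1 1 : ℤ) : ZMod D) = 1 := by
  have h := congrArg (Int.cast : ℤ → ZMod D) (det_eq γ)
  push_cast at h
  rw [Gamma0_mem.mp hγ, mul_zero, sub_zero] at h
  have hu : IsUnit ((γ 1 1 : ℤ) : ZMod D) := IsUnit.of_mul_eq_one_right _ h
  obtain ⟨u, hu⟩ := hu
  rw [← hu, Complex.conj_mul', DirichletCharacter.unit_norm_eq_one]
  simp

/-- The conjugate `(d, c/D; D b, a)` of `γ = (a, b; c, d)` by the matrix `(0, 1; D, 0)`. -/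
def frickeConj [NeZero D] (γ : SL(2, ℤ)) (hγ : γ ∈ Gamma0 D) : SL(2, ℤ) :=
  ⟨!![γ 1 1, γ 1 0 / D; D * γ 0 1, γ 0 0], by
    rw [Matrix.det_fin_two_of]
    have h := Int.ediv_mul_cancel (Gamma0_dvd hγ)
    linear_combination det_eq γ - γ 0 1 * h⟩

lemma frickeConj_mem [NeZero D] {γ : SL(2, ℤ)} (hγ : γ ∈ Gamma0 D) :
    frickeConj γ hγ ∈ Gamma0 D :=
  mem_Gamma0_of_dvd (by simp [frickeConj])

lemma fricke_mul_mapGL [NeZero D] {γ : SL(2, ℤ)} (hγ : γ ∈ Gamma0 D) :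
    fricke D * mapGL ℝ γ = mapGL ℝ (frickeConj γ hγ) * fricke D := by
  have hD : (D : ℝ) ≠ 0 := by simp [NeZero.ne D]
  have h : (((γ 1 0 / D : ℤ)) : ℝ) * D = ((γ 1 0 : ℤ) : ℝ) := by
    exact_mod_cast congrArg (Int.cast : ℤ → ℝ) (Int.ediv_mul_cancel (Gamma0_dvd hγ))
  ext i j
  rw [Units.val_mul, Units.val_mul, val_mapGL, val_mapGL, val_fricke]
  fin_cases i <;> fin_cases j <;> simp [frickeConj, Matrix.mul_apply, Fin.sum_univ_two, h, mul_comm]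

/-- Conjugation by the matrix exchanges the diagonal entries, which inverts the character, and the
negative determinant conjugates it; the two effects cancel. -/
lemma slash_fricke_mem [NeZero D] {F : ℍ → ℂ} (hF : F ∈ formSpace D k χ) :
    F ∣[(k : ℤ)] (fricke D) ∈ formSpace D k χ := by
  refine ⟨hF.1.slash _ _, fun γ hγ => ?_, fun B hB => slash_isZeroAtImInfty hF fricke_mem_ratGL hB⟩
  have h1 : (frickeConj γ hγ) 1 1 = γ 0 0 := rfl
  rw [← SlashAction.slash_mul, fricke_mul_mapGL hγ, SlashAction.slash_mul,
    hF.2.1 _ (frickeConj_mem hγ), smul_slash_of_neg _ _ det_fricke_neg, h1]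
  congr 1
  have e1 := char_mul_char (χ := χ) hγ
  have e2 := char_mul_conj (χ := χ) hγ
  have e3 : conj (χ ((γ 0 0 : ℤ) : ZMod D)) * conj (χ ((γ 1 1 : ℤ) : ZMod D)) = 1 := by
    rw [← map_mul, e1, map_one]
  calc _ = conj (χ ((γ 0 0 : ℤ) : ZMod D)) *
        (conj (χ ((γ 1 1 : ℤ) : ZMod D)) * χ ((γ 1 1 : ℤ) : ZMod D)) := by rw [e2, mul_one]
    _ = _ := by rw [← mul_assoc, e3, one_mul]

lemma slash_scalar (F : ℍ → ℂ) {A : GL (Fin 2) ℝ} {r : ℝ} (hr : 0 < r)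
    (hA : A.val = !![r, 0; 0, r]) (hk : 2 ≤ k) : F ∣[(k : ℤ)] A = ((r : ℂ) ^ (k - 2)) • F := by
  have hdet : A.det.val = r ^ 2 := by
    rw [Matrix.GeneralLinearGroup.val_det_apply, hA, Matrix.det_fin_two_of]; ring
  have hsm : ∀ z : ℍ, A • z = z := fun z => by
    ext
    rw [coe_smul_of_det_pos (by rw [hdet]; positivity), num, denom, hA]
    have hr' : (r : ℂ) ≠ 0 := by exact_mod_cast hr.ne'
    simp [mul_div_cancel_left₀ _ hr']
  ext z
  rw [ModularForm.slash_apply, hsm, hdet]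
  have hσ : σ A (F z) = F z := by rw [σ, hdet, if_pos (by positivity)]; rfl
  rw [hσ, denom, hA]
  simp only [Matrix.cons_val', Matrix.cons_val_zero, Matrix.cons_val_one, Matrix.of_apply, Pi.smul_apply,
    smul_eq_mul, Complex.ofReal_zero, zero_mul, zero_add, Matrix.cons_val_fin_one]
  obtain ⟨m, rfl⟩ := Nat.exists_eq_add_of_le hk
  have hr' : (r : ℂ) ≠ 0 := by exact_mod_cast hr.ne'
  rw [abs_of_pos (by positivity), zpow_neg, zpow_natCast,
    show (((2 + m : ℕ) : ℤ) - 1) = ((m + 1 : ℕ) : ℤ) by push_cast; ring, zpow_natCast,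
    Nat.add_sub_cancel_left]
  push_cast
  field_simp
  ring

lemma slash_fricke_fricke [NeZero D] (hk : 2 ≤ k) (F : ℍ → ℂ) :
    (F ∣[(k : ℤ)] (fricke D)) ∣[(k : ℤ)] (fricke D) = ((D : ℂ) ^ (k - 2)) • F := by
  rw [← SlashAction.slash_mul, slash_scalar F (r := D) (by simpa using NeZero.pos D) _ hk]
  · simp
  · rw [Units.val_mul, val_fricke]; simp

lemma T_zpow_mem_Gamma0 (n : ℤ) : ModularGroup.T ^ n ∈ Gamma0 D :=
  mem_Gamma0_of_dvd (by simp [ModularGroup.coe_T_zpow])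

lemma slash_T_zpow {F : ℍ → ℂ} (hF : F ∈ formSpace D k χ) (n : ℤ) :
    F ∣[(k : ℤ)] (mapGL ℝ (ModularGroup.T ^ n)) = F := by
  rw [hF.2.1 _ (T_zpow_mem_Gamma0 n)]
  simp [ModularGroup.coe_T_zpow]

lemma isUnit_intCast_of_isCoprime {d : ℕ} {a : ℤ} (h : IsCoprime a d) : IsUnit (a : ZMod d) := by
  obtain ⟨u, v, huv⟩ := h
  have := congrArg (Int.cast : ℤ → ZMod d) huv
  push_cast at this
  rw [ZMod.natCast_self, mul_zero, add_zero] at this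
  exact IsUnit.of_mul_eq_one_right _ this

lemma isCoprime_of_dvd_pow {d : ℕ} (hd : ∃ n : ℕ, d ∣ D ^ n) {a : ℤ} (h : IsCoprime a D) :
    IsCoprime a d := by
  obtain ⟨n, hn⟩ := hd
  have h1 : IsCoprime a ((D : ℤ) ^ n) := h.pow_right
  exact h1.of_isCoprime_of_dvd_right (by exact_mod_cast hn)

/-- The matrix identity behind the action of `Γ₀(D)` on the cosets in `U_d`: `γ` maps the coset of
`j` to that of `j' = (b + j e) / (a + j c)`, where `γ = (a, b; c, e)`. -/
lemma exists_upperGL_mul {γ : SL(2, ℤ)} (hγ : γ ∈ Gamma0 D) (d : ℕ) [NeZero d] {j j' : ℤ}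
    (h : (d : ℤ) ∣ γ 0 1 + j * γ 1 1 - (γ 0 0 + j * γ 1 0) * j') :
    ∃ γ' ∈ Gamma0 D, ((γ' 1 1 : ℤ) : ZMod D) = ((γ 1 1 : ℤ) : ZMod D) ∧
      upperGL d j * mapGL ℝ γ = mapGL ℝ γ' * upperGL d j' := by
  obtain ⟨t, ht⟩ := h
  obtain ⟨γ', h00, h01, h10, h11⟩ := exists_SL (a := γ 0 0 + j * γ 1 0) (b := t)
    (c := d * γ 1 0) (d := γ 1 1 - γ 1 0 * j') (by linear_combination det_eq γ + γ 1 0 * ht)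
  refine ⟨γ', mem_Gamma0_of_dvd ?_, ?_, ?_⟩
  · rw [h10]
    exact (Gamma0_dvd hγ).mul_left d
  · simp [h11, Gamma0_mem.mp hγ]
  · have ht' : ((γ 0 1 : ℤ) : ℝ) + j * ((γ 1 1 : ℤ) : ℝ) -
        (((γ 0 0 : ℤ) : ℝ) + j * ((γ 1 0 : ℤ) : ℝ)) * j' = d * t := by exact_mod_cast ht
    ext i l
    rw [Units.val_mul, Units.val_mul, val_mapGL, val_mapGL, val_upperGL, val_upperGL, h00, h01,
      h10, h11]
    fin_cases i <;> fin_cases l <;> simp [Matrix.mul_apply, Fin.sum_univ_two]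
    · linear_combination ht'
    · ring

/-- `U_d` preserves level and character if all prime factors of `d` divide `D`. -/
lemma opU_mem {F : ℍ → ℂ} (hF : F ∈ formSpace D k χ) (d : ℕ) [NeZero d]
    (hd : ∃ n : ℕ, d ∣ D ^ n) : opU k d F ∈ formSpace D k χ := by
  refine ⟨?_, fun γ hγ => ?_, fun B hB => ?_⟩
  · exact MDifferentiable.sum fun j _ => hF.1.slash _ _
  · have hu : ∀ j : ZMod d, IsUnit (((γ 0 0 : ℤ) : ZMod d) + j * ((γ 1 0 : ℤ) : ZMod d)) := by
      intro j
      have hc : IsCoprime (γ 0 0 + (j.val : ℤ) * γ 1 0) (γ 1 0) :=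
        ⟨γ 1 1, -γ 0 1 - j.val * γ 1 1, by linear_combination det_eq γ⟩
      have := isUnit_intCast_of_isCoprime (isCoprime_of_dvd_pow hd
        (hc.of_isCoprime_of_dvd_right (Gamma0_dvd hγ)))
      simpa using this
    -- The permutation of the cosets induced by `γ`.
    set τ : ZMod d → ZMod d := fun j => (((γ 0 1 : ℤ) : ZMod d) + j * ((γ 1 1 : ℤ) : ZMod d)) *
      (((γ 0 0 : ℤ) : ZMod d) + j * ((γ 1 0 : ℤ) : ZMod d))⁻¹ with hτ
    have hτmul : ∀ j, (((γ 0 0 : ℤ) : ZMod d) + j * ((γ 1 0 : ℤ) : ZMod d)) * τ j =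
        ((γ 0 1 : ℤ) : ZMod d) + j * ((γ 1 1 : ℤ) : ZMod d) := fun j => by
      rw [hτ]
      linear_combination (((γ 0 1 : ℤ) : ZMod d) + j * ((γ 1 1 : ℤ) : ZMod d)) *
        ZMod.mul_inv_of_unit _ (hu j)
    have hdet := congrArg (Int.cast : ℤ → ZMod d) (det_eq γ)
    push_cast at hdet
    have hinj : Function.Injective τ := by
      intro j l h
      have h1 := hτmul j
      have h2 := hτmul l
      rw [h] at h1
      linear_combination (((γ 0 0 : ℤ) : ZMod d) + j * ((γ 1 0 : ℤ) : ZMod d)) * h2 -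
        (((γ 0 0 : ℤ) : ZMod d) + l * ((γ 1 0 : ℤ) : ZMod d)) * h1 - (j - l) * hdet
    have hbij : Function.Bijective τ := Finite.injective_iff_bijective.mp hinj
    unfold opU
    rw [SlashAction.sum_slash, Finset.smul_sum]
    refine Eq.trans (Finset.sum_congr rfl fun j _ => ?_)
      (hbij.sum_comp fun j => χ ((γ 1 1 : ℤ) : ZMod D) • F ∣[(k : ℤ)] (upperGL d (j.val : ℤ)))
    obtain ⟨γ', hγ', hχ, hmul⟩ := exists_upperGL_mul hγ d (j := j.val) (j' := (τ j).val) (by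
      rw [← ZMod.intCast_zmod_eq_zero_iff_dvd]
      push_cast
      rw [ZMod.natCast_zmod_val, ZMod.natCast_zmod_val, hτmul, sub_self])
    rw [← SlashAction.slash_mul, hmul, SlashAction.slash_mul, hF.2.1 _ hγ', hχ,
      smul_slash_of_pos _ _ (by rw [det_upperGL]; simpa using NeZero.pos d)]
  · unfold opU
    rw [SlashAction.sum_slash]
    have : ∀ s : Finset (ZMod d), IsZeroAtImInfty
        (∑ j ∈ s, (F ∣[(k : ℤ)] (upperGL d (j.val : ℤ))) ∣[(k : ℤ)] B) := by
      classical
      intro s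
      induction s using Finset.induction_on with
      | empty => exact Filter.zero_zeroAtFilter _
      | insert a s ha ih =>
        rw [Finset.sum_insert ha]
        exact (slash_isZeroAtImInfty hF (upperGL_mem_ratGL d _) hB).add ih
    exact this _

end

/-! ### The Petersson product and the operators -/

section

/-- Holomorphic functions `F` on `ℍ` with `|F(z)|² y^k` bounded. Besides the cusp forms this covers
their translates by arbitrary real matrices, which are not forms of level `D`. -/
structure IsPeterssonBounded (k : ℕ) (F : ℍ → ℂ) : Prop where
  mdiff : MDiff F
  bdd : ∃ C, ∀ z, ‖petersson k F F z‖ ≤ C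

variable {D k : ℕ} {χ : DirichletCharacter ℂ D}

lemma norm_sigma (A : GL (Fin 2) ℝ) (z : ℂ) : ‖σ A z‖ = ‖z‖ := by
  unfold σ
  split_ifs
  · rfl
  · exact Complex.norm_conj z

lemma norm_petersson_self (k : ℕ) (F : ℍ → ℂ) (z : ℍ) :
    ‖petersson k F F z‖ = ‖F z‖ ^ 2 * z.im ^ k := by
  simp only [petersson, norm_mul, Complex.norm_conj, zpow_natCast, norm_pow, Complex.norm_real,
    Real.norm_of_nonneg z.im_pos.le]
  ring

lemma norm_petersson_sq (k : ℕ) (F G : ℍ → ℂ) (z : ℍ) :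
    ‖petersson k F G z‖ ^ 2 = ‖petersson k F F z‖ * ‖petersson k G G z‖ := by
  rw [norm_petersson_self, norm_petersson_self]
  simp only [petersson, norm_mul, Complex.norm_conj, zpow_natCast, norm_pow, Complex.norm_real,
    Real.norm_of_nonneg z.im_pos.le]
  ring

namespace IsPeterssonBounded

variable {F G : ℍ → ℂ}

lemma slash (hF : IsPeterssonBounded k F) (A : GL (Fin 2) ℝ) :
    IsPeterssonBounded k (F ∣[(k : ℤ)] A) := by
  refine ⟨hF.mdiff.slash _ _, ?_⟩
  obtain ⟨C, hC⟩ := hF.bdd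
  refine ⟨|A.det.val| ^ ((k : ℤ) - 2) * C, fun z => ?_⟩
  rw [petersson_slash, norm_mul, norm_sigma]
  have : ‖((|A.det.val| : ℝ) : ℂ) ^ ((k : ℤ) - 2)‖ = |A.det.val| ^ ((k : ℤ) - 2) := by
    rw [norm_zpow, Complex.norm_real, Real.norm_of_nonneg (abs_nonneg _)]
  rw [this]
  exact mul_le_mul_of_nonneg_left (hC _) (by positivity)

lemma petersson_bdd (hF : IsPeterssonBounded k F) (hG : IsPeterssonBounded k G) :
    ∃ C, ∀ z, ‖petersson k F G z‖ ≤ C := by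
  obtain ⟨C, hC⟩ := hF.bdd
  obtain ⟨C', hC'⟩ := hG.bdd
  refine ⟨√(C * C'), fun z => Real.le_sqrt_of_sq_le ?_⟩
  rw [norm_petersson_sq]
  exact mul_le_mul (hC z) (hC' z) (norm_nonneg _) ((norm_nonneg _).trans (hC z))

lemma integrable (hF : IsPeterssonBounded k F) (hG : IsPeterssonBounded k G) (μ : Measure ℍ)
    [IsFiniteMeasure μ] : Integrable (petersson k F G) μ := by
  obtain ⟨C, hC⟩ := hF.petersson_bdd hG
  exact Integrable.of_bound
    (petersson_continuous _ hF.mdiff.continuous hG.mdiff.continuous).aestronglyMeasurable C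
    (Filter.Eventually.of_forall hC)

end IsPeterssonBounded

lemma isPeterssonBounded_of_mem [NeZero D] {F : ℍ → ℂ} (hF : F ∈ formSpace D k χ) :
    IsPeterssonBounded k F := by
  obtain ⟨f, -, rfl⟩ := exists_cuspForm_of_mem_formSpace hF
  exact ⟨hF.1, CuspFormClass.petersson_bounded_left k ((Gamma1 D).map (mapGL ℝ)) f f⟩

lemma petersson_mapGL_smul (F G : ℍ → ℂ) (γ : SL(2, ℤ)) (z : ℍ) :
    petersson k F G (γ • z) =
      petersson k (F ∣[(k : ℤ)] (mapGL ℝ γ)) (G ∣[(k : ℤ)] (mapGL ℝ γ)) z :=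
  (petersson_slash_SL k F G γ z).symm

/-- If `F` and `G` are multiplied by the same character value of absolute value one, then
`conj F G` is invariant. -/
lemma petersson_smul_smul {F G : ℍ → ℂ} {c : ℂ} (hc : conj c * c = 1) (z : ℍ) :
    petersson k (c • F) (c • G) z = petersson k F G z := by
  simp only [petersson, Pi.smul_apply, smul_eq_mul, map_mul]
  linear_combination (conj (F z) * G z * (z.im : ℂ) ^ (k : ℤ)) * hc

lemma petersson_invariant [NeZero D] {F G : ℍ → ℂ} (hF : F ∈ formSpace D k χ)
    (hG : G ∈ formSpace D k χ) {γ : SL(2, ℤ)} (hγ : γ ∈ Gamma0 D) (z : ℍ) :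
    petersson k F G (γ • z) = petersson k F G z := by
  rw [petersson_mapGL_smul, hF.2.1 γ hγ, hG.2.1 γ hγ, petersson_smul_smul (char_mul_conj hγ)]

lemma measurable_petersson {F G : ℍ → ℂ} (hF : IsPeterssonBounded k F)
    (hG : IsPeterssonBounded k G) : Measurable (petersson k F G) :=
  (petersson_continuous _ hF.mdiff.continuous hG.mdiff.continuous).measurable

lemma peterssonInner_eq [NeZero D] {F G : ℍ → ℂ} (hF : IsPeterssonBounded k F)
    (hG : IsPeterssonBounded k G) :
    peterssonInner D k F G = ∫ z, petersson k F G z ∂(weightMeasure (fdWeight (Gamma0 D))) :=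
  peterssonInner_eq_integral D k F G (hF.integrable hG _)

lemma peterssonInner_symm [NeZero D] {F G : ℍ → ℂ} (hF : IsPeterssonBounded k F)
    (hG : IsPeterssonBounded k G) : peterssonInner D k G F = conj (peterssonInner D k F G) := by
  rw [peterssonInner_eq hF hG, peterssonInner_eq hG hF, ← integral_conj]
  simp only [petersson_symm (k : ℤ) F G]

lemma peterssonInner_self [NeZero D] {F : ℍ → ℂ} (hF : IsPeterssonBounded k F) :
    peterssonInner D k F F = (peterssonNormSq D k F : ℂ) :=
  (Complex.conj_eq_iff_re.mp (peterssonInner_symm hF hF).symm).symm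

lemma IsPeterssonBounded.sum_smul {ι : Type*} (s : Finset ι) (c : ι → ℂ) {G : ι → ℍ → ℂ}
    (hG : ∀ i, G i ∈ formSpace D k χ) [NeZero D] :
    IsPeterssonBounded k (∑ i ∈ s, c i • G i) :=
  isPeterssonBounded_of_mem (Submodule.sum_mem (formSpace D k χ) fun i _ =>
    Submodule.smul_mem _ _ (hG i))

lemma peterssonInner_sum_right [NeZero D] {ι : Type*} (s : Finset ι) (c : ι → ℂ) {F : ℍ → ℂ}
    {G : ι → ℍ → ℂ} (hF : F ∈ formSpace D k χ) (hG : ∀ i, G i ∈ formSpace D k χ) :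
    peterssonInner D k F (∑ i ∈ s, c i • G i) = ∑ i ∈ s, c i * peterssonInner D k F (G i) := by
  have hF' := isPeterssonBounded_of_mem hF
  have hG' := fun i => isPeterssonBounded_of_mem (hG i)
  rw [peterssonInner_eq hF' (.sum_smul s c hG)]
  simp only [fun i => peterssonInner_eq (D := D) hF' (hG' i), ← integral_const_mul]
  rw [← integral_finsetSum _ fun i _ => (hF'.integrable (hG' i) _).const_mul _]
  refine integral_congr_ae (Filter.Eventually.of_forall fun z => ?_)
  simp only [petersson, Finset.sum_apply, Pi.smul_apply, smul_eq_mul, Finset.mul_sum,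
    Finset.sum_mul]
  exact Finset.sum_congr rfl fun i _ => by ring

lemma eq_zero_of_peterssonInner_self [NeZero D] {F : ℍ → ℂ} (hF : F ∈ formSpace D k χ)
    (h : peterssonInner D k F F = 0) : F = 0 := by
  have hb := isPeterssonBounded_of_mem hF
  rw [peterssonInner_eq hb hb] at h
  have hr : ∀ z, petersson k F F z = ((‖F z‖ ^ 2 * z.im ^ k : ℝ) : ℂ) := fun z => by
    simp only [petersson, Complex.conj_mul', zpow_natCast]
    push_cast
    rfl
  have hint : Integrable (fun z : ℍ => ‖F z‖ ^ 2 * z.im ^ k)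
      (weightMeasure (fdWeight (Gamma0 D))) := by
    refine (hb.integrable hb _).norm.congr (Filter.Eventually.of_forall fun z => ?_)
    exact norm_petersson_self k F z
  simp only [hr, integral_complex_ofReal] at h
  rw [Complex.ofReal_eq_zero, integral_eq_zero_iff_of_nonneg _ hint] at h
  · have hs : MeasurableSet {z | F z ≠ 0} :=
      (hF.1.continuous.measurable (measurableSet_singleton 0)).compl
    have h0 : weightMeasure (fdWeight (Gamma0 D)) {z | F z ≠ 0} = 0 := by
      refine measure_mono_null (fun z hz => ?_) (ae_iff.mp h)
      have := z.im_pos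
      have hz' : F z ≠ 0 := hz
      simp only [Set.mem_ofPred, Pi.zero_apply]
      positivity
    -- `{F ≠ 0}` is an invariant open set on which the weight vanishes almost everywhere.
    have hv := (isFundWeight_fdWeight (Gamma0 D)).volume_eq_zero hs (fun γ hγ z => ?_) h0
    · have ho : IsOpen {z | F z ≠ 0} := isOpen_ne_fun hF.1.continuous continuous_const
      have he := (ho.measure_eq_zero_iff volume).mp hv
      ext z
      by_contra hz
      exact (Set.eq_empty_iff_forall_notMem.mp he) z hz
    · have h1 := petersson_invariant hF hF hγ z
      have e : ∀ w, F w ≠ 0 ↔ petersson k F F w ≠ 0 := fun w => by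
        have := w.im_pos.ne'
        rw [hr]
        norm_cast
        simp [this]
      exact (e _).trans (by rw [h1]; exact (e z).symm)
  · intro z
    have := z.im_pos
    simp only [Pi.zero_apply]
    positivity

/-- Change of variables by an element `g` of `GL(2, ℝ)` with `g Γ' g⁻¹ = Γ`. -/
lemma IsFundWeight.integral_comp_smul {Γ Γ' : Subgroup SL(2, ℤ)} {w w' : ℍ → ℝ≥0∞}
    (hw : IsFundWeight Γ w) (hw' : IsFundWeight Γ' w') (g : GL (Fin 2) ℝ)
    (h1 : ∀ γ ∈ Γ', ∃ γ' ∈ Γ, g * mapGL ℝ γ = mapGL ℝ γ' * g)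
    (h2 : ∀ γ' ∈ Γ, ∃ γ ∈ Γ', g * mapGL ℝ γ = mapGL ℝ γ' * g)
    {F : ℍ → ℂ} (hF : Measurable F) (hinv : ∀ γ ∈ Γ, ∀ z, F (γ • z) = F z) :
    ∫ z, F (g • z) ∂(weightMeasure w') = ∫ z, F z ∂(weightMeasure w) := by
  have hinj : Function.Injective (mapGL ℝ : SL(2, ℤ) → GL (Fin 2) ℝ) := mapGL_injective
  choose! φ hφ hφ' using h1
  have hb : Function.Bijective fun γ : Γ' => (⟨φ γ, hφ _ γ.2⟩ : Γ) := by
    constructor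
    · intro γ δ h
      have h : φ γ = φ δ := congrArg Subtype.val h
      have e := hφ' γ γ.2
      rw [h, ← hφ' δ δ.2] at e
      exact Subtype.ext (hinj (mul_left_cancel e))
    · rintro ⟨γ', hγ'⟩
      obtain ⟨γ, hγ, e⟩ := h2 γ' hγ'
      refine ⟨⟨γ, hγ⟩, Subtype.ext (hinj ?_)⟩
      exact mul_right_cancel ((hφ' γ hγ).symm.trans e)
  have hsm : ∀ γ ∈ Γ', ∀ z : ℍ, g • (γ • z) = φ γ • (g • z) := fun γ hγ z => by
    have e := congrArg (· • z) (hφ' γ hγ)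
    simp only [mul_smul] at e
    exact e
  have hw2 : IsFundWeight Γ' fun z => w (g • z) :=
    hw.comp_smul g (Equiv.ofBijective _ hb) fun γ z => hsm γ γ.2 z
  refine (hw'.integral_eq hw2 (hF.comp (measurable_GL g)) fun γ hγ z => ?_).trans
    (integral_weightMeasure_comp g F hw.measurable)
  simp only [Function.comp, hsm γ hγ, hinv _ (hφ γ hγ)]

lemma frickeConj_surj [NeZero D] {γ' : SL(2, ℤ)} (hγ' : γ' ∈ Gamma0 D) :
    ∃ γ ∈ Gamma0 D, fricke D * mapGL ℝ γ = mapGL ℝ γ' * fricke D := by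
  refine ⟨frickeConj γ' hγ', frickeConj_mem hγ', ?_⟩
  rw [fricke_mul_mapGL (frickeConj_mem hγ')]
  congr 2
  ext i j
  have h := Int.mul_ediv_cancel' (Gamma0_dvd hγ')
  have hD : (D : ℤ) ≠ 0 := by simp [NeZero.ne D]
  fin_cases i <;> fin_cases j <;> simp [frickeConj, h]
  exact Int.mul_ediv_cancel_left _ hD

/-- The bilinear form `(F, H) ↦ ⟨J F, H⟩`, with `J` the slash action of `fricke D`, is symmetric. -/
lemma peterssonInner_fricke_comm [NeZero D] (hk : 2 ≤ k) {F H : ℍ → ℂ} (hF : F ∈ formSpace D k χ)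
    (hH : H ∈ formSpace D k χ) :
    peterssonInner D k (F ∣[(k : ℤ)] (fricke D)) H =
      peterssonInner D k (H ∣[(k : ℤ)] (fricke D)) F := by
  have hD : (D : ℂ) ≠ 0 := by simp [NeZero.ne D]
  have hF' := isPeterssonBounded_of_mem hF
  have hH' := isPeterssonBounded_of_mem hH
  have hJH := slash_fricke_mem hH
  rw [peterssonInner_eq (hF'.slash _) hH', peterssonInner_eq (hH'.slash _) hF']
  have key : ∀ z, petersson k (F ∣[(k : ℤ)] (fricke D)) H z =
      petersson k (H ∣[(k : ℤ)] (fricke D)) F (fricke D • z) := fun z => by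
    -- Slash the pair `F, J H` by the involution, with `J (J H) = D^(k-2) H`; the conjugation in
    -- `σ` exchanges the two arguments.
    have h1 := petersson_slash k F (H ∣[(k : ℤ)] (fricke D)) (fricke D) z
    rw [slash_fricke_fricke hk, det_fricke, abs_neg, abs_of_nonneg (Nat.cast_nonneg D)] at h1
    have h2 : σ (fricke D) (petersson k F (H ∣[(k : ℤ)] (fricke D)) (fricke D • z)) =
        petersson k (H ∣[(k : ℤ)] (fricke D)) F (fricke D • z) := by
      rw [σ, if_neg det_fricke_neg.not_gt, petersson_symm _ F]
      rfl
    rw [h2, show ((k : ℤ) - 2) = ((k - 2 : ℕ) : ℤ) by omega, zpow_natCast] at h1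
    refine mul_left_cancel₀ (pow_ne_zero (k - 2) hD) (Eq.trans ?_ h1)
    simp only [petersson, Pi.smul_apply, smul_eq_mul]
    ring
  simp only [key]
  exact (isFundWeight_fdWeight _).integral_comp_smul (isFundWeight_fdWeight _) (fricke D)
    (fun γ hγ => ⟨_, frickeConj_mem hγ, fricke_mul_mapGL hγ⟩) (fun γ hγ => frickeConj_surj hγ)
    (measurable_petersson (isPeterssonBounded_of_mem hJH) hF')
    fun γ hγ z => petersson_invariant hJH hF hγ z

/-- A version of `IsFundWeight.sum_cosets` with the coset decomposition given elementwise. -/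
lemma IsFundWeight.sum_cosets_inv {Γ Γ' : Subgroup SL(2, ℤ)} {w : ℍ → ℝ≥0∞}
    (hw : IsFundWeight Γ w) (hle : Γ' ≤ Γ) {ι : Type*} [Fintype ι] (s : ι → SL(2, ℤ))
    (hs : ∀ i, s i ∈ Γ) (h : ∀ δ ∈ Γ, ∃! i, s i * δ ∈ Γ') :
    IsFundWeight Γ' fun z => ∑ i, w ((s i)⁻¹ • z) := by
  have hb : Function.Bijective fun p : ι × Γ' =>
      (⟨(s p.1)⁻¹ * p.2, mul_mem (inv_mem (hs _)) (hle p.2.2)⟩ : Γ) := by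
    constructor
    · rintro ⟨i, γ⟩ ⟨j, δ⟩ e
      have e : (s i)⁻¹ * (γ : SL(2, ℤ)) = (s j)⁻¹ * δ := congrArg Subtype.val e
      obtain ⟨l, -, hl⟩ := h ((s i)⁻¹ * γ) (mul_mem (inv_mem (hs _)) (hle γ.2))
      have hi := hl i (by simp)
      have hj := hl j (by rw [e]; simp)
      obtain rfl : i = j := hi.trans hj.symm
      rw [Prod.mk.injEq]
      exact ⟨rfl, Subtype.ext (mul_left_cancel e)⟩
    · rintro ⟨δ, hδ⟩
      obtain ⟨i, hi, -⟩ := h δ hδ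
      exact ⟨(i, ⟨_, hi⟩), Subtype.ext (by simp)⟩
  exact hw.sum_cosets (fun i => (s i)⁻¹) (Equiv.ofBijective _ hb) fun p => rfl

/-- Summing over translates of the argument amounts to summing the weight over translates. -/
lemma IsFundWeight.sum_integral_smul {Γ : Subgroup SL(2, ℤ)} {w : ℍ → ℝ≥0∞}
    (hw : IsFundWeight Γ w) [IsFiniteMeasure (weightMeasure w)] {ι : Type*} [Fintype ι]
    (s : ι → SL(2, ℤ)) {F : ℍ → ℂ} (hF : Continuous F) (hbd : ∃ C, ∀ z, ‖F z‖ ≤ C) :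
    ∑ i, ∫ z, F (s i • z) ∂(weightMeasure w) =
      ∫ z, F z ∂(weightMeasure fun z => ∑ i, w ((s i)⁻¹ • z)) := by
  have hm : ∀ i, Measurable fun z => w ((s i)⁻¹ • z) := fun i =>
    hw.measurable.comp (measurable_SL _)
  have hcv : ∀ i, ∀ G : ℍ → ℂ, ∫ z, G (s i • z) ∂(weightMeasure w) =
      ∫ z, G z ∂(weightMeasure fun z => w ((s i)⁻¹ • z)) := fun i G => by
    have := integral_weightMeasure_comp (mapGL ℝ (s i)) G (hm i)
    rw [← this]
    have e : ∀ z : ℍ, (s i)⁻¹ • (mapGL ℝ (s i) • z) = z := fun z => inv_smul_smul (s i) z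
    simp only [e]
    rfl
  obtain ⟨C, hC⟩ := hbd
  rw [weightMeasure_sum _ hm, integral_finsetSum_measure fun i _ => ?_]
  · exact Finset.sum_congr rfl fun i _ => hcv i F
  · have : IsFiniteMeasure (weightMeasure fun z => w ((s i)⁻¹ • z)) := by
      have hmp : (weightMeasure fun z => w ((s i)⁻¹ • z)) =
          (weightMeasure w).map (fun z => s i • z) := by
        ext t ht
        rw [Measure.map_apply (measurable_SL _) ht, weightMeasure, weightMeasure,
          withDensity_apply _ ht, withDensity_apply _ (measurable_SL _ ht)]
        have := (measurePreserving_SL (s i)).setLIntegral_comp_preimage ht (hm i)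
        simpa using this.symm
      rw [hmp]
      infer_instance
    exact Integrable.of_bound hF.aestronglyMeasurable C (Filter.Eventually.of_forall hC)

/-- The group of matrices `(a, b; c, e)` in `Γ₀(D)` with `d ∣ b`. -/
def Gamma0Upper (D d : ℕ) : Subgroup SL(2, ℤ) where
  carrier := {γ | γ ∈ Gamma0 D ∧ (d : ℤ) ∣ γ 0 1}
  mul_mem' {a b} ha hb := by
    refine ⟨mul_mem ha.1 hb.1, ?_⟩
    have : (a * b) 0 1 = a 0 0 * b 0 1 + a 0 1 * b 1 1 := by
      simp [Matrix.mul_apply, Fin.sum_univ_two]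
    rw [this]
    exact (hb.2.mul_left _).add (ha.2.mul_right _)
  one_mem' := ⟨one_mem _, by simp⟩
  inv_mem' {a} ha := by
    refine ⟨inv_mem ha.1, ?_⟩
    rw [SL2_inv_expl]
    simpa using ha.2

/-- The matrix `(1, 0; c, 1)`. -/
def lowerSL (c : ℤ) : SL(2, ℤ) := ⟨!![1, 0; c, 1], by simp⟩

lemma coe_lowerSL (c : ℤ) : (lowerSL c : Matrix (Fin 2) (Fin 2) ℤ) = !![1, 0; c, 1] := rfl

lemma lowerSL_mem (j : ℤ) : lowerSL (j * D) ∈ Gamma0 D :=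
  mem_Gamma0_of_dvd (by simp [coe_lowerSL])

lemma slash_lowerSL {F : ℍ → ℂ} (hF : F ∈ formSpace D k χ) (j : ℤ) :
    F ∣[(k : ℤ)] (mapGL ℝ (lowerSL (j * D))) = F := by
  rw [hF.2.1 _ (lowerSL_mem j)]
  simp [coe_lowerSL]

lemma upperGL_mul_fricke [NeZero D] (d : ℕ) [NeZero d] (j : ℤ) :
    upperGL d j * fricke D = upperGL d 0 * fricke D * mapGL ℝ (lowerSL (j * D)) := by
  ext i l
  simp only [Units.val_mul, val_upperGL, val_fricke, val_mapGL, coe_lowerSL]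
  fin_cases i <;> fin_cases l <;> simp

lemma upperGL_zero_mul_fricke [NeZero D] (d : ℕ) [NeZero d] :
    upperGL d 0 * fricke D = fricke D * dilGL d := by
  ext i l
  simp only [Units.val_mul, val_upperGL, val_fricke, val_dilGL]
  fin_cases i <;> fin_cases l <;> simp [mul_comm]

lemma upperGL_eq_zero_mul (d : ℕ) [NeZero d] (j : ℤ) :
    upperGL d j = upperGL d 0 * mapGL ℝ (ModularGroup.T ^ j) := by
  ext i l
  simp only [Units.val_mul, val_upperGL, val_mapGL, ModularGroup.coe_T_zpow]
  fin_cases i <;> fin_cases l <;> simp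

lemma upperGL_zero_mul_dilGL_val (d : ℕ) [NeZero d] :
    (upperGL d 0 * dilGL d).val = !![(d : ℝ), 0; 0, (d : ℝ)] := by
  simp [Units.val_mul]

/-- Conjugation by `(d, 0; 0, 1)` maps `Γ₀(dD)` onto `{(a, b; c, e) ∈ Γ₀(D) : d ∣ b}`. -/
lemma dilGL_mul_mapGL [NeZero D] (d : ℕ) [NeZero d] {γ : SL(2, ℤ)} (hγ : γ ∈ Gamma0 (d * D)) :
    ∃ γ' ∈ Gamma0Upper D d, dilGL d * mapGL ℝ γ = mapGL ℝ γ' * dilGL d := by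
  obtain ⟨t, ht⟩ := Gamma0_dvd hγ
  obtain ⟨γ', h00, h01, h10, h11⟩ := exists_SL (a := γ 0 0) (b := d * γ 0 1)
    (c := D * t) (d := γ 1 1) (by push_cast at ht; linear_combination det_eq γ + γ 0 1 * ht)
  refine ⟨γ', ⟨mem_Gamma0_of_dvd (by simp [h10]), by simp [h01]⟩, ?_⟩
  have ht' : ((γ 1 0 : ℤ) : ℝ) = d * D * t := by exact_mod_cast congrArg (Int.cast : ℤ → ℝ) ht
  ext i l
  simp only [Units.val_mul, val_mapGL, val_dilGL, h00, h01, h10, h11, ht']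
  fin_cases i <;> fin_cases l <;> simp
  all_goals ring

lemma dilGL_mul_mapGL_surj [NeZero D] (d : ℕ) [NeZero d] {γ' : SL(2, ℤ)}
    (hγ' : γ' ∈ Gamma0Upper D d) :
    ∃ γ ∈ Gamma0 (d * D), dilGL d * mapGL ℝ γ = mapGL ℝ γ' * dilGL d := by
  obtain ⟨t, ht⟩ := hγ'.2
  obtain ⟨γ, h00, h01, h10, h11⟩ := exists_SL (a := γ' 0 0) (b := t)
    (c := d * γ' 1 0) (d := γ' 1 1) (by linear_combination det_eq γ' + γ' 1 0 * ht)
  refine ⟨γ, mem_Gamma0_of_dvd ?_, ?_⟩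
  · rw [h10]
    push_cast
    exact mul_dvd_mul_left _ (Gamma0_dvd hγ'.1)
  have ht' : ((γ' 0 1 : ℤ) : ℝ) = d * t := by exact_mod_cast congrArg (Int.cast : ℤ → ℝ) ht
  ext i l
  simp only [Units.val_mul, val_mapGL, val_dilGL, h00, h01, h10, h11, ht']
  fin_cases i <;> fin_cases l <;> simp
  all_goals ring

lemma existsUnique_zmod {d : ℕ} [NeZero d] {a b : ℤ} (ha : IsUnit (a : ZMod d)) :
    ∃! j : ZMod d, (d : ℤ) ∣ b + j.val * a := by
  have e : ∀ j : ZMod d, (d : ℤ) ∣ b + j.val * a ↔ (b : ZMod d) + j * a = 0 := fun j => by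
    rw [← ZMod.intCast_zmod_eq_zero_iff_dvd]
    push_cast
    rw [ZMod.natCast_zmod_val]
  obtain ⟨u, hu⟩ := ha
  have hinv : (↑u⁻¹ : ZMod d) * u = 1 := Units.inv_mul u
  refine ⟨-b * ↑u⁻¹, (e _).mpr ?_, fun j hj => ?_⟩
  · rw [← hu]
    linear_combination (-(b : ZMod d)) * hinv
  · have := (e j).mp hj
    rw [← hu] at this
    linear_combination (↑u⁻¹ : ZMod d) * this - j * hinv

lemma isUnit_diag {γ : SL(2, ℤ)} (hγ : γ ∈ Gamma0 D) {d : ℕ} (hd : ∃ n : ℕ, d ∣ D ^ n) :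
    IsUnit ((γ 0 0 : ℤ) : ZMod d) ∧ IsUnit ((γ 1 1 : ℤ) : ZMod d) := by
  obtain ⟨t, ht⟩ := Gamma0_dvd hγ
  exact ⟨isUnit_intCast_of_isCoprime (isCoprime_of_dvd_pow hd
      ⟨γ 1 1, -γ 0 1 * t, by linear_combination det_eq γ + γ 0 1 * ht⟩),
    isUnit_intCast_of_isCoprime (isCoprime_of_dvd_pow hd
      ⟨γ 0 0, -γ 0 1 * t, by linear_combination det_eq γ + γ 0 1 * ht⟩)⟩

lemma peterssonInner_sum_slash_left [NeZero D] {ι : Type*} [Fintype ι] {F : ι → ℍ → ℂ}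
    {H : ℍ → ℂ} (hF : ∀ i, IsPeterssonBounded k (F i)) (hH : IsPeterssonBounded k H)
    (hs : IsPeterssonBounded k (∑ i, F i)) :
    peterssonInner D k (∑ i, F i) H =
      ∑ i, ∫ z, petersson k (F i) H z ∂(weightMeasure (fdWeight (Gamma0 D))) := by
  rw [peterssonInner_eq hs hH, ← integral_finsetSum _ fun i _ => (hF i).integrable hH _]
  refine integral_congr_ae (Filter.Eventually.of_forall fun z => ?_)
  simp only [petersson, Finset.sum_apply, map_sum, Finset.sum_mul]

/-- The operators `U_d`, where every prime factor of `d` divides `D`, are self-adjoint for the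
bilinear form `(F, H) ↦ ⟨J F, H⟩`: both sides are the integral of the same function over
`{(a, b; c, e) ∈ Γ₀(D) : d ∣ b}\ℍ`. -/
lemma peterssonInner_fricke_opU [NeZero D] (hk : 2 ≤ k) {F H : ℍ → ℂ} (hF : F ∈ formSpace D k χ)
    (hH : H ∈ formSpace D k χ) (d : ℕ) [NeZero d] (hd : ∃ n : ℕ, d ∣ D ^ n) :
    peterssonInner D k (opU k d F ∣[(k : ℤ)] (fricke D)) H =
      peterssonInner D k (F ∣[(k : ℤ)] (fricke D)) (opU k d H) := by
  have hF' := isPeterssonBounded_of_mem hF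
  have hH' := isPeterssonBounded_of_mem hH
  have hJF := slash_fricke_mem hF
  have hJF' := isPeterssonBounded_of_mem hJF
  have hw := isFundWeight_fdWeight (Gamma0 D)
  -- The terms of the left side are translates of `G`, those of the right side are translates of
  -- `P`, and `z ↦ dz` carries `P` to `G`.
  set G : ℍ → ℂ := petersson k (F ∣[(k : ℤ)] (upperGL d 0 * fricke D)) H with hG
  set P : ℍ → ℂ := petersson k (F ∣[(k : ℤ)] (fricke D)) (H ∣[(k : ℤ)] (upperGL d 0)) with hP
  have hPm := measurable_petersson hJF' (hH'.slash (upperGL d 0))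
  have hGP : ∀ z, G z = P (dilGL d • z) := fun z => by
    have hd0 : (d : ℂ) ≠ 0 := by simp [NeZero.ne d]
    have h1 := petersson_slash k (F ∣[(k : ℤ)] (fricke D)) (H ∣[(k : ℤ)] (upperGL d 0)) (dilGL d) z
    rw [← SlashAction.slash_mul, ← SlashAction.slash_mul, ← upperGL_zero_mul_fricke,
      slash_scalar H (r := d) (by simpa using NeZero.pos d) (upperGL_zero_mul_dilGL_val d) hk,
      det_dilGL, abs_of_nonneg (Nat.cast_nonneg d), σ, det_dilGL,
      if_pos (by simpa using NeZero.pos d),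
      show ((k : ℤ) - 2) = ((k - 2 : ℕ) : ℤ) by omega, zpow_natCast] at h1
    refine mul_left_cancel₀ (pow_ne_zero (k - 2) hd0) (Eq.trans ?_ h1)
    simp only [hG, petersson, Pi.smul_apply, smul_eq_mul]
    push_cast
    ring
  have hleft : peterssonInner D k (opU k d F ∣[(k : ℤ)] (fricke D)) H =
      ∑ j : ZMod d, ∫ z, G (lowerSL ((j.val : ℤ) * D) • z)
        ∂(weightMeasure (fdWeight (Gamma0 D))) := by
    have e : opU k d F ∣[(k : ℤ)] (fricke D) =
        ∑ j : ZMod d, (F ∣[(k : ℤ)] (upperGL d (j.val : ℤ))) ∣[(k : ℤ)] (fricke D) :=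
      SlashAction.sum_slash _ _
    rw [e, peterssonInner_sum_slash_left (fun j => (hF'.slash _).slash _) hH'
      (by rw [← e]; exact (isPeterssonBounded_of_mem (opU_mem hF d hd)).slash _)]
    refine Finset.sum_congr rfl fun j _ => ?_
    congr 1
    funext z
    rw [hG, petersson_mapGL_smul, slash_lowerSL hH, ← SlashAction.slash_mul,
      ← SlashAction.slash_mul, upperGL_mul_fricke]
  have hright : peterssonInner D k (F ∣[(k : ℤ)] (fricke D)) (opU k d H) =
      ∑ j : ZMod d, ∫ z, P ((ModularGroup.T ^ (j.val : ℤ)) • z)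
        ∂(weightMeasure (fdWeight (Gamma0 D))) := by
    rw [peterssonInner_symm (isPeterssonBounded_of_mem (opU_mem hH d hd)) hJF']
    have hb := isPeterssonBounded_of_mem (opU_mem hH d hd)
    unfold opU at hb ⊢
    rw [peterssonInner_sum_slash_left (fun j => hH'.slash _) hJF' hb, map_sum]
    refine Finset.sum_congr rfl fun j _ => ?_
    rw [← integral_conj]
    congr 1
    funext z
    rw [hP, petersson_mapGL_smul, slash_T_zpow hJF, ← SlashAction.slash_mul,
      ← upperGL_eq_zero_mul, ← petersson_symm]
  have hPinv : ∀ γ ∈ Gamma0Upper D d, ∀ z, P (γ • z) = P z := fun γ hγ z => by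
    obtain ⟨γ', hγ', hχ, hmul⟩ := exists_upperGL_mul hγ.1 d (j := 0) (j' := 0)
      (by simpa using hγ.2)
    rw [hP, petersson_mapGL_smul, hJF.2.1 γ hγ.1, ← SlashAction.slash_mul, hmul,
      SlashAction.slash_mul, hH.2.1 γ' hγ', hχ,
      smul_slash_of_pos _ _ (by rw [det_upperGL]; simpa using NeZero.pos d),
      petersson_smul_smul (char_mul_conj hγ.1)]
  -- The translations `T^j`, `j` modulo `d`, represent the cosets of `Γ₀(D)` by the subgroup
  -- `d ∣ b`, because the lower right entry is invertible modulo `d`.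
  have hw1 : IsFundWeight (Gamma0Upper D d) fun z => ∑ j : ZMod d,
      fdWeight (Gamma0 D) ((ModularGroup.T ^ (j.val : ℤ))⁻¹ • z) := by
    refine hw.sum_cosets_inv (fun γ (hγ : γ ∈ Gamma0Upper D d) => hγ.1) _ (fun j => T_zpow_mem_Gamma0 _) fun δ hδ => ?_
    have := existsUnique_zmod (b := δ 0 1) (isUnit_diag hδ hd).2
    convert this using 2 with j
    have e : (ModularGroup.T ^ (j.val : ℤ) * δ) 0 1 = δ 0 1 + j.val * δ 1 1 := by
      simp [ModularGroup.coe_T_zpow, Matrix.mul_apply, Fin.sum_univ_two]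
    refine ⟨fun h => by rw [← e]; exact h.2, fun h => ⟨mul_mem (T_zpow_mem_Gamma0 _) hδ, ?_⟩⟩
    rwa [e]
  -- In the same way the matrices `(1, 0; jD, 1)` represent the cosets by `Γ₀(dD)`.
  have hw2 : IsFundWeight (Gamma0 (d * D)) fun z => ∑ j : ZMod d,
      fdWeight (Gamma0 D) ((lowerSL ((j.val : ℤ) * D))⁻¹ • z) := by
    refine hw.sum_cosets_inv (fun γ hγ => mem_Gamma0_of_dvd ?_) _ (fun j => lowerSL_mem _)
      fun δ hδ => ?_
    · have := Gamma0_dvd hγ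
      push_cast at this
      exact dvd_of_mul_left_dvd this
    · obtain ⟨t, ht⟩ := Gamma0_dvd hδ
      have := existsUnique_zmod (b := t) (isUnit_diag hδ hd).1
      convert this using 2 with j
      have e : (lowerSL ((j.val : ℤ) * D) * δ) 1 0 = D * (t + j.val * δ 0 0) := by
        have : (lowerSL ((j.val : ℤ) * D) * δ) 1 0 = (j.val : ℤ) * D * δ 0 0 + δ 1 0 := by
          simp [coe_lowerSL, Matrix.mul_apply, Fin.sum_univ_two]
        rw [this, ht]
        ring
      have hD : (D : ℤ) ≠ 0 := by simp [NeZero.ne D]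
      rw [← mul_dvd_mul_iff_left hD, ← e, mul_comm (D : ℤ), ← Nat.cast_mul]
      exact ⟨Gamma0_dvd, mem_Gamma0_of_dvd⟩
  have hFd := hF'.slash (upperGL d 0 * fricke D)
  have hHd := hH'.slash (upperGL d 0)
  rw [hleft, hright,
    hw.sum_integral_smul _ (petersson_continuous _ hFd.mdiff.continuous hH'.mdiff.continuous)
      (hFd.petersson_bdd hH'),
    hw.sum_integral_smul _ (petersson_continuous _ hJF'.mdiff.continuous hHd.mdiff.continuous)
      (hJF'.petersson_bdd hHd)]
  simp only [← hG, ← hP, hGP]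
  exact hw1.integral_comp_smul hw2 (dilGL d) (fun γ hγ => dilGL_mul_mapGL d hγ)
    (fun γ hγ => dilGL_mul_mapGL_surj d hγ) hPm hPinv

end

/-! ### Fourier coefficients -/

section

/-- The Fourier coefficient `A(n)` in `F(z) = ∑ A(n) e(nz)`. -/
def coef (F : ℍ → ℂ) (n : ℕ) : ℂ := (qExpansion 1 F).coeff n

/-- Holomorphic functions on `ℍ` of period one that vanish at `i∞`. -/
structure IsCuspPeriodic (F : ℍ → ℂ) : Prop where
  mdiff : MDiff F
  periodic : ∀ z : ℍ, F ((1 : ℝ) +ᵥ z) = F z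
  zero : IsZeroAtImInfty F

variable {D k : ℕ} {χ : DirichletCharacter ℂ D}

lemma qParam_pow (z : ℂ) (n : ℕ) :
    Function.Periodic.qParam 1 z ^ n = Complex.exp (2 * Real.pi * Complex.I * (n * z)) := by
  rw [Function.Periodic.qParam, ← Complex.exp_nat_mul]
  congr 1
  push_cast
  ring

namespace IsCuspPeriodic

variable {F G : ℍ → ℂ}

lemma periodic_ofComplex (hF : IsCuspPeriodic F) :
    Function.Periodic (F ∘ ofComplex) ((1 : ℝ) : ℂ) := by
  intro w
  by_cases! hw : 0 < w.im
  · have : 0 < (w + ((1 : ℝ) : ℂ)).im := by simpa using hw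
    simp only [Function.comp_apply, ofComplex_apply_of_im_pos this, ofComplex_apply_of_im_pos hw]
    rw [← hF.periodic ⟨w, hw⟩]
    congr 1
    ext
    simp [add_comm]
  · have : (w + ((1 : ℝ) : ℂ)).im ≤ 0 := by simpa using hw
    simp only [Function.comp_apply, ofComplex_apply_of_im_nonpos this,
      ofComplex_apply_of_im_nonpos hw]

lemma analyticAt (hF : IsCuspPeriodic F) : AnalyticAt ℂ (cuspFunction 1 F) 0 :=
  analyticAt_cuspFunction_zero one_pos hF.periodic_ofComplex hF.mdiff hF.zero.isBoundedAtImInfty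

lemma hasSum (hF : IsCuspPeriodic F) (z : ℍ) :
    HasSum (fun n : ℕ => coef F n * Complex.exp (2 * Real.pi * Complex.I * (n * z))) (F z) := by
  have h := hasSum_qExpansion one_pos hF.periodic_ofComplex hF.mdiff hF.zero.isBoundedAtImInfty z
  simpa only [coef, smul_eq_mul, qParam_pow] using h

lemma coef_unique (hF : IsCuspPeriodic F) {c : ℕ → ℂ}
    (h : ∀ z : ℍ, HasSum (fun n : ℕ => c n * Complex.exp (2 * Real.pi * Complex.I * (n * z))) (F z))
    (n : ℕ) : coef F n = c n := by
  have h' : ∀ z : ℍ, HasSum (fun n : ℕ => c n • Function.Periodic.qParam 1 z ^ n) (F z) := fun z => by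
    simpa only [smul_eq_mul, qParam_pow] using h z
  have h1 := (hasFPowerSeriesOnBall_cuspFunction one_pos hF.analyticAt h').hasFPowerSeriesAt
  have h2 := h1.eq_formalMultilinearSeries hF.analyticAt.hasFPowerSeriesAt
  have h3 := congrArg (fun p => FormalMultilinearSeries.coeff p n) h2
  simp only [FormalMultilinearSeries.coeff_ofScalars] at h3
  rw [coef, qExpansion_coeff, h3]
  ring

lemma coef_zero (hF : IsCuspPeriodic F) : coef F 0 = 0 := by
  unfold coef
  rw [qExpansion_coeff_zero one_pos hF.analyticAt hF.periodic_ofComplex]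
  exact hF.zero.valueAtInfty_eq_zero

lemma sum {ι : Type*} (s : Finset ι) {F : ι → ℍ → ℂ} (hF : ∀ i ∈ s, IsCuspPeriodic (F i)) :
    IsCuspPeriodic (∑ i ∈ s, F i) where
  mdiff := by
    classical
    induction s using Finset.induction_on with
    | empty => exact mdifferentiable_const
    | insert a s ha ih =>
      rw [Finset.sum_insert ha]
      exact (hF a (Finset.mem_insert_self a s)).mdiff.add
        (ih fun i hi => hF i (Finset.mem_insert_of_mem hi))
  periodic z := by
    simp only [Finset.sum_apply]
    exact Finset.sum_congr rfl fun i hi => (hF i hi).periodic z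
  zero := by
    have := tendsto_finsetSum s fun i hi => (hF i hi).zero
    unfold IsZeroAtImInfty Filter.ZeroAtFilter
    convert this using 1
    · ext z; simp
    · simp

lemma coef_sum {ι : Type*} (s : Finset ι) {F : ι → ℍ → ℂ} (hF : ∀ i ∈ s, IsCuspPeriodic (F i))
    (n : ℕ) : coef (∑ i ∈ s, F i) n = ∑ i ∈ s, coef (F i) n := by
  refine (sum s hF).coef_unique (c := fun n => ∑ i ∈ s, coef (F i) n) (fun z => ?_) n
  simp only [Finset.sum_mul, Finset.sum_apply]
  exact hasSum_sum fun i hi => (hF i hi).hasSum z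

lemma smul (hF : IsCuspPeriodic F) (c : ℂ) : IsCuspPeriodic (c • F) where
  mdiff := hF.mdiff.const_smul c
  periodic z := by simp only [Pi.smul_apply, hF.periodic z]
  zero := hF.zero.smul c

lemma coef_smul (hF : IsCuspPeriodic F) (c : ℂ) (n : ℕ) : coef (c • F) n = c * coef F n := by
  refine (hF.smul c).coef_unique (c := fun n => c * coef F n) (fun z => ?_) n
  simpa only [Pi.smul_apply, smul_eq_mul, mul_assoc] using (hF.hasSum z).mul_left c

/-- A function of period `1/g` has no Fourier coefficients of index prime to `g`. -/
lemma coef_eq_zero (hF : IsCuspPeriodic F) {g : ℕ} (hg : 1 < g)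
    (hper : ∀ z : ℍ, F ((1 / g : ℝ) +ᵥ z) = F z) {n : ℕ} (hn : n.Coprime g) : coef F n = 0 := by
  have h1 := hF.coef_unique (c := fun n => coef F n *
    Complex.exp (2 * Real.pi * Complex.I * (n * (1 / g)))) (fun z => ?_) n
  · have hz : Complex.exp (2 * Real.pi * Complex.I * (n * (1 / g))) ≠ 1 := by
      intro h
      rw [Complex.exp_eq_one_iff] at h
      obtain ⟨m, hm⟩ := h
      have hg0 : (g : ℂ) ≠ 0 := by exact_mod_cast (by omega : g ≠ 0)
      have hp : (2 * Real.pi * Complex.I : ℂ) ≠ 0 := Complex.two_pi_I_ne_zero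
      have e : (n : ℂ) = m * g := by
        field_simp at hm
        linear_combination hm
      have e' : (n : ℤ) = m * g := by exact_mod_cast e
      have hd : g ∣ n := Int.natCast_dvd_natCast.mp ⟨m, by linarith⟩
      have := Nat.eq_one_of_dvd_coprimes hn hd dvd_rfl
      omega
    by_contra hc
    exact hz (mul_left_cancel₀ hc (by rw [mul_one]; exact h1.symm))
  · have := hF.hasSum ((1 / g : ℝ) +ᵥ z)
    rw [hper z] at this
    convert this using 2 with n
    rw [mul_assoc, ← Complex.exp_add, coe_vadd]
    congr 2
    push_cast
    ring

end IsCuspPeriodic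

/-- The matrix `(1, t; 0, 1)`. -/
def transGL (t : ℝ) : GL (Fin 2) ℝ :=
  Matrix.GeneralLinearGroup.mkOfDetNeZero !![1, t; 0, 1] (by simp)

@[simp] lemma val_transGL (t : ℝ) : (transGL t).val = !![1, t; 0, 1] := rfl

lemma det_transGL (t : ℝ) : (transGL t).det.val = 1 := by
  simp [Matrix.GeneralLinearGroup.val_det_apply]

lemma slash_transGL (F : ℍ → ℂ) (t : ℝ) (z : ℍ) : (F ∣[(k : ℤ)] (transGL t)) z = F (t +ᵥ z) := by
  have h : transGL t • z = t +ᵥ z := by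
    ext
    rw [coe_smul_of_det_pos (by rw [det_transGL]; exact one_pos), num, denom, val_transGL]
    simp [add_comm]
  rw [ModularForm.slash_apply, h, det_transGL, denom, val_transGL, σ, det_transGL, if_pos one_pos]
  simp

lemma transGL_one : transGL 1 = mapGL ℝ (ModularGroup.T ^ (1 : ℤ)) := by
  ext i j
  rw [val_mapGL, val_transGL]
  simp only [ModularGroup.coe_T_zpow]
  fin_cases i <;> fin_cases j <;> simp

lemma isCuspPeriodic_of_mem {F : ℍ → ℂ} (hF : F ∈ formSpace D k χ) : IsCuspPeriodic F where
  mdiff := hF.1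
  periodic z := by
    rw [← slash_transGL (k := k) F, transGL_one, slash_T_zpow hF]
  zero := by
    have := hF.2.2 1 (one_mem _)
    rwa [SlashAction.slash_one] at this

lemma coef_sum_smul {ι : Type*} (s : Finset ι) (c : ι → ℂ) {G : ι → ℍ → ℂ}
    (hG : ∀ i, G i ∈ formSpace D k χ) (n : ℕ) :
    coef (∑ i ∈ s, c i • G i) n = ∑ i ∈ s, c i * coef (G i) n := by
  rw [IsCuspPeriodic.coef_sum s fun i _ => (isCuspPeriodic_of_mem (hG i)).smul (c i)]
  exact Finset.sum_congr rfl fun i _ => (isCuspPeriodic_of_mem (hG i)).coef_smul _ _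

lemma coe_upperGL_smul (d : ℕ) [NeZero d] (b : ℤ) (z : ℍ) :
    ((upperGL d b • z : ℍ) : ℂ) = (z + b) / d := by
  rw [coe_smul_of_det_pos (by rw [det_upperGL]; simpa using NeZero.pos d), num, denom, val_upperGL]
  simp

lemma slash_upperGL_apply (F : ℍ → ℂ) (d : ℕ) [NeZero d] (b : ℤ) (z : ℍ) :
    (F ∣[(k : ℤ)] (upperGL d b)) z = (d : ℂ)⁻¹ * F (upperGL d b • z) := by
  have hd : (d : ℂ) ≠ 0 := by simp [NeZero.ne d]
  rw [ModularForm.slash_apply, det_upperGL, denom, val_upperGL, σ, det_upperGL,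
    if_pos (by simpa using NeZero.pos d), abs_of_nonneg (Nat.cast_nonneg d)]
  simp only [Matrix.cons_val', Matrix.cons_val_zero, Matrix.cons_val_one, Matrix.of_apply,
    Matrix.cons_val_fin_one, Complex.ofReal_zero, zero_mul, zero_add, Complex.ofReal_natCast]
  rw [zpow_sub₀ hd, zpow_neg, zpow_one]
  field_simp
  rfl

/-- The sum of `e(nj/d)` over `j` modulo `d` detects divisibility of `n` by `d`. -/
lemma sum_exp_zmod (d : ℕ) [NeZero d] (n : ℕ) :
    ∑ j : ZMod d, Complex.exp (2 * Real.pi * Complex.I * (n * (j.val : ℂ) / d)) =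
      if d ∣ n then (d : ℂ) else 0 := by
  have h := AddChar.sum_mulShift (R := ZMod d) (n : ZMod d) (ZMod.isPrimitive_stdAddChar d)
  rw [ZMod.card] at h
  simp only [ZMod.natCast_eq_zero_iff] at h
  refine (Finset.sum_congr rfl fun j _ => ?_).trans (h.trans (by push_cast; rfl))
  have e : j * (n : ZMod d) = ((j.val * n : ℤ) : ZMod d) := by
    push_cast; rw [ZMod.natCast_zmod_val]
  rw [e, ZMod.stdAddChar_coe]
  congr 1
  push_cast
  ring

lemma coef_opU {F : ℍ → ℂ} (hF : F ∈ formSpace D k χ) (d : ℕ) [NeZero d]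
    (hd : ∃ n : ℕ, d ∣ D ^ n) (n : ℕ) : coef (opU k d F) n = coef F (d * n) := by
  have hd0 : (d : ℂ) ≠ 0 := by simp [NeZero.ne d]
  refine (isCuspPeriodic_of_mem (opU_mem hF d hd)).coef_unique (c := fun n => coef F (d * n))
    (fun z => ?_) n
  have h1 : HasSum (fun n : ℕ => ∑ j : ZMod d, (d : ℂ)⁻¹ * (coef F n *
      Complex.exp (2 * Real.pi * Complex.I * (n * (upperGL d (j.val : ℤ) • z : ℍ))))) (opU k d F z) := by
    unfold opU
    simp only [Finset.sum_apply, slash_upperGL_apply]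
    exact hasSum_sum fun j _ => ((isCuspPeriodic_of_mem hF).hasSum _).mul_left _
  -- Orthogonality of characters leaves the terms with `d ∣ n`.
  have h2 : ∀ n : ℕ, ∑ j : ZMod d, (d : ℂ)⁻¹ * (coef F n *
      Complex.exp (2 * Real.pi * Complex.I * (n * (upperGL d (j.val : ℤ) • z : ℍ)))) =
      if d ∣ n then coef F n * Complex.exp (2 * Real.pi * Complex.I * (n * z / d)) else 0 := by
    intro n
    have e : ∀ j : ZMod d, (d : ℂ)⁻¹ * (coef F n *
        Complex.exp (2 * Real.pi * Complex.I * (n * (upperGL d (j.val : ℤ) • z : ℍ)))) =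
        (d : ℂ)⁻¹ * (coef F n * Complex.exp (2 * Real.pi * Complex.I * (n * z / d))) *
          Complex.exp (2 * Real.pi * Complex.I * (n * (j.val : ℂ) / d)) := fun j => by
      have e' : Complex.exp (2 * Real.pi * Complex.I * (n * (upperGL d (j.val : ℤ) • z : ℍ))) =
          Complex.exp (2 * Real.pi * Complex.I * (n * z / d)) *
          Complex.exp (2 * Real.pi * Complex.I * (n * (j.val : ℂ) / d)) := by
        rw [coe_upperGL_smul, ← Complex.exp_add]
        congr 1
        push_cast
        ring
      rw [e']
      ring
    simp only [e, ← Finset.mul_sum, sum_exp_zmod]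
    split_ifs
    · field_simp
    · rw [mul_zero]
  simp only [h2] at h1
  have hinj : Function.Injective fun n : ℕ => d * n := fun a b h =>
    Nat.eq_of_mul_eq_mul_left (NeZero.pos d) h
  rw [← hinj.hasSum_iff] at h1
  · convert h1 using 2 with n
    simp only [Function.comp, dvd_mul_right, if_true]
    congr 3
    push_cast
    field_simp
  · intro n hn
    rw [if_neg]
    rintro ⟨m, rfl⟩
    exact hn ⟨m, rfl⟩

/-! ### The coefficients of `J U_D F` of index prime to `D` -/

/-- The matrix `(D, e; 0, -D)`, which acts on `ℍ` by `z ↦ -z̄ - e/D`. -/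
def reflGL (D : ℕ) [NeZero D] (e : ℤ) : GL (Fin 2) ℝ :=
  Matrix.GeneralLinearGroup.mkOfDetNeZero !![(D : ℝ), (e : ℝ); 0, -(D : ℝ)] (by simp [NeZero.ne D])

@[simp] lemma val_reflGL (D : ℕ) [NeZero D] (e : ℤ) :
    (reflGL D e).val = !![(D : ℝ), (e : ℝ); 0, -(D : ℝ)] := rfl

lemma det_reflGL (D : ℕ) [NeZero D] (e : ℤ) : (reflGL D e).det.val = -(D : ℝ) ^ 2 := by
  simp [Matrix.GeneralLinearGroup.val_det_apply, sq]

lemma det_reflGL_neg (D : ℕ) [NeZero D] (e : ℤ) : (reflGL D e).det.val < 0 := by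
  rw [det_reflGL]
  have : (0 : ℝ) < D := by simpa using NeZero.pos D
  nlinarith

lemma coe_reflGL_smul (D : ℕ) [NeZero D] (e : ℤ) (z : ℍ) :
    ((reflGL D e • z : ℍ) : ℂ) = -conj (z : ℂ) - e / D := by
  have hD : (D : ℂ) ≠ 0 := by simp [NeZero.ne D]
  rw [coe_smul, σ, if_neg (det_reflGL_neg D e).not_gt, num, denom, val_reflGL]
  simp
  field_simp
  ring

lemma slash_reflGL_apply (hk : 2 ≤ k) (F : ℍ → ℂ) (D : ℕ) [NeZero D] (e : ℤ) (z : ℍ) :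
    (F ∣[(k : ℤ)] (reflGL D e)) z =
      (-1) ^ k * (D : ℂ) ^ (k - 2) * conj (F (reflGL D e • z)) := by
  have hD : (D : ℂ) ≠ 0 := by simp [NeZero.ne D]
  have hσ : σ (reflGL D e) (F (reflGL D e • z)) = conj (F (reflGL D e • z)) := by
    rw [σ, if_neg (det_reflGL_neg D e).not_gt]; rfl
  rw [ModularForm.slash_apply, hσ, det_reflGL, denom, val_reflGL, abs_neg,
    abs_of_nonneg (sq_nonneg _)]
  simp only [Matrix.cons_val', Matrix.cons_val_zero, Matrix.cons_val_one, Matrix.of_apply,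
    Matrix.cons_val_fin_one, Complex.ofReal_zero, zero_mul, zero_add, Complex.ofReal_natCast,
    Complex.ofReal_neg, Complex.ofReal_pow]
  obtain ⟨m, rfl⟩ := Nat.exists_eq_add_of_le hk
  rw [Nat.add_sub_cancel_left, show (((2 + m : ℕ) : ℤ) - 1) = ((m + 1 : ℕ) : ℤ) by push_cast; ring,
    zpow_neg, zpow_natCast, zpow_natCast, neg_pow (D : ℂ), mul_inv]
  have h1 : ((-1 : ℂ) ^ (2 + m))⁻¹ = (-1) ^ (2 + m) := by
    rw [← inv_pow]; norm_num
  rw [h1]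
  field_simp
  ring

/-- For `g ∣ b` and `g ∣ D`, the function `F|(1, b; 0, D)(0, 1; D, 0)` has period `1/g`. -/
lemma slash_upperGL_fricke_periodic [NeZero D] {F : ℍ → ℂ} (hF : F ∈ formSpace D k χ) {b : ℤ}
    {g : ℕ} (hgb : (g : ℤ) ∣ b) (hgD : g ∣ D) (z : ℍ) :
    ((F ∣[(k : ℤ)] (upperGL D b)) ∣[(k : ℤ)] (fricke D)) ((1 / g : ℝ) +ᵥ z) =
      ((F ∣[(k : ℤ)] (upperGL D b)) ∣[(k : ℤ)] (fricke D)) z := by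
  obtain ⟨b', rfl⟩ := hgb
  have hD0 : (D : ℝ) ≠ 0 := by simp [NeZero.ne D]
  obtain ⟨D', hD'⟩ := hgD
  have hg0 : (g : ℝ) ≠ 0 := by
    rintro h
    rw [Nat.cast_eq_zero] at h
    exact NeZero.ne D (by rw [hD', h, zero_mul])
  obtain ⟨γ, h00, h01, h10, h11⟩ := exists_SL (a := 1 + D * b') (b := -(g * b' ^ 2))
    (c := D * D') (d := 1 - D * b') (by rw [hD']; push_cast; ring)
  have hγ : γ ∈ Gamma0 D := mem_Gamma0_of_dvd (by rw [h10]; exact dvd_mul_right _ _)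
  have hmul : upperGL D (g * b') * fricke D * transGL (1 / g) =
      mapGL ℝ γ * (upperGL D (g * b') * fricke D) := by
    have hD'' : (D : ℝ) = g * D' := by exact_mod_cast hD'
    ext i j
    simp only [Units.val_mul, val_upperGL, val_fricke, val_transGL, val_mapGL, h00, h01, h10, h11]
    fin_cases i <;> fin_cases j <;> simp
    all_goals (rw [hD'']; field_simp; try ring)
  rw [← slash_transGL (k := k) ((F ∣[(k : ℤ)] _) ∣[(k : ℤ)] _), ← SlashAction.slash_mul,
    ← SlashAction.slash_mul, ← SlashAction.slash_mul, ← mul_assoc, hmul,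
    SlashAction.slash_mul, hF.2.1 γ hγ, h11]
  simp

lemma isCuspPeriodic_upperGL_fricke [NeZero D] {F : ℍ → ℂ} (hF : F ∈ formSpace D k χ) (b : ℤ) :
    IsCuspPeriodic ((F ∣[(k : ℤ)] (upperGL D b)) ∣[(k : ℤ)] (fricke D)) where
  mdiff := (hF.1.slash _ _).slash _ _
  periodic z := by
    have := slash_upperGL_fricke_periodic hF (g := 1) (b := b) (by simp) (one_dvd _) z
    simpa using this
  zero := slash_isZeroAtImInfty hF (upperGL_mem_ratGL D b) fricke_mem_ratGL

/-- For `b` prime to `D` with inverse `e` modulo `D`, the cusp reached by the matrix on the left is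
equivalent to `i∞`. -/
lemma upperGL_mul_fricke_eq [NeZero D] {b e : ℤ} (h : (D : ℤ) ∣ b * e - 1) :
    ∃ γ ∈ Gamma0 D, γ 1 1 = e ∧ upperGL D b * fricke D = mapGL ℝ γ * reflGL D e := by
  obtain ⟨y, hy⟩ := h
  obtain ⟨γ, h00, h01, h10, h11⟩ := exists_SL (a := b) (b := y) (c := D) (d := e)
    (by linear_combination hy)
  refine ⟨γ, mem_Gamma0_of_dvd (by rw [h10]), h11, ?_⟩
  have hy' : (b : ℝ) * e - 1 = D * y := by exact_mod_cast congrArg (Int.cast : ℤ → ℝ) hy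
  ext i j
  simp only [Units.val_mul, val_upperGL, val_fricke, val_reflGL, val_mapGL, h00, h01, h10, h11]
  fin_cases i <;> fin_cases j <;> simp
  · linear_combination -hy'
  · ring

lemma coef_upperGL_fricke [NeZero D] (hk : 2 ≤ k) {F : ℍ → ℂ} (hF : F ∈ formSpace D k χ) {b e : ℤ}
    (h : (D : ℤ) ∣ b * e - 1) (n : ℕ) :
    coef ((F ∣[(k : ℤ)] (upperGL D b)) ∣[(k : ℤ)] (fricke D)) n =
      (-1) ^ k * (D : ℂ) ^ (k - 2) * conj (coef F n) *
        (conj (χ (e : ZMod D)) * Complex.exp (2 * Real.pi * Complex.I * (n * e / D))) := by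
  obtain ⟨γ, hγ, h11, hmul⟩ := upperGL_mul_fricke_eq h
  refine (isCuspPeriodic_upperGL_fricke hF b).coef_unique (c := fun n =>
      (-1) ^ k * (D : ℂ) ^ (k - 2) * conj (coef F n) *
        (conj (χ (e : ZMod D)) * Complex.exp (2 * Real.pi * Complex.I * (n * e / D))))
    (fun z => ?_) n
  rw [← SlashAction.slash_mul, hmul, SlashAction.slash_mul, hF.2.1 γ hγ, h11,
    smul_slash_of_neg _ _ (det_reflGL_neg D e), Pi.smul_apply, smul_eq_mul, slash_reflGL_apply hk]
  have h1 := ((Complex.hasSum_conj'.mpr ((isCuspPeriodic_of_mem hF).hasSum (reflGL D e • z))).mul_left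
    (conj (χ (e : ZMod D)) * ((-1) ^ k * (D : ℂ) ^ (k - 2))))
  convert! h1 using 1
  · funext n
    rw [coe_reflGL_smul, map_mul, ← Complex.exp_conj]
    simp only [map_mul, map_sub, map_neg, Complex.conj_conj, Complex.conj_I, map_ofNat,
      Complex.conj_ofReal, map_natCast, map_div₀, map_intCast]
    have : Complex.exp (2 * Real.pi * -Complex.I * (n * (-(z : ℂ) - e / D))) =
        Complex.exp (2 * Real.pi * Complex.I * (n * e / D)) *
          Complex.exp (2 * Real.pi * Complex.I * (n * z)) := by
      rw [← Complex.exp_add]; congr 1; ring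
    rw [this]
    ring
  · ring

/-- The twist by `χ`: for `n` prime to `D`, only the terms of `U_D` with `b` prime to `D`
contribute to the coefficient of `J U_D F`, and they produce a Gauss sum. -/
lemma coef_opU_fricke [NeZero D] (hk : 2 ≤ k) {F : ℍ → ℂ} (hF : F ∈ formSpace D k χ) {n : ℕ}
    (hn : n.Coprime D) :
    coef (opU k D F ∣[(k : ℤ)] (fricke D)) n =
      (-1) ^ k * (D : ℂ) ^ (k - 2) * conj (coef F n) *
        (χ n * gaussSum χ⁻¹ ZMod.stdAddChar) := by
  classical
  have e1 : opU k D F ∣[(k : ℤ)] (fricke D) =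
      ∑ j : ZMod D, (F ∣[(k : ℤ)] (upperGL D (j.val : ℤ))) ∣[(k : ℤ)] (fricke D) :=
    SlashAction.sum_slash _ _
  set f : ZMod D → ℂ := fun j =>
    coef ((F ∣[(k : ℤ)] (upperGL D (j.val : ℤ))) ∣[(k : ℤ)] (fricke D)) n with hf
  have e2 : coef (opU k D F ∣[(k : ℤ)] (fricke D)) n = ∑ j : ZMod D, f j := by
    rw [e1, IsCuspPeriodic.coef_sum _ fun j _ => isCuspPeriodic_upperGL_fricke hF _]
  have hsum : ∀ f : ZMod D → ℂ, (∀ j, ¬ IsUnit j → f j = 0) →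
      ∑ j, f j = ∑ u : (ZMod D)ˣ, f u := by
    intro f h0
    refine (Finset.sum_of_injOn (fun u : (ZMod D)ˣ => (u : ZMod D)) (Units.val_injective.injOn)
      (fun _ _ => Finset.mem_coe.mpr (Finset.mem_univ _)) (fun j _ hj => h0 j fun hu => hj ?_)
      fun u _ => rfl).symm
    exact ⟨hu.unit, by simp, rfl⟩
  -- For `gcd(j, D) > 1` the term has a period `1 / gcd(j, D)`.
  have hnon : ∀ j : ZMod D, ¬ IsUnit j → f j = 0 := by
    intro j hj
    set g := Nat.gcd j.val D with hg
    have hg1 : 1 < g := by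
      have h0 : 0 < g := Nat.gcd_pos_of_pos_right _ (NeZero.pos D)
      have h1 : g ≠ 1 := fun h => hj (by
        rw [← ZMod.natCast_zmod_val j]; exact (ZMod.isUnit_iff_coprime _ _).mpr h)
      omega
    exact (isCuspPeriodic_upperGL_fricke hF _).coef_eq_zero hg1
      (slash_upperGL_fricke_periodic hF (Int.natCast_dvd_natCast.mpr (Nat.gcd_dvd_left _ _))
        (Nat.gcd_dvd_right _ _))
      (hn.coprime_dvd_right (Nat.gcd_dvd_right _ _))
  have hunit : ∀ u : (ZMod D)ˣ, f ↑u⁻¹ = (-1) ^ k * (D : ℂ) ^ (k - 2) * conj (coef F n) *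
      (χ⁻¹ (u : ZMod D) * ZMod.stdAddChar ((n : ZMod D) * (u : ZMod D))) := by
    intro u
    have hdv : (D : ℤ) ∣ ((↑u⁻¹ : ZMod D).val : ℤ) * ((u : ZMod D).val : ℤ) - 1 := by
      rw [← ZMod.intCast_zmod_eq_zero_iff_dvd]
      push_cast
      rw [ZMod.natCast_zmod_val, ZMod.natCast_zmod_val, Units.inv_mul, sub_self]
    simp only [hf]
    rw [coef_upperGL_fricke hk hF hdv]
    congr 2
    · rw [MulChar.inv_apply_eq_inv', Int.cast_natCast, ZMod.natCast_zmod_val]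
      refine (Complex.inv_eq_conj (DirichletCharacter.unit_norm_eq_one χ u)).symm
    · have e : (n : ZMod D) * u = ((n * (u : ZMod D).val : ℤ) : ZMod D) := by
        push_cast; rw [ZMod.natCast_zmod_val]
      rw [e, ZMod.stdAddChar_coe]
      congr 1
      push_cast
      ring
  have hgs : ∑ u : (ZMod D)ˣ, χ⁻¹ (u : ZMod D) * (ZMod.stdAddChar ((n : ZMod D) * (u : ZMod D)) : ℂ) =
      χ n * gaussSum χ⁻¹ ZMod.stdAddChar := by
    have h := gaussSum_mulShift_eq χ⁻¹ (ZMod.stdAddChar (N := D)) (ZMod.unitOfCoprime n hn)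
    rw [inv_inv, ZMod.coe_unitOfCoprime] at h
    rw [← h, gaussSum, hsum]
    · simp only [AddChar.mulShift_apply]
    · intro j hj
      rw [MulChar.map_nonunit _ hj, zero_mul]
  rw [e2, hsum f hnon, ← Equiv.sum_comp (Equiv.inv (ZMod D)ˣ)]
  simp only [Equiv.inv_apply, hunit, ← Finset.mul_sum, hgs]

end

/-! ### Finite dimension -/

section

variable {D k : ℕ} {χ : DirichletCharacter ℂ D}

lemma norm_exp_two_pi_I_mul (n : ℕ) (z : ℂ) :
    ‖Complex.exp (2 * Real.pi * Complex.I * (n * z))‖ = Real.exp (-(2 * Real.pi * n * z.im)) := by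
  rw [Complex.norm_exp]
  congr 1
  simp
  ring

/-- A function whose first `N` Fourier coefficients vanish is `O(exp(-2πN Im z))` at `i∞`. -/
lemma IsCuspPeriodic.isBigO {F : ℍ → ℂ} (hF : IsCuspPeriodic F) {N : ℕ}
    (h : ∀ n < N, coef F n = 0) :
    F =O[atImInfty] fun z => Real.exp (-(2 * Real.pi * N * z.im)) := by
  have hs := (hF.hasSum I).summable.norm
  simp only [norm_mul, norm_exp_two_pi_I_mul, UpperHalfPlane.coe_im, I_im, mul_one] at hs
  set C := ∑' n, ‖coef F n‖ * Real.exp (-(2 * Real.pi * n)) with hC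
  refine Asymptotics.IsBigO.of_bound (C * Real.exp (2 * Real.pi * N)) ?_
  have h1 : ∀ᶠ z : ℍ in atImInfty, 1 ≤ z.im := Filter.eventually_comap.mpr
    ((Filter.eventually_ge_atTop 1).mono fun y hy z hz => hz ▸ hy)
  filter_upwards [h1] with z hz
  rw [Real.norm_of_nonneg (Real.exp_pos _).le, mul_assoc, ← Real.exp_add, ← (hF.hasSum z).tsum_eq]
  refine tsum_of_norm_bounded (hs.hasSum.mul_right _) fun n => ?_
  rw [norm_mul, norm_exp_two_pi_I_mul, mul_assoc ‖coef F n‖, ← Real.exp_add]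
  rcases lt_or_ge n N with hn | hn
  · simp [h n hn]
  · gcongr
    have hn' : (N : ℝ) ≤ n := by exact_mod_cast hn
    rw [UpperHalfPlane.coe_im]
    nlinarith [mul_nonneg (mul_nonneg (sub_nonneg.mpr hn') (sub_nonneg.mpr hz)) Real.pi_pos.le]

/-- Converse to the decay of functions with vanishing coefficients, in level one. -/
lemma coeff_eq_zero_of_isBigO {m : ℤ} (Φ : ModularForm 𝒮ℒ m) {N : ℕ}
    (h : (Φ : ℍ → ℂ) =O[atImInfty] fun z => Real.exp (-(2 * Real.pi * N * z.im))) {n : ℕ}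
    (hn : n < N) : (qExpansion 1 Φ).coeff n = 0 := by
  obtain ⟨C, hC⟩ := h.bound
  obtain ⟨A, hA⟩ := (atImInfty_mem _).mp hC
  have hle : ∀ t : ℝ, max A 1 ≤ t →
      ‖(qExpansion 1 Φ).coeff n‖ ≤ C * Real.exp (-(2 * Real.pi * (N - n)) * t) := by
    intro t ht
    have ht0 : 0 < t := one_pos.trans_le ((le_max_right _ _).trans ht)
    rw [ModularFormClass.qExpansion_coeff_eq_intervalIntegral Φ one_pos
      one_mem_strictPeriods_SL n ht0]
    have hb : ∀ u ∈ Set.uIoc (0 : ℝ) 1,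
        ‖1 / Function.Periodic.qParam 1 (u + t * Complex.I) ^ n *
          Φ ⟨u + t * Complex.I, by simpa using ht0⟩‖ ≤
        C * Real.exp (-(2 * Real.pi * (N - n)) * t) := by
      intro u _
      have e1 : (u + t * Complex.I : ℂ).im = t := by simp
      have hq : ‖1 / Function.Periodic.qParam 1 (u + t * Complex.I) ^ n‖ =
          Real.exp (2 * Real.pi * n * t) := by
        rw [norm_div, norm_one, qParam_pow, norm_exp_two_pi_I_mul, e1, one_div, ← Real.exp_neg,
          neg_neg]
      have hΦ : ∀ z : ℍ, z.im = t → ‖Φ z‖ ≤ C * Real.exp (-(2 * Real.pi * N * t)) := by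
        intro z hz
        have h2 : ‖Φ z‖ ≤ C * ‖Real.exp (-(2 * Real.pi * N * z.im))‖ :=
          hA z (hz ▸ (le_max_left _ _).trans ht)
        rwa [Real.norm_of_nonneg (Real.exp_pos _).le, hz] at h2
      rw [norm_mul, hq]
      calc _ ≤ Real.exp (2 * Real.pi * n * t) * (C * Real.exp (-(2 * Real.pi * N * t))) := by
            gcongr
            exact hΦ _ e1
        _ = C * (Real.exp (2 * Real.pi * n * t) * Real.exp (-(2 * Real.pi * N * t))) := by ring
        _ = _ := by rw [← Real.exp_add]; congr 2; ring
    have := intervalIntegral.norm_integral_le_of_norm_le_const hb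
    simpa using this
  have hlim : Filter.Tendsto (fun t : ℝ => C * Real.exp (-(2 * Real.pi * (N - n)) * t))
      Filter.atTop (nhds (C * 0)) := by
    refine (Real.tendsto_exp_atBot.comp (Filter.tendsto_id.const_mul_atTop_of_neg ?_)).const_mul C
    have : (n : ℝ) < N := by exact_mod_cast hn
    have := Real.pi_pos
    nlinarith
  rw [mul_zero] at hlim
  have := ge_of_tendsto hlim ((Filter.eventually_ge_atTop (max A 1)).mono hle)
  exact norm_le_zero_iff.mp this

/-- A cusp form with sufficiently many vanishing coefficients is zero: apply the Sturm bound in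
level one to its norm. -/
lemma exists_sturm_bound (D : ℕ) [NeZero D] (k : ℕ) (χ : DirichletCharacter ℂ D) :
    ∃ N : ℕ, ∀ f ∈ cuspForms D k χ, (∀ n < N, coef f n = 0) → f = 0 := by
  classical
  set 𝒢 := (Gamma1 D).map (mapGL ℝ) with h𝒢
  set m : ℤ := k * Nat.card (𝒮ℒ ⧸ 𝒢.subgroupOf 𝒮ℒ) with hm
  refine ⟨m.toNat / 12 + 1, fun f hf h0 => ?_⟩
  let Q := 𝒮ℒ ⧸ 𝒢.subgroupOf 𝒮ℒ
  let := Fintype.ofFinite Q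
  let Φ : ModularForm 𝒮ℒ m := ModularForm.norm 𝒮ℒ f
  have hO : (Φ : ℍ → ℂ) =O[atImInfty]
      fun z => Real.exp (-(2 * Real.pi * (m.toNat / 12 + 1 : ℕ) * z.im)) := by
    have hfO := (isCuspPeriodic_of_mem (coe_mem_formSpace hf)).isBigO h0
    have hΦ : (Φ : ℍ → ℂ) = fun z => ∏ q : Q, SlashInvariantForm.quotientFunc f q z := by
      rw [ModularForm.coe_norm]
      ext z
      rw [Finset.prod_apply]
    rw [hΦ]
    set E : ℍ → ℝ := fun z => Real.exp (-(2 * Real.pi * (m.toNat / 12 + 1 : ℕ) * z.im)) with hE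
    have hprod : E = fun z => ∏ q : Q, if q = (⟦1⟧ : Q) then E z else 1 := by
      ext z
      rw [Finset.prod_ite_eq']
      simp
    rw [hprod]
    -- The factor of the trivial coset is `f` itself and decays; the others are bounded.
    refine .finsetProd (Quotient.forall.mpr fun r _ => ?_)
    by_cases hr : (⟦r⟧ : Q) = ⟦1⟧
    · rw [hr]
      simpa using hfO
    · simp only [hr, if_false]
      have hr : (r : GL (Fin 2) ℝ)⁻¹ ∈ ratGL := by
        obtain ⟨γ, hγ⟩ := r.2
        rw [← hγ]
        exact inv_mem (mapGL_mem_ratGL γ)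
      exact ((coe_mem_formSpace hf).2.2 _ hr).isBoundedAtImInfty
  have hΦ0 : Φ = 0 := by
    refine ModularForm.sturm_bound_levelOne ?_
    have : ((m.toNat / 12 + 1 : ℕ) : ℕ∞) ≤ (qExpansion 1 Φ).order :=
      PowerSeries.nat_le_order _ _ fun n hn => coeff_eq_zero_of_isBigO Φ hO hn
    exact lt_of_lt_of_le (by exact_mod_cast Nat.lt_succ_self _) this
  have := (ModularForm.norm_eq_zero_iff 𝒮ℒ f).mp hΦ0
  exact DFunLike.coe_injective this

lemma finiteDimensional_cuspForms (D : ℕ) [NeZero D] (k : ℕ) (χ : DirichletCharacter ℂ D) :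
    FiniteDimensional ℂ (cuspForms D k χ) := by
  obtain ⟨N, hN⟩ := exists_sturm_bound D k χ
  have hm : ∀ f : cuspForms D k χ, IsCuspPeriodic (f.1 : ℍ → ℂ) := fun f =>
    isCuspPeriodic_of_mem (coe_mem_formSpace f.2)
  let L : cuspForms D k χ →ₗ[ℂ] (Fin N → ℂ) :=
    { toFun := fun f n => coef f.1 n
      map_add' := fun f g => by
        ext n
        have := IsCuspPeriodic.coef_sum (Finset.univ : Finset (Fin 2))
          (F := ![(f.1 : ℍ → ℂ), g.1]) (fun i _ => by fin_cases i <;> simp [hm]) n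
        simpa [Fin.sum_univ_two] using this
      map_smul' := fun c f => by
        ext n
        exact (hm f).coef_smul c n }
  refine FiniteDimensional.of_injective L ((injective_iff_map_eq_zero L).mpr fun f hf => ?_)
  exact Subtype.ext (hN f.1 f.2 fun n hn => congrFun hf ⟨n, hn⟩)

end

/-! ### Integration of holomorphic functions on a horizontal line against a Schwartz function -/

section

lemma norm_exp_two_pi_I (w : ℂ) :
    ‖Complex.exp (2 * Real.pi * Complex.I * w)‖ = Real.exp (-(2 * Real.pi * w.im)) := by
  simpa using norm_exp_two_pi_I_mul 1 w

lemma integrableOn_pow_mul_exp (m : ℕ) {s : ℂ} (hs : 0 < s.re) :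
    IntegrableOn (fun x : ℝ => (x : ℂ) ^ m * Complex.exp (-(s * x))) (Set.Ioi 0) := by
  have h := integrableOn_rpow_mul_exp_neg_mul_rpow (p := 1) (s := m) (b := s.re)
    (by have : (0 : ℝ) ≤ m := Nat.cast_nonneg m
        linarith) one_pos hs
  refine Integrable.mono' h (by fun_prop) ?_
  filter_upwards [ae_restrict_mem measurableSet_Ioi] with x hx
  have hx : (0 : ℝ) < x := hx
  rw [norm_mul, norm_pow, Complex.norm_real, Real.norm_of_nonneg hx.le, Complex.norm_exp,
    Real.rpow_one, Real.rpow_natCast]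
  simp

lemma tendsto_pow_mul_exp (m : ℕ) {s : ℂ} (hs : 0 < s.re) :
    Filter.Tendsto (fun x : ℝ => (x : ℂ) ^ m * Complex.exp (-(s * x))) Filter.atTop (nhds 0) := by
  rw [tendsto_zero_iff_norm_tendsto_zero]
  refine (tendsto_rpow_mul_exp_neg_mul_atTop_nhds_zero m s.re hs).congr' ?_
  filter_upwards [Filter.eventually_gt_atTop 0] with x hx
  rw [norm_mul, norm_pow, Complex.norm_real, Real.norm_of_nonneg hx.le, Complex.norm_exp,
    Real.rpow_natCast]
  simp

/-- The Laplace transform of `x ^ m`. -/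
lemma integral_pow_mul_exp (m : ℕ) {s : ℂ} (hs : 0 < s.re) :
    ∫ x in Set.Ioi (0 : ℝ), (x : ℂ) ^ m * Complex.exp (-(s * x)) = m.factorial / s ^ (m + 1) := by
  have hs0 : s ≠ 0 := by rintro rfl; simp at hs
  induction m with
  | zero =>
    have := integral_exp_mul_complex_Ioi (a := -s) (by simpa using hs) 0
    simp only [pow_zero, one_mul, ← neg_mul]
    rw [this]
    simp
  | succ m ih =>
    have hd : ∀ x ∈ Set.Ici (0 : ℝ), HasDerivAt
        (fun x : ℝ => (x : ℂ) ^ (m + 1) * Complex.exp (-(s * x)))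
        ((m + 1) * ((x : ℂ) ^ m * Complex.exp (-(s * x))) -
          s * ((x : ℂ) ^ (m + 1) * Complex.exp (-(s * x)))) x := by
      intro x _
      have h1 : HasDerivAt (fun x : ℂ => x ^ (m + 1) * Complex.exp (-(s * x)))
          ((m + 1) * ((x : ℂ) ^ m * Complex.exp (-(s * x))) -
          s * ((x : ℂ) ^ (m + 1) * Complex.exp (-(s * x)))) (x : ℂ) := by
        have h2 := (hasDerivAt_pow (m + 1) (x : ℂ)).mul
          (((hasDerivAt_id (x : ℂ)).const_mul s).neg.cexp)
        convert! h2 using 1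
        push_cast
        simp
        ring
      exact h1.comp_ofReal
    have hi1 := integrableOn_pow_mul_exp m hs
    have hi2 := integrableOn_pow_mul_exp (m + 1) hs
    have h := integral_Ioi_of_hasDerivAt_of_tendsto' hd
      ((hi1.const_mul _).sub (hi2.const_mul _)) (tendsto_pow_mul_exp (m + 1) hs)
    rw [integral_sub (hi1.const_mul _) (hi2.const_mul _), integral_const_mul, integral_const_mul,
      ih] at h
    simp only [Complex.ofReal_zero, zero_pow (Nat.succ_ne_zero m), zero_mul, sub_zero] at h
    have h3 : s * ∫ x in Set.Ioi (0 : ℝ), (x : ℂ) ^ (m + 1) * Complex.exp (-(s * x)) =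
        (m + 1) * (m.factorial / s ^ (m + 1)) := by linear_combination -h
    rw [Nat.factorial_succ]
    push_cast
    field_simp at h3 ⊢
    linear_combination h3

/-- The point `t + i`. -/
def linePt (t : ℝ) : ℂ := t + Complex.I

@[fun_prop]
lemma continuous_linePt : Continuous linePt := by unfold linePt; fun_prop

lemma linePt_im (t : ℝ) : (linePt t).im = 1 := by simp [linePt]

lemma linePt_ne_zero (t : ℝ) : linePt t ≠ 0 := fun h => by
  have := linePt_im t
  rw [h] at this
  simp at this

lemma one_le_norm_linePt (t : ℝ) : 1 ≤ ‖linePt t‖ := by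
  have := Complex.abs_im_le_norm (linePt t)
  rwa [linePt_im, abs_one] at this

lemma normSq_linePt (t : ℝ) : Complex.normSq (linePt t) = 1 + t ^ 2 := by
  simp [linePt, Complex.normSq_apply]; ring

/-- `G` is recovered from the Schwartz function `H` by integrating `e(xz)` on the line
`Im z = 1`: up to the factor `exp(-2πx)`, `G` is the Fourier transform of `H`. -/
def IsLineTransform (H : SchwartzMap ℝ ℂ) (G : ℝ → ℂ) : Prop :=
  ∀ x : ℝ, ∫ t, H t * Complex.exp (2 * Real.pi * Complex.I * (x * linePt t)) = G x

lemma exists_isLineTransform {G : ℝ → ℂ} (hG : ContDiff ℝ ∞ G) (hGc : HasCompactSupport G) :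
    ∃ H, IsLineTransform H G := by
  have h1 : ContDiff ℝ ∞ fun x : ℝ => G x * Complex.exp (2 * Real.pi * x) := by
    refine hG.mul (Complex.contDiff_exp.comp (contDiff_const.mul Complex.ofRealCLM.contDiff))
  let h : SchwartzMap ℝ ℂ := (hGc.mul_right (f' := fun x : ℝ =>
    Complex.exp (2 * Real.pi * x))).toSchwartzMap h1
  refine ⟨FourierTransform.fourier h, fun x => ?_⟩
  have h2 : FourierTransformInv.fourierInv (FourierTransform.fourier h) x = h x := by
    rw [FourierPair.fourierInv_fourier_eq]
  rw [SchwartzMap.fourierInv_coe, Real.fourierInv_eq'] at h2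
  have h3 : h x = G x * Complex.exp (2 * Real.pi * x) := rfl
  have h4 : G x = Complex.exp (-(2 * Real.pi * x)) * h x := by
    rw [h3, mul_left_comm, ← Complex.exp_add]
    simp
  rw [h4, ← h2, ← integral_const_mul]
  congr 1
  funext t
  rw [smul_eq_mul, ← mul_assoc (Complex.exp _), ← Complex.exp_add, mul_comm]
  congr 2
  have hI : Complex.I * Complex.I = -1 := Complex.I_mul_I
  simp [linePt]
  linear_combination 2 * Real.pi * x * hI

lemma integrable_mul_of_bounded (H : SchwartzMap ℝ ℂ) {φ : ℝ → ℂ} (hφ : Continuous φ) {C : ℝ}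
    (hC : ∀ t, ‖φ t‖ ≤ C) : Integrable fun t => H t * φ t := by
  refine (H.integrable.norm.mul_const C).mono' (by fun_prop) (Filter.Eventually.of_forall fun t => ?_)
  rw [norm_mul]
  exact mul_le_mul_of_nonneg_left (hC t) (norm_nonneg _)

namespace IsLineTransform

variable {H : SchwartzMap ℝ ℂ} {G : ℝ → ℂ}

/-- The integral of `H(t) z^(-m-1)`, `z = t + i`: write `z^(-m-1)` as a Laplace integral. -/
lemma integral_inv_pow (hH : IsLineTransform H G) (m : ℕ) :
    ∫ t, H t * (linePt t ^ (m + 1))⁻¹ =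
      (-2 * Real.pi * Complex.I) ^ (m + 1) / m.factorial *
        ∫ x in Set.Ioi (0 : ℝ), (x : ℂ) ^ m * G x := by
  have hpi : (Real.pi : ℂ) ≠ 0 := by exact_mod_cast Real.pi_ne_zero
  have hfac : (m.factorial : ℂ) ≠ 0 := by exact_mod_cast Nat.factorial_ne_zero m
  have h1 : ∀ t, H t * (linePt t ^ (m + 1))⁻¹ =
      (-2 * Real.pi * Complex.I) ^ (m + 1) / m.factorial * ∫ x in Set.Ioi (0 : ℝ), H t *
        ((x : ℂ) ^ m * Complex.exp (2 * Real.pi * Complex.I * (x * linePt t))) := by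
    intro t
    have hs : 0 < (-2 * Real.pi * Complex.I * linePt t).re := by
      simp [linePt, Real.pi_pos]
    have h2 := integral_pow_mul_exp m hs
    have h3 : ∀ x : ℝ, Complex.exp (-(-2 * Real.pi * Complex.I * linePt t * x)) =
        Complex.exp (2 * Real.pi * Complex.I * (x * linePt t)) := fun x => by
      congr 1; ring
    simp only [h3] at h2
    rw [integral_const_mul, h2, mul_pow (-2 * Real.pi * Complex.I)]
    have := linePt_ne_zero t
    have := Complex.I_ne_zero
    field_simp
  simp only [h1]
  rw [integral_const_mul, integral_integral_swap]
  · congr 1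
    refine integral_congr_ae (Filter.Eventually.of_forall fun x => ?_)
    simp only
    rw [← hH x, ← integral_const_mul]
    congr 1
    funext t
    ring
  · have h4 : IntegrableOn (fun x : ℝ => (x : ℂ) ^ m * Complex.exp (-((2 * Real.pi : ℝ) * x)))
        (Set.Ioi 0) := integrableOn_pow_mul_exp m (by rw [Complex.ofReal_re]; positivity)
    refine (H.integrable.mul_prod h4).mono (Continuous.aestronglyMeasurable (by fun_prop))
      (Filter.Eventually.of_forall fun p => ?_)
    simp only [Function.uncurry, norm_mul, norm_exp_two_pi_I]
    rw [Complex.norm_exp]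
    simp [linePt]

/-- Expansion of `e(-a/z)` in powers of `1/z`. -/
lemma hasSum_kernel (hH : IsLineTransform H G) (m : ℕ) (a : ℝ) :
    HasSum (fun j : ℕ => (-2 * Real.pi * Complex.I * a) ^ j / j.factorial *
        ((-2 * Real.pi * Complex.I) ^ (m + j + 1) / (m + j).factorial *
          ∫ x in Set.Ioi (0 : ℝ), (x : ℂ) ^ (m + j) * G x))
      (∫ t, H t * ((linePt t ^ (m + 1))⁻¹ *
        Complex.exp (2 * Real.pi * Complex.I * (-(a / linePt t))))) := by
  set c : ℕ → ℂ := fun j => (-2 * Real.pi * Complex.I * a) ^ j / j.factorial with hc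
  set F : ℕ → ℝ → ℂ := fun j t => H t * (c j * (linePt t ^ (m + j + 1))⁻¹) with hF
  have hcont : ∀ j, Continuous fun t => c j * (linePt t ^ (m + j + 1))⁻¹ := fun j =>
    continuous_const.mul ((continuous_linePt.pow _).inv₀ fun t => pow_ne_zero _ (linePt_ne_zero t))
  have hbd : ∀ j t, ‖c j * (linePt t ^ (m + j + 1))⁻¹‖ ≤ ‖c j‖ := fun j t => by
    rw [norm_mul, norm_inv, norm_pow]
    exact mul_le_of_le_one_right (norm_nonneg _)
      (inv_le_one_of_one_le₀ (one_le_pow₀ (one_le_norm_linePt t)))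
  have hint : ∀ j, Integrable (F j) := fun j => integrable_mul_of_bounded H (hcont j) (hbd j)
  have hcs : Summable fun j => ‖c j‖ := by
    have := Real.summable_pow_div_factorial ‖-2 * Real.pi * Complex.I * a‖
    refine this.congr fun j => ?_
    rw [hc]
    simp only [norm_div, norm_pow, Complex.norm_natCast]
  have hsum : Summable fun j => ∫ t, ‖F j t‖ := by
    refine Summable.of_nonneg_of_le (fun j => integral_nonneg fun t => norm_nonneg _) (fun j => ?_)
      (hcs.mul_left (∫ t, ‖H t‖))
    rw [← integral_mul_const]
    refine integral_mono (hint j).norm (H.integrable.norm.mul_const _) fun t => ?_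
    simp only [hF, norm_mul (H t)]
    exact mul_le_mul_of_nonneg_left (hbd j t) (norm_nonneg _)
  have h := hasSum_integral_of_summable_integral_norm hint hsum
  convert! h using 1
  · funext j
    rw [← integral_inv_pow hH, ← integral_const_mul]
    congr 1
    funext t
    simp only [hF, hc]
    ring
  · congr 1
    funext t
    rw [hF]
    simp only [tsum_mul_left]
    congr 1
    have hz := linePt_ne_zero t
    have h1 := NormedSpace.expSeries_div_hasSum_exp (2 * Real.pi * Complex.I * (-(a / linePt t)))
    rw [← Complex.exp_eq_exp_ℂ] at h1
    have h2 := (h1.mul_left (linePt t ^ (m + 1))⁻¹).tsum_eq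
    rw [← h2]
    refine tsum_congr fun j => ?_
    rw [hc]
    simp only
    rw [show 2 * Real.pi * Complex.I * (-(a / linePt t)) =
      (-2 * Real.pi * Complex.I * a) / linePt t by ring, div_pow, show m + j + 1 = m + 1 + j by ring,
      pow_add]
    field_simp
    ring

lemma exp_neg_le_factorial_div {u : ℝ} (hu : 0 < u) (N : ℕ) :
    Real.exp (-u) ≤ N.factorial / u ^ N := by
  have h := Real.pow_div_factorial_le_exp u hu.le N
  have hf : (0 : ℝ) < N.factorial := by exact_mod_cast N.factorial_pos
  rw [Real.exp_neg, inv_le_comm₀ (Real.exp_pos _) (by positivity), inv_div]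
  exact h

/-- Rapid decay in `a` of the transform of `z ^ (-m) e(-a/z)`. -/
lemma exists_kernel_bound (H : SchwartzMap ℝ ℂ) (m N : ℕ) :
    ∃ C : ℝ, ∀ a : ℝ, 0 < a →
      ∫ t, ‖H t * ((linePt t ^ m)⁻¹ * Complex.exp (2 * Real.pi * Complex.I * (-(a / linePt t))))‖ ≤
        C / a ^ N := by
  have hint : Integrable fun t => ‖H t‖ * (1 + t ^ 2) ^ N := by
    have h1 : ∀ t : ℝ, ‖H t‖ * (1 + t ^ 2) ^ N =
        ∑ i ∈ Finset.range (N + 1), (N.choose i : ℝ) * (‖t‖ ^ (2 * i) * ‖H t‖) := fun t => by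
      rw [add_comm, add_pow, Finset.mul_sum]
      refine Finset.sum_congr rfl fun i _ => ?_
      rw [pow_mul ‖t‖, Real.norm_eq_abs, sq_abs]
      simp
      ring
    simp only [h1]
    exact integrable_finsetSum _ fun i _ => (H.integrable_pow_mul volume (2 * i)).const_mul _
  refine ⟨(∫ t, ‖H t‖ * (1 + t ^ 2) ^ N) * (N.factorial / (2 * Real.pi) ^ N), fun a ha => ?_⟩
  rw [mul_div_assoc, ← integral_mul_const]
  refine integral_mono_of_nonneg (Filter.Eventually.of_forall fun t => norm_nonneg _)
    (hint.mul_const _) (Filter.Eventually.of_forall fun t => ?_)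
  -- `|e(-a/z)| = exp(-2πa / (1 + t²))` is small unless `t² > a`, where `H` is small.
  have him : (-((a : ℂ) / linePt t)).im = a / (1 + t ^ 2) := by
    rw [Complex.neg_im, Complex.div_im, normSq_linePt, linePt_im]
    simp
  have hp : (0 : ℝ) < 1 + t ^ 2 := by positivity
  have hpi := Real.pi_pos
  have h2 : ‖(linePt t ^ m)⁻¹‖ ≤ 1 := by
    rw [norm_inv, norm_pow]
    exact inv_le_one_of_one_le₀ (one_le_pow₀ (one_le_norm_linePt t))
  have h3 := exp_neg_le_factorial_div (u := 2 * Real.pi * (a / (1 + t ^ 2))) (by positivity) N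
  simp only [norm_mul (H t), norm_mul (linePt t ^ m)⁻¹, norm_exp_two_pi_I, him]
  calc ‖H t‖ * (‖(linePt t ^ m)⁻¹‖ * Real.exp (-(2 * Real.pi * (a / (1 + t ^ 2)))))
      ≤ ‖H t‖ * (1 * (N.factorial / (2 * Real.pi * (a / (1 + t ^ 2))) ^ N)) := by gcongr
    _ = _ := by
      rw [mul_pow, div_pow]
      field_simp

lemma continuous_kernel (m : ℕ) (a : ℝ) : Continuous fun t => (linePt t ^ m)⁻¹ *
    Complex.exp (2 * Real.pi * Complex.I * (-((a : ℂ) / linePt t))) :=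
  ((continuous_linePt.pow _).inv₀ fun t => pow_ne_zero _ (linePt_ne_zero t)).mul
    (Complex.continuous_exp.comp (continuous_const.mul
      ((continuous_const.div continuous_linePt linePt_ne_zero).neg)))

lemma integrable_kernel (H : SchwartzMap ℝ ℂ) (m : ℕ) {a : ℝ} (ha : 0 ≤ a) :
    Integrable fun t => H t * ((linePt t ^ m)⁻¹ *
      Complex.exp (2 * Real.pi * Complex.I * (-(a / linePt t)))) := by
  refine integrable_mul_of_bounded H (continuous_kernel m a) (C := 1) fun t => ?_
  rw [norm_mul, norm_exp_two_pi_I, norm_inv, norm_pow]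
  refine mul_le_one₀ (inv_le_one_of_one_le₀ (one_le_pow₀ (one_le_norm_linePt t)))
    (Real.exp_pos _).le (Real.exp_le_one_iff.mpr ?_)
  have him : (-((a : ℂ) / linePt t)).im = a / (1 + t ^ 2) := by
    rw [Complex.neg_im, Complex.div_im, normSq_linePt, linePt_im]
    simp
  rw [him, neg_nonpos]
  have := Real.pi_pos
  positivity

/-- Two expansions of the same function on the line `Im z = 1` give a summation formula. -/
lemma summation_formula (hH : IsLineTransform H G) (m M : ℕ) {A B : ℕ → ℂ} {r : ℝ} (hr : 0 < r)
    {F : ℝ → ℂ} (hA : Summable fun n => ‖A n‖ * Real.exp (-(2 * Real.pi * n)))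
    (hFA : ∀ t, HasSum (fun n => A n * Complex.exp (2 * Real.pi * Complex.I * (n * linePt t))) (F t))
    (hB0 : B 0 = 0) (hB : ∃ C, ∀ n, ‖B n‖ ≤ C * (n : ℝ) ^ M)
    (hFB : ∀ t, HasSum (fun n => B n * ((linePt t ^ m)⁻¹ *
      Complex.exp (2 * Real.pi * Complex.I * (-((n * r : ℝ) / linePt t))))) (F t)) :
    ∑' n, A n * G n = ∑' n, B n * ∫ t, H t * ((linePt t ^ m)⁻¹ *
      Complex.exp (2 * Real.pi * Complex.I * (-((n * r : ℝ) / linePt t)))) := by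
  have h1 : HasSum (fun n => A n * G n) (∫ t, H t * F t) := by
    have hc : ∀ n : ℕ, Continuous fun t =>
        A n * Complex.exp (2 * Real.pi * Complex.I * (n * linePt t)) := fun n => by fun_prop
    have hn : ∀ (n : ℕ) t, ‖A n * Complex.exp (2 * Real.pi * Complex.I * (n * linePt t))‖ =
        ‖A n‖ * Real.exp (-(2 * Real.pi * n)) := fun n t => by
      rw [norm_mul, norm_exp_two_pi_I_mul, linePt_im, mul_one]
    have hi := fun n : ℕ => integrable_mul_of_bounded H (hc n) fun t => (hn n t).le
    have := hasSum_integral_of_summable_integral_norm hi (by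
      simp only [norm_mul (H _), hn, integral_mul_const]
      exact hA.mul_left _)
    convert! this using 1
    · funext n
      have := hH n
      push_cast at this
      rw [← this, ← integral_const_mul]
      congr 1
      funext t
      ring
    · congr 1
      funext t
      rw [tsum_mul_left, (hFA t).tsum_eq]
  have h2 : HasSum (fun n => B n * ∫ t, H t * ((linePt t ^ m)⁻¹ *
      Complex.exp (2 * Real.pi * Complex.I * (-((n * r : ℝ) / linePt t))))) (∫ t, H t * F t) := by
    have hi : ∀ n : ℕ, Integrable fun t => B n * (H t * ((linePt t ^ m)⁻¹ *
        Complex.exp (2 * Real.pi * Complex.I * (-((n * r : ℝ) / linePt t))))) := fun n =>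
      (integrable_kernel H m (by positivity)).const_mul _
    obtain ⟨C, hC⟩ := hB
    obtain ⟨C', hC'⟩ := exists_kernel_bound H m (M + 2)
    have hs : Summable fun n : ℕ => ∫ t, ‖B n * (H t * ((linePt t ^ m)⁻¹ *
        Complex.exp (2 * Real.pi * Complex.I * (-((n * r : ℝ) / linePt t)))))‖ := by
      have hz : Summable fun n : ℕ => C * C' / r ^ (M + 2) * (1 / (n : ℝ) ^ 2) :=
        (Real.summable_one_div_nat_pow.mpr one_lt_two).mul_left _
      refine Summable.of_nonneg_of_le (fun n => integral_nonneg fun t => norm_nonneg _)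
        (fun n => ?_) hz
      simp only [norm_mul (B n), integral_const_mul]
      rcases Nat.eq_zero_or_pos n with rfl | hn
      · simp [hB0]
      · have hn' : (0 : ℝ) < n := by exact_mod_cast hn
        have h3 := hC' (n * r) (by positivity)
        calc _ ≤ (C * (n : ℝ) ^ M) * (C' / (n * r) ^ (M + 2)) :=
              mul_le_mul (hC n) h3 (integral_nonneg fun t => norm_nonneg _)
                ((norm_nonneg _).trans (hC n))
          _ = _ := by
              rw [mul_pow, pow_add (n : ℝ)]
              field_simp
    have := hasSum_integral_of_summable_integral_norm hi hs
    convert! this using 1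
    · funext n
      rw [integral_const_mul]
    · congr 1
      funext t
      rw [← (hFB t).tsum_eq, ← tsum_mul_left]
      exact tsum_congr fun n => by ring
  rw [h1.tsum_eq, h2.tsum_eq]

end IsLineTransform

end

/-! ### The Hankel transform -/

section

/-- The function `g(x) x^(-m/2)`: with `m = k - 1` it is the weight by which the unnormalized
coefficients enter the sum. For `x ≤ 0` it vanishes if `g` is supported on the positive reals. -/
def unnorm (m : ℕ) (g : ℝ → ℂ) (x : ℝ) : ℂ := g x * (((√x ^ m)⁻¹ : ℝ) : ℂ)

lemma contDiff_unnorm (m : ℕ) {g : ℝ → ℂ} (hg : ContDiff ℝ ∞ g)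
    (hgs : tsupport g ⊆ Set.Ioi (0 : ℝ)) : ContDiff ℝ ∞ (unnorm m g) := by
  rw [contDiff_iff_contDiffAt]
  intro x
  by_cases hx : x ∈ tsupport g
  · have hx0 : (0 : ℝ) < x := hgs hx
    have h1 : ContDiffAt ℝ ∞ (fun x : ℝ => (√x ^ m)⁻¹) x :=
      ((Real.contDiffAt_sqrt hx0.ne').pow m).inv (pow_ne_zero _ (Real.sqrt_pos.mpr hx0).ne')
    exact hg.contDiffAt.mul (Complex.ofRealCLM.contDiff.contDiffAt.comp x h1)
  · refine (contDiffAt_const (c := (0 : ℂ))).congr_of_eventuallyEq ?_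
    filter_upwards [notMem_tsupport_iff_eventuallyEq.mp hx] with y hy
    rw [unnorm, hy, Pi.zero_apply, zero_mul]

lemma hasCompactSupport_unnorm (m : ℕ) {g : ℝ → ℂ} (hg : HasCompactSupport g) :
    HasCompactSupport (unnorm m g) := hg.mul_right

lemma exists_bound_of_hasCompactSupport {G : ℝ → ℂ} (hG : HasCompactSupport G) :
    ∃ R : ℝ, 0 ≤ R ∧ ∀ x, R < |x| → G x = 0 := by
  obtain ⟨R, hR⟩ := hG.isCompact.isBounded.exists_norm_le
  refine ⟨max R 0, le_max_right _ _, fun x hx => image_eq_zero_of_notMem_tsupport fun h => ?_⟩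
  exact absurd (hR x h) (not_le.mpr ((le_max_left _ _).trans_lt hx))

/-- The power series of the Bessel function `J_m(4π√(ax))`. -/
lemma tsum_bessel (m : ℕ) (g : ℝ → ℂ) {a x : ℝ} (ha : 0 < a) (hx : 0 < x) :
    ∑' j : ℕ, (-2 * Real.pi * Complex.I * a) ^ j / j.factorial *
        ((-2 * Real.pi * Complex.I) ^ (m + j + 1) / (m + j).factorial *
          ((x : ℂ) ^ (m + j) * unnorm m g x)) =
      (-Complex.I) ^ (m + 1) / (√a : ℂ) ^ m * (2 * Real.pi) *
        (g x * (besselJ m (4 * Real.pi * √(a * x)) : ℝ)) := by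
  rw [besselJ, Complex.ofReal_tsum, ← tsum_mul_left, ← tsum_mul_left]
  refine tsum_congr fun j => ?_
  obtain ⟨u, hu, rfl⟩ : ∃ u : ℝ, 0 < u ∧ u ^ 2 = x := ⟨√x, Real.sqrt_pos.mpr hx, Real.sq_sqrt hx.le⟩
  obtain ⟨v, hv, rfl⟩ : ∃ v : ℝ, 0 < v ∧ v ^ 2 = a := ⟨√a, Real.sqrt_pos.mpr ha, Real.sq_sqrt ha.le⟩
  rw [unnorm, ← mul_pow, Real.sqrt_sq hu.le, Real.sqrt_sq hv.le, Real.sqrt_sq (by positivity),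
    show 4 * Real.pi * (v * u) / 2 = 2 * Real.pi * (v * u) by ring]
  have hu' : (u : ℂ) ≠ 0 := by exact_mod_cast hu.ne'
  have hv' : (v : ℂ) ≠ 0 := by exact_mod_cast hv.ne'
  push_cast
  rw [add_comm j m]
  -- The sign `(-1)^j` of the Bessel series is written as a square, `(-i)^(2j)`.
  have e1 : (-2 * (Real.pi : ℂ) * Complex.I * (v : ℂ) ^ 2) ^ j *
      (-2 * (Real.pi : ℂ) * Complex.I) ^ (m + j + 1) =
      (-1) ^ j * (-Complex.I) ^ (m + 1) * (2 * Real.pi) ^ (m + 2 * j + 1) * (v : ℂ) ^ (2 * j) := by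
    rw [show -2 * (Real.pi : ℂ) * Complex.I = (2 * Real.pi) * (-Complex.I) by ring]
    have hq : (-1 : ℂ) = (-Complex.I) ^ 2 := by rw [neg_sq, Complex.I_sq]
    rw [hq]
    generalize 2 * (Real.pi : ℂ) = p
    generalize -Complex.I = q
    ring
  have e2 : ((u : ℂ) ^ 2) ^ (m + j) * ((u : ℂ) ^ m)⁻¹ = (u : ℂ) ^ (2 * j + m) := by
    rw [← pow_mul, show 2 * (m + j) = (2 * j + m) + m by ring, pow_add _ _ m,
      mul_assoc, mul_inv_cancel₀ (pow_ne_zero _ hu'), mul_one]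
  have e3 : (v : ℂ) ^ (2 * j + m) / (v : ℂ) ^ m = (v : ℂ) ^ (2 * j) := by
    rw [pow_add, mul_div_cancel_right₀ _ (pow_ne_zero _ hv')]
  calc _ = ((-2 * (Real.pi : ℂ) * Complex.I * (v : ℂ) ^ 2) ^ j *
      (-2 * (Real.pi : ℂ) * Complex.I) ^ (m + j + 1)) * (((u : ℂ) ^ 2) ^ (m + j) * ((u : ℂ) ^ m)⁻¹) *
        g (u ^ 2) / (j.factorial * (m + j).factorial) := by ring
    _ = _ := by
      rw [e1, e2, ← e3]
      generalize 2 * (Real.pi : ℂ) = p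
      ring

/-- The integral transform of the summation formula is the Hankel transform. -/
lemma IsLineTransform.integral_kernel {H : SchwartzMap ℝ ℂ} {g : ℝ → ℂ} (m : ℕ)
    (hH : IsLineTransform H (unnorm m g)) (hg : ContDiff ℝ ∞ g) (hgc : HasCompactSupport g)
    (hgs : tsupport g ⊆ Set.Ioi (0 : ℝ)) {a : ℝ} (ha : 0 < a) :
    ∫ t, H t * ((linePt t ^ (m + 1))⁻¹ *
        Complex.exp (2 * Real.pi * Complex.I * (-(a / linePt t)))) =
      (-Complex.I) ^ (m + 1) / (√a : ℂ) ^ m * hankel (m + 1) g a := by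
  set G := unnorm m g with hG
  have hGi : Integrable G := (contDiff_unnorm m hg hgs).continuous.integrable_of_hasCompactSupport
    (hasCompactSupport_unnorm m hgc)
  have hGc := (contDiff_unnorm m hg hgs).continuous
  obtain ⟨R, hR0, hR⟩ := exists_bound_of_hasCompactSupport (hasCompactSupport_unnorm m hgc)
  set c : ℕ → ℂ := fun j => (-2 * Real.pi * Complex.I * a) ^ j / j.factorial *
    ((-2 * Real.pi * Complex.I) ^ (m + j + 1) / (m + j).factorial) with hc
  have hxb : ∀ (j : ℕ) (x : ℝ), ‖(x : ℂ) ^ (m + j) * G x‖ ≤ R ^ (m + j) * ‖G x‖ := fun j x => by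
    rw [norm_mul, norm_pow, Complex.norm_real, Real.norm_eq_abs]
    rcases le_or_gt |x| R with h | h
    · gcongr
    · rw [hG, hR x h]; simp
  have hi0 : ∀ j : ℕ, Integrable fun x : ℝ => (x : ℂ) ^ (m + j) * G x := fun j =>
    (hGi.norm.const_mul (R ^ (m + j))).mono' (by fun_prop) (Filter.Eventually.of_forall (hxb j))
  have hi : ∀ j : ℕ, Integrable (fun x : ℝ => c j * ((x : ℂ) ^ (m + j) * G x))
      (volume.restrict (Set.Ioi 0)) := fun j => ((hi0 j).const_mul _).restrict
  have hs : Summable fun j : ℕ =>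
      ∫ x in Set.Ioi (0 : ℝ), ‖c j * ((x : ℂ) ^ (m + j) * G x)‖ := by
    set p := 2 * Real.pi with hp
    have hpp : 0 < p := by positivity
    have hsm : Summable fun j : ℕ => p ^ (m + 1) * R ^ m * (∫ x in Set.Ioi (0 : ℝ), ‖G x‖) *
        ((p * a * p * R) ^ j / j.factorial) := (Real.summable_pow_div_factorial _).mul_left _
    refine Summable.of_nonneg_of_le (fun j => integral_nonneg fun t => norm_nonneg _)
      (fun j => ?_) hsm
    have hcj : ‖c j‖ ≤ (p * a) ^ j / j.factorial * p ^ (m + j + 1) := by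
      have h1 : ‖-2 * (Real.pi : ℂ) * Complex.I‖ = p := by
        simp [hp, Real.pi_pos.le]
      rw [hc]
      simp only [norm_mul, norm_div, norm_pow, Complex.norm_natCast]
      rw [← norm_mul, ← norm_mul, h1, Complex.norm_real, Real.norm_of_nonneg ha.le]
      refine mul_le_mul_of_nonneg_left (div_le_self (by positivity) ?_) (by positivity)
      exact_mod_cast (m + j).factorial_pos
    simp only [norm_mul (c j), integral_const_mul]
    have hint : ∫ x in Set.Ioi (0 : ℝ), ‖(x : ℂ) ^ (m + j) * G x‖ ≤
        R ^ (m + j) * ∫ x in Set.Ioi (0 : ℝ), ‖G x‖ := by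
      rw [← integral_const_mul]
      exact integral_mono (hi0 j).norm.restrict (hGi.norm.const_mul _).restrict (hxb j)
    calc _ ≤ ((p * a) ^ j / j.factorial * p ^ (m + j + 1)) *
          (R ^ (m + j) * ∫ x in Set.Ioi (0 : ℝ), ‖G x‖) :=
            mul_le_mul hcj hint (integral_nonneg fun t => norm_nonneg _) (by positivity)
      _ = _ := by rw [show m + j + 1 = m + 1 + j by ring, pow_add p, pow_add R, mul_pow (p * a * p),
                    mul_pow (p * a) p]; ring
  have h2 := hasSum_integral_of_summable_integral_norm hi hs
  have h1 := hH.hasSum_kernel m a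
  have h3 : (fun j : ℕ => (-2 * Real.pi * Complex.I * a) ^ j / j.factorial *
        ((-2 * Real.pi * Complex.I) ^ (m + j + 1) / (m + j).factorial *
          ∫ x in Set.Ioi (0 : ℝ), (x : ℂ) ^ (m + j) * G x)) =
      fun j => ∫ x in Set.Ioi (0 : ℝ), c j * ((x : ℂ) ^ (m + j) * G x) := by
    funext j
    rw [integral_const_mul, hc]
    ring
  rw [h3] at h1
  rw [h1.unique h2, hankel, Nat.add_sub_cancel, ← mul_assoc, ← integral_const_mul]
  refine setIntegral_congr_fun measurableSet_Ioi fun x hx => ?_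
  rw [← tsum_bessel m g ha hx]
  exact tsum_congr fun j => by rw [hc]; ring

end

/-! ### The Voronoi formula -/

section

variable {D k : ℕ} {χ : DirichletCharacter ℂ D}

lemma coe_fricke_smul [NeZero D] (z : ℍ) :
    ((fricke D • z : ℍ) : ℂ) = conj (1 / (D * (z : ℂ))) := by
  rw [coe_smul, σ, if_neg det_fricke_neg.not_gt, num, denom, val_fricke]
  simp

lemma slash_fricke_apply [NeZero D] (hk : 1 ≤ k) (F : ℍ → ℂ) (z : ℍ) :
    (F ∣[(k : ℤ)] (fricke D)) z = (D : ℂ)⁻¹ * ((z : ℂ) ^ k)⁻¹ * conj (F (fricke D • z)) := by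
  have hD : (D : ℂ) ≠ 0 := by simp [NeZero.ne D]
  have hσ : σ (fricke D) (F (fricke D • z)) = conj (F (fricke D • z)) := by
    rw [σ, if_neg det_fricke_neg.not_gt]; rfl
  rw [ModularForm.slash_apply, hσ, det_fricke, denom, val_fricke, abs_neg, Nat.abs_cast]
  simp only [Matrix.cons_val', Matrix.cons_val_zero, Matrix.cons_val_one, Matrix.of_apply,
    Matrix.cons_val_fin_one, Complex.ofReal_zero, add_zero, Complex.ofReal_natCast]
  obtain ⟨m, rfl⟩ := Nat.exists_eq_add_of_le hk
  rw [show (((1 + m : ℕ) : ℤ) - 1) = (m : ℤ) by push_cast; ring,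
    zpow_neg, zpow_natCast, zpow_natCast, mul_pow, mul_inv, pow_add (D : ℂ)]
  field_simp

/-- The expansion of `F|(0, 1; D, 0)` at the cusp `0`. -/
lemma hasSum_slash_fricke [NeZero D] (hk : 1 ≤ k) {F : ℍ → ℂ} (hF : F ∈ formSpace D k χ) (z : ℍ) :
    HasSum (fun n : ℕ => (D : ℂ)⁻¹ * conj (coef F n) * (((z : ℂ) ^ k)⁻¹ *
      Complex.exp (2 * Real.pi * Complex.I * (-((n * (D : ℝ)⁻¹ : ℝ) / (z : ℂ))))))
      ((F ∣[(k : ℤ)] (fricke D)) z) := by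
  rw [slash_fricke_apply hk]
  have h := (Complex.hasSum_conj'.mpr ((isCuspPeriodic_of_mem hF).hasSum (fricke D • z))).mul_left
    ((D : ℂ)⁻¹ * ((z : ℂ) ^ k)⁻¹)
  convert! h using 2 with n
  rw [map_mul, ← Complex.exp_conj, coe_fricke_smul]
  simp only [map_mul, Complex.conj_conj, Complex.conj_ofReal, Complex.conj_I, map_natCast,
    map_ofNat, Complex.ofReal_mul, Complex.ofReal_natCast, Complex.ofReal_inv]
  rw [show 2 * (Real.pi : ℂ) * Complex.I * -(n * (D : ℂ)⁻¹ / z) =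
    2 * Real.pi * -Complex.I * (n * (1 / (D * z))) by rw [one_div, mul_inv]; ring]
  ring

/-- Hecke's bound, with an unspecified exponent. -/
lemma exists_coef_bound [NeZero D] {F : ℍ → ℂ} (hF : F ∈ formSpace D k χ) :
    ∃ (M : ℕ) (C : ℝ), ∀ n : ℕ, ‖coef F n‖ ≤ C * (n : ℝ) ^ M := by
  obtain ⟨f, -, rfl⟩ := exists_cuspForm_of_mem_formSpace hF
  have h := CuspFormClass.qExpansion_isBigO f
  have hT : ModularGroup.T ∈ Gamma1 D := by
    rw [Gamma1_mem]; simp [ModularGroup.T]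
  have hw : ((Gamma1 D).map (mapGL ℝ)).strictWidthInfty = 1 :=
    Subgroup.strictWidthInfty_eq_one_of_T_mem hT
  rw [hw] at h
  obtain ⟨C, hC0, hC⟩ := Asymptotics.bound_of_isBigO_nat_atTop h
  refine ⟨k, C, fun n => ?_⟩
  rcases Nat.eq_zero_or_pos n with rfl | hn
  · rw [(isCuspPeriodic_of_mem hF).coef_zero, norm_zero]
    positivity
  have hn' : (1 : ℝ) ≤ n := by exact_mod_cast hn
  have hp : 0 < (n : ℝ) ^ (((k : ℤ) : ℝ) / 2) := by positivity
  refine (hC hp.ne').trans (mul_le_mul_of_nonneg_left ?_ hC0.le)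
  rw [Real.norm_of_nonneg hp.le, ← Real.rpow_natCast]
  refine Real.rpow_le_rpow_of_exponent_le hn' ?_
  rw [Int.cast_natCast]
  exact half_le_self k.cast_nonneg

lemma rpow_half_eq_sqrt_pow (hk : 1 ≤ k) (n : ℕ) :
    (n : ℝ) ^ (((k : ℝ) - 1) / 2) = √(n : ℝ) ^ (k - 1) := by
  rw [Real.sqrt_eq_rpow, ← Real.rpow_natCast, ← Real.rpow_mul (Nat.cast_nonneg n), Nat.cast_sub hk]
  congr 1
  push_cast
  ring

lemma fourierCoeff_eq (hk : 1 ≤ k) (F : ℍ → ℂ) (n : ℕ) :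
    fourierCoeff k F n = coef F n / (√(n : ℝ) : ℂ) ^ (k - 1) := by
  rw [fourierCoeff, rpow_half_eq_sqrt_pow hk, coef, Complex.ofReal_pow]

lemma exists_hankel_bound {g : ℝ → ℂ} (m N : ℕ) (hg : ContDiff ℝ ∞ g) (hgc : HasCompactSupport g)
    (hgs : tsupport g ⊆ Set.Ioi (0 : ℝ)) :
    ∃ C : ℝ, ∀ a : ℝ, 0 < a → ‖hankel (m + 1) g a‖ ≤ √a ^ m * (C / a ^ N) := by
  obtain ⟨H, hH⟩ := exists_isLineTransform (contDiff_unnorm m hg hgs)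
    (hasCompactSupport_unnorm m hgc)
  obtain ⟨C, hC⟩ := IsLineTransform.exists_kernel_bound H (m + 1) N
  refine ⟨C, fun a ha => ?_⟩
  have h1 := hH.integral_kernel m hg hgc hgs ha
  have h2 := (norm_integral_le_integral_norm _).trans (hC a ha)
  have ha' : 0 < √a ^ m := pow_pos (Real.sqrt_pos.mpr ha) m
  rw [h1, norm_mul, norm_div, norm_pow, norm_neg, Complex.norm_I, one_pow, norm_pow,
    Complex.norm_real, Real.norm_of_nonneg (Real.sqrt_nonneg a), one_div_mul_eq_div,
    div_le_iff₀ ha', mul_comm] at h2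
  exact h2

/-- The Hankel transform decays fast enough to be summed against polynomially bounded
coefficients. -/
lemma summable_mul_hankel {g : ℝ → ℂ} {m M : ℕ} (hg : ContDiff ℝ ∞ g) (hgc : HasCompactSupport g)
    (hgs : tsupport g ⊆ Set.Ioi (0 : ℝ)) [NeZero D] {c : ℕ → ℂ} {C : ℝ}
    (hc : ∀ n, ‖c n‖ ≤ C * (n : ℝ) ^ M) :
    Summable fun n : ℕ => c n * hankel (m + 1) g ((n : ℝ) / D) := by
  obtain ⟨C', hC'⟩ := exists_hankel_bound m (m + M + 2) hg hgc hgs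
  have hD : (0 : ℝ) < D := by exact_mod_cast NeZero.pos D
  have hD1 : (1 : ℝ) ≤ D := by exact_mod_cast NeZero.pos D
  have hz : Summable fun n : ℕ => C * C' * D ^ (m + M + 2) * (1 / (n : ℝ) ^ 2) :=
    (Real.summable_one_div_nat_pow.mpr one_lt_two).mul_left _
  refine Summable.of_norm_bounded_eventually_nat hz ?_
  filter_upwards [Filter.eventually_ge_atTop 1] with n hn
  have hn1 : (1 : ℝ) ≤ n := by exact_mod_cast hn
  have hn0 : (0 : ℝ) < n := by linarith
  have h1 := hC' ((n : ℝ) / D) (by positivity)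
  have hC'0 : 0 ≤ C' := by
    have h2 := (norm_nonneg _).trans (hC' 1 one_pos)
    simpa using h2
  have h3 : √((n : ℝ) / D) ≤ n := by
    rw [Real.sqrt_le_left hn0.le]
    calc (n : ℝ) / D ≤ n := div_le_self hn0.le hD1
      _ ≤ n ^ 2 := by nlinarith
  rw [norm_mul]
  have hC0 : 0 ≤ C * (n : ℝ) ^ M := (norm_nonneg _).trans (hc n)
  calc _ ≤ (C * (n : ℝ) ^ M) * ((n : ℝ) ^ m * (C' / ((n : ℝ) / D) ^ (m + M + 2))) := by
        refine mul_le_mul (hc n) (h1.trans ?_) (norm_nonneg _) hC0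
        gcongr
    _ = _ := by
        rw [div_pow, pow_add (n : ℝ), pow_add (n : ℝ)]
        field_simp

lemma tsum_pnat_eq_tsum_nat {f : ℕ → ℂ} (h : f 0 = 0) : ∑' n : ℕ+, f n = ∑' n : ℕ, f n := by
  rw [tsum_pnat_eq_tsum_succ (f := f)]
  refine (Function.Injective.tsum_eq (f := f) (g := Nat.succ) Nat.succ_injective ?_)
  intro n hn
  rcases n with _ | n
  · exact absurd h hn
  · exact ⟨n, rfl⟩

/-- The Voronoi summation formula that relates the coefficients of `J q` and `q`. -/
theorem voronoi [NeZero D] (hk : 1 ≤ k) {g : ℝ → ℂ} (hg : ContDiff ℝ ∞ g)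
    (hgc : HasCompactSupport g) (hgs : tsupport g ⊆ Set.Ioi (0 : ℝ)) {q : ℍ → ℂ}
    (hq : q ∈ formSpace D k χ) :
    ∑' n : ℕ+, fourierCoeff k (q ∣[(k : ℤ)] (fricke D)) n * g n =
      (-Complex.I) ^ k * (D : ℂ)⁻¹ * (√(D : ℝ) : ℂ) ^ (k - 1) *
        ∑' n : ℕ+, conj (fourierCoeff k q n) * hankel k g ((n : ℝ) / D) := by
  obtain ⟨m, rfl⟩ : ∃ m, k = m + 1 := ⟨k - 1, by omega⟩
  obtain ⟨H, hH⟩ := exists_isLineTransform (contDiff_unnorm m hg hgs)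
    (hasCompactSupport_unnorm m hgc)
  obtain ⟨M, C, hC⟩ := exists_coef_bound hq
  have hF := isCuspPeriodic_of_mem (slash_fricke_mem hq)
  have hD : (0 : ℝ) < D := by exact_mod_cast NeZero.pos D
  set F := q ∣[((m + 1 : ℕ) : ℤ)] (fricke D) with hFdef
  have hq0 := (isCuspPeriodic_of_mem hq).coef_zero
  let P : ℝ → ℍ := fun t => ⟨linePt t, by rw [linePt_im]; exact one_pos⟩
  have hP : ∀ t, ((P t : ℍ) : ℂ) = linePt t := fun t => rfl
  have hA : Summable fun n => ‖coef F n‖ * Real.exp (-(2 * Real.pi * n)) := by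
    have hs := (hF.hasSum I).summable.norm
    simpa only [norm_mul, norm_exp_two_pi_I_mul, UpperHalfPlane.coe_im, I_im, mul_one] using hs
  have key := hH.summation_formula (m + 1) M (A := coef F)
    (B := fun n => (D : ℂ)⁻¹ * conj (coef q n)) (r := (D : ℝ)⁻¹) (inv_pos.mpr hD)
    (F := fun t => F (P t)) hA (fun t => by simpa only [hP] using hF.hasSum (P t)) (by simp [hq0])
    ⟨(D : ℝ)⁻¹ * C, fun n => by
      rw [norm_mul, RCLike.norm_conj, norm_inv, Complex.norm_natCast, mul_assoc]
      exact mul_le_mul_of_nonneg_left (hC n) (by positivity)⟩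
    (fun t => by simpa only [hP] using hasSum_slash_fricke hk hq (P t))
  have e1 : ∀ n : ℕ, fourierCoeff (m + 1) F n * g n = coef F n * unnorm m g n := fun n => by
    rw [fourierCoeff_eq hk, Nat.add_sub_cancel, unnorm]
    push_cast
    ring
  have e2 : ∀ n : ℕ, (D : ℂ)⁻¹ * conj (coef q n) * (∫ t, H t * ((linePt t ^ (m + 1))⁻¹ *
      Complex.exp (2 * Real.pi * Complex.I * (-((n * (D : ℝ)⁻¹ : ℝ) / linePt t))))) =
      (-Complex.I) ^ (m + 1) * (D : ℂ)⁻¹ * (√(D : ℝ) : ℂ) ^ m *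
        (conj (fourierCoeff (m + 1) q n) * hankel (m + 1) g ((n : ℝ) / D)) := fun n => by
    rcases Nat.eq_zero_or_pos n with rfl | hn
    · simp [hq0, fourierCoeff_eq hk]
    have hn' : (0 : ℝ) < n := by exact_mod_cast hn
    rw [hH.integral_kernel m hg hgc hgs (by positivity), ← div_eq_mul_inv, fourierCoeff_eq hk,
      Nat.add_sub_cancel, Real.sqrt_div hn'.le, map_div₀, map_pow, Complex.conj_ofReal]
    push_cast
    rw [div_pow, div_div_eq_mul_div]
    ring
  rw [tsum_pnat_eq_tsum_nat (f := fun n => fourierCoeff (m + 1) F n * g n) (by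
      simp [fourierCoeff_eq hk, hF.coef_zero]),
    tsum_pnat_eq_tsum_nat (f := fun n => conj (fourierCoeff (m + 1) q n) *
      hankel (m + 1) g ((n : ℝ) / D)) (by simp [fourierCoeff_eq hk, hq0]),
    tsum_congr e1, key, Nat.add_sub_cancel, ← tsum_mul_left]
  exact tsum_congr e2

end

/-! ### The Gauss sum of a primitive character -/

section

variable {D k : ℕ} {χ : DirichletCharacter ℂ D}

/-- The product `χ(-1) τ(χ) τ(χ̄)` is `D`. Mathlib has this over fields; in general primitivity is
needed for `∑ χ(b) e(ab/D) = χ̄(a) τ(χ)` to hold for all `a`, not only for units. -/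
lemma gaussSum_mul_gaussSum_inv [NeZero D] (hχ : χ.IsPrimitive) :
    χ (-1) * gaussSum χ ZMod.stdAddChar * gaussSum χ⁻¹ ZMod.stdAddChar = D := by
  set e : AddChar (ZMod D) ℂ := ZMod.stdAddChar with he
  have h1 : ∀ a : ZMod D, χ⁻¹ a * gaussSum χ e = ∑ b, χ b * e (a * b) := fun a => by
    rw [← gaussSum_mulShift_of_isPrimitive e hχ a, gaussSum]
    simp only [AddChar.mulShift_apply]
  have h2 : χ (-1) * gaussSum χ⁻¹ e = gaussSum χ⁻¹ e⁻¹ := by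
    have h := gaussSum_mulShift_eq χ⁻¹ e (-1)
    rw [inv_inv, Units.coe_neg_one, ← AddChar.inv_mulShift] at h
    exact h.symm
  calc _ = (χ (-1) * gaussSum χ⁻¹ e) * gaussSum χ e := by ring
    _ = ∑ a, e (-a) * (χ⁻¹ a * gaussSum χ e) := by
      rw [h2, gaussSum, Finset.sum_mul]
      refine Finset.sum_congr rfl fun a _ => ?_
      rw [AddChar.inv_apply]
      ring
    _ = ∑ b, χ b * ∑ a, e (a * (b - 1)) := by
      simp only [h1, Finset.mul_sum]
      rw [Finset.sum_comm]
      refine Finset.sum_congr rfl fun b _ => Finset.sum_congr rfl fun a _ => ?_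
      rw [mul_left_comm, ← AddChar.map_add_eq_mul]
      congr 2
      ring
    _ = D := by
      have h3 : ∀ b : ZMod D, ∑ a, e (a * (b - 1)) = if b = 1 then (D : ℂ) else 0 := fun b => by
        have h := AddChar.sum_mulShift (b - 1) (ZMod.isPrimitive_stdAddChar D)
        rw [ZMod.card] at h
        simpa [sub_eq_zero] using h
      simp [h3]

/-! ### Fricke-dual reproducing kernels -/

/-- The form `q m` represents the `m`-th Fourier coefficient with respect to the symmetric
complex-bilinear pairing `(F, H) ↦ ⟨F|(0, 1; D, 0), H⟩`. -/
def IsFrickeKernel (k : ℕ) (χ : DirichletCharacter ℂ D) [NeZero D] (q : ℕ → ℍ → ℂ) : Prop :=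
  ∀ m, q m ∈ formSpace D k χ ∧ ∀ H ∈ formSpace D k χ,
    peterssonInner D k (q m ∣[(k : ℤ)] (fricke D)) H = coef H m

namespace IsFrickeKernel

variable [NeZero D] {q : ℕ → ℍ → ℂ}

lemma coef_comm (hq : IsFrickeKernel k χ q) (hk : 2 ≤ k) (m n : ℕ) :
    coef (q m) n = coef (q n) m := by
  rw [← (hq n).2 _ (hq m).1, ← (hq m).2 _ (hq n).1, peterssonInner_fricke_comm hk (hq n).1 (hq m).1]

/-- The self-adjointness of `U_d` in terms of coefficients. -/
lemma coef_mul (hq : IsFrickeKernel k χ q) (hk : 2 ≤ k) {d : ℕ} (hd0 : d ≠ 0)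
    (hd : ∃ j, d ∣ D ^ j) (m n : ℕ) : coef (q m) (d * n) = coef (q (d * m)) n := by
  have : NeZero d := ⟨hd0⟩
  rw [← coef_opU (hq m).1 d hd, ← (hq n).2 _ (opU_mem (hq m).1 d hd),
    ← peterssonInner_fricke_opU hk (hq n).1 (hq m).1 d hd,
    peterssonInner_fricke_comm hk (opU_mem (hq n).1 d hd) (hq m).1,
    (hq m).2 _ (opU_mem (hq n).1 d hd), coef_opU (hq n).1 d hd, hq.coef_comm hk]

/-- The coefficients of `J q_m` at multiples of `D`, through the conjugate of the coefficient of
index `m` of `J U_D q_n`. -/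
lemma coef_fricke (hq : IsFrickeKernel k χ q) (hk : 2 ≤ k) {m : ℕ} (hm : m.Coprime D) (n : ℕ) :
    coef (q m ∣[(k : ℤ)] (fricke D)) (D * n) = (-1) ^ k * (D : ℂ) ^ (k - 2) * coef (q m) n *
      conj (χ m * gaussSum χ⁻¹ ZMod.stdAddChar) := by
  have hD : ∃ j, D ∣ D ^ j := ⟨1, by simp⟩
  have hp := slash_fricke_mem (hq m).1
  have hU := opU_mem (hq n).1 D hD
  rw [← coef_opU hp D hD, ← (hq n).2 _ (opU_mem hp D hD),
    ← peterssonInner_fricke_opU hk (hq n).1 hp D hD,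
    peterssonInner_symm (isPeterssonBounded_of_mem hp)
      (isPeterssonBounded_of_mem (slash_fricke_mem hU)),
    (hq m).2 _ (slash_fricke_mem hU), coef_opU_fricke hk (hq n).1 hm, hq.coef_comm hk n m]
  simp

end IsFrickeKernel

/-! ### Orthogonal bases -/

section Basis

variable {ι : Type*} [Fintype ι] {f : ι → ℍ → ℂ}

/-- The form `∑ᵢ conj(aᵢ(m)) fᵢ / ‖fᵢ‖²` attached to the `m`-th Fourier coefficients `aᵢ(m)` of an
orthogonal basis `fᵢ`; it is a multiple of the `m`-th Poincaré series. -/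
def kernelForm (D k : ℕ) (f : ι → ℍ → ℂ) (m : ℕ) : ℍ → ℂ :=
  ∑ i, (conj (coef (f i) m) / (peterssonNormSq D k (f i) : ℂ)) • f i

lemma kernelForm_mem (hf : ∀ i, f i ∈ formSpace D k χ) (m : ℕ) :
    kernelForm D k f m ∈ formSpace D k χ :=
  Submodule.sum_mem _ fun i _ => Submodule.smul_mem _ _ (hf i)

lemma coef_kernelForm (hf : ∀ i, f i ∈ formSpace D k χ) (m n : ℕ) :
    coef (kernelForm D k f m) n =
      ∑ i, conj (coef (f i) m) / (peterssonNormSq D k (f i) : ℂ) * coef (f i) n :=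
  coef_sum_smul _ _ hf n

lemma peterssonInner_kernelForm [NeZero D] (hf : ∀ i, f i ∈ formSpace D k χ)
    (horth : Pairwise fun i j => peterssonInner D k (f i) (f j) = 0)
    (hf0 : ∀ i, f i ≠ 0)
    (hspan : ∀ H ∈ formSpace D k χ, ∃ c : ι → ℂ, H = ∑ i, c i • f i) (m : ℕ)
    {H : ℍ → ℂ} (hH : H ∈ formSpace D k χ) :
    peterssonInner D k (kernelForm D k f m) H = coef H m := by
  classical
  obtain ⟨c, rfl⟩ := hspan H hH
  have hb := fun i => isPeterssonBounded_of_mem (hf i)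
  have hN : ∀ i, (peterssonNormSq D k (f i) : ℂ) ≠ 0 := fun i h =>
    hf0 i (eq_zero_of_peterssonInner_self (hf i) (by rw [peterssonInner_self (hb i), h]))
  have h1 : ∀ i, peterssonInner D k (f i) (∑ j, c j • f j) = c i * peterssonNormSq D k (f i) := by
    intro i
    rw [peterssonInner_sum_right _ _ (hf i) hf, Finset.sum_eq_single i, peterssonInner_self (hb i)]
    · exact fun j _ hj => by rw [horth hj.symm, mul_zero]
    · exact fun h => absurd (Finset.mem_univ i) h
  have h2 : peterssonInner D k (∑ j, c j • f j) (kernelForm D k f m) =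
      conj (coef (∑ j, c j • f j) m) := by
    rw [kernelForm, peterssonInner_sum_right _ _ hH hf, coef_sum_smul _ _ hf, map_sum]
    refine Finset.sum_congr rfl fun i _ => ?_
    rw [peterssonInner_symm (hb i) (isPeterssonBounded_of_mem hH), h1, map_mul, map_mul,
      Complex.conj_ofReal]
    field_simp [hN i]
  rw [peterssonInner_symm (isPeterssonBounded_of_mem hH)
    (isPeterssonBounded_of_mem (kernelForm_mem hf m)), h2, Complex.conj_conj]

/-- The images of the forms `kernelForm` under the Fricke involution. -/
lemma exists_isFrickeKernel [NeZero D] (hk : 2 ≤ k) (hf : ∀ i, f i ∈ formSpace D k χ)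
    (horth : Pairwise fun i j => peterssonInner D k (f i) (f j) = 0)
    (hf0 : ∀ i, f i ≠ 0)
    (hspan : ∀ H ∈ formSpace D k χ, ∃ c : ι → ℂ, H = ∑ i, c i • f i) :
    ∃ q : ℕ → ℍ → ℂ, IsFrickeKernel k χ q ∧
      ∀ m, q m ∣[(k : ℤ)] (fricke D) = kernelForm D k f m := by
  have hD : (D : ℂ) ^ (k - 2) ≠ 0 := pow_ne_zero _ (by simp [NeZero.ne D])
  set q : ℕ → ℍ → ℂ := fun m => ((D : ℂ) ^ (k - 2))⁻¹ • (kernelForm D k f m ∣[(k : ℤ)] (fricke D))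
    with hq
  have h1 : ∀ m, q m ∣[(k : ℤ)] (fricke D) = kernelForm D k f m := fun m => by
    rw [hq]
    simp only
    rw [smul_slash_of_neg _ _ det_fricke_neg, slash_fricke_fricke hk, smul_smul]
    simp [hD]
  refine ⟨q, fun m => ⟨Submodule.smul_mem _ _ (slash_fricke_mem (kernelForm_mem hf m)),
    fun H hH => ?_⟩, h1⟩
  rw [h1, peterssonInner_kernelForm hf horth hf0 hspan m hH]

end Basis

end

/-! ### The averaged formula -/

section

variable {D k : ℕ} {χ : DirichletCharacter ℂ D}

lemma summable_fourierCoeff_mul {g : ℝ → ℂ} (hg : HasCompactSupport g) (F : ℍ → ℂ) :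
    Summable fun n : ℕ+ => fourierCoeff k F n * g n := by
  obtain ⟨R, -, hR⟩ := exists_bound_of_hasCompactSupport hg
  refine (summable_of_ne_finset_zero (f := fun n : ℕ => fourierCoeff k F n * g n)
    (s := Finset.range (⌊R⌋₊ + 1)) fun n hn => ?_).comp_injective PNat.coe_injective
  rw [Finset.mem_range, not_lt, Nat.add_one_le_iff] at hn
  rw [hR n (by rw [Nat.abs_cast]; exact Nat.lt_of_floor_lt hn), mul_zero]

lemma summable_fourierCoeff_mul_hankel [NeZero D] (hk : 1 ≤ k) {g : ℝ → ℂ} (hg : ContDiff ℝ ∞ g)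
    (hgc : HasCompactSupport g) (hgs : tsupport g ⊆ Set.Ioi (0 : ℝ)) {F : ℍ → ℂ}
    (hF : F ∈ formSpace D k χ) (a : ℕ) :
    Summable fun n : ℕ+ => conj (fourierCoeff k F (a * n)) * hankel k g ((n : ℝ) / D) := by
  obtain ⟨M, C, hC⟩ := exists_coef_bound hF
  have hC0 : 0 ≤ C := by simpa using (norm_nonneg _).trans (hC 1)
  have hb : ∀ n : ℕ, ‖conj (fourierCoeff k F (a * n))‖ ≤ C * a ^ M * (n : ℝ) ^ M := fun n => by
    rw [RCLike.norm_conj, fourierCoeff_eq hk, mul_assoc, ← mul_pow, ← Nat.cast_mul]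
    rcases Nat.eq_zero_or_pos (a * n) with h | h
    · rw [h, (isCuspPeriodic_of_mem hF).coef_zero, zero_div, norm_zero]
      positivity
    · rw [norm_div]
      refine (div_le_self (norm_nonneg _) ?_).trans (hC _)
      rw [norm_pow, Complex.norm_real, Real.norm_of_nonneg (Real.sqrt_nonneg _)]
      exact one_le_pow₀ (Real.one_le_sqrt.mpr (by exact_mod_cast h))
  obtain ⟨m, rfl⟩ : ∃ m, k = m + 1 := ⟨k - 1, by omega⟩
  exact (summable_mul_hankel hg hgc hgs hb).comp_injective PNat.coe_injective

section Basis

variable {ι : Type*} [Fintype ι] {f : ι → ℍ → ℂ}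

lemma fourierCoeff_kernelForm (hk : 1 ≤ k) (hf : ∀ i, f i ∈ formSpace D k χ) {m : ℕ} (hm : m ≠ 0)
    (n : ℕ) : fourierCoeff k (kernelForm D k f m) n =
      (√(m : ℝ) : ℂ) ^ (k - 1) * ∑ i, conj (fourierCoeff k (f i) m) * fourierCoeff k (f i) n /
        (peterssonNormSq D k (f i) : ℂ) := by
  have h : (√(m : ℝ) : ℂ) ^ (k - 1) ≠ 0 := by
    refine pow_ne_zero _ (Complex.ofReal_ne_zero.mpr (Real.sqrt_pos.mpr ?_).ne')
    exact_mod_cast Nat.pos_of_ne_zero hm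
  rw [fourierCoeff_eq hk, coef_kernelForm hf, Finset.sum_div, Finset.mul_sum]
  refine Finset.sum_congr rfl fun i _ => ?_
  rw [fourierCoeff_eq hk, fourierCoeff_eq hk, map_div₀, map_pow, Complex.conj_ofReal]
  field_simp

/-- The sums over a basis are sums over the coefficients of one form. -/
lemma sum_mul_tsum_fourierCoeff (hk : 1 ≤ k) (hf : ∀ i, f i ∈ formSpace D k χ) {m : ℕ}
    (hm : m ≠ 0) (u : ℕ+ → ℕ) (φ : ℕ+ → ℂ)
    (hs : ∀ i, Summable fun n => fourierCoeff k (f i) (u n) * φ n) :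
    ∑ i, conj (fourierCoeff k (f i) m) * (∑' n, fourierCoeff k (f i) (u n) * φ n) /
        (peterssonNormSq D k (f i) : ℂ) =
      ((√(m : ℝ) : ℂ) ^ (k - 1))⁻¹ * ∑' n, fourierCoeff k (kernelForm D k f m) (u n) * φ n := by
  have h : (√(m : ℝ) : ℂ) ^ (k - 1) ≠ 0 := by
    refine pow_ne_zero _ (Complex.ofReal_ne_zero.mpr (Real.sqrt_pos.mpr ?_).ne')
    exact_mod_cast Nat.pos_of_ne_zero hm
  have h1 : ∀ i, conj (fourierCoeff k (f i) m) * (∑' n, fourierCoeff k (f i) (u n) * φ n) /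
        (peterssonNormSq D k (f i) : ℂ) = ∑' n, conj (fourierCoeff k (f i) m) /
        (peterssonNormSq D k (f i) : ℂ) * (fourierCoeff k (f i) (u n) * φ n) := fun i => by
    rw [tsum_mul_left]; ring
  simp only [h1]
  rw [← Summable.tsum_finsetSum fun i _ => (hs i).mul_left _, ← tsum_mul_left]
  refine tsum_congr fun n => ?_
  rw [fourierCoeff_kernelForm hk hf hm, ← mul_assoc, ← mul_assoc, inv_mul_cancel₀ h, one_mul,
    Finset.sum_mul]
  exact Finset.sum_congr rfl fun i _ => by ring

lemma sum_mul_tsum_conj_fourierCoeff (hk : 1 ≤ k) (hf : ∀ i, f i ∈ formSpace D k χ) {m : ℕ}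
    (hm : m ≠ 0) (u : ℕ+ → ℕ) (φ : ℕ+ → ℂ)
    (hs : ∀ i, Summable fun n => conj (fourierCoeff k (f i) (u n)) * φ n) :
    ∑ i, fourierCoeff k (f i) m * (∑' n, conj (fourierCoeff k (f i) (u n)) * φ n) /
        (peterssonNormSq D k (f i) : ℂ) =
      ((√(m : ℝ) : ℂ) ^ (k - 1))⁻¹ *
        ∑' n, conj (fourierCoeff k (kernelForm D k f m) (u n)) * φ n := by
  have h := congrArg conj (sum_mul_tsum_fourierCoeff hk hf hm u (fun n => conj (φ n)) fun i => by
    rw [← Complex.summable_conj]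
    simpa using hs i)
  simpa [Complex.conj_tsum] using h

lemma IsFrickeKernel.fourierCoeff_fricke [NeZero D] {q : ℕ → ℍ → ℂ} (hq : IsFrickeKernel k χ q)
    (hk : 2 ≤ k) {d m : ℕ} (hd0 : d ≠ 0) (hd : ∃ j, d ∣ D ^ j) (hm : m.Coprime D) (n : ℕ) :
    fourierCoeff k (q m ∣[(k : ℤ)] (fricke D)) (d * D * n) =
      (-1) ^ k * (D : ℂ) ^ (k - 2) * conj (χ m * gaussSum χ⁻¹ ZMod.stdAddChar) /
        ((√(d : ℝ) : ℂ) ^ (k - 1) * (√(D : ℝ) : ℂ) ^ (k - 1)) *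
        fourierCoeff k (q (d * m)) n := by
  rw [fourierCoeff_eq (by omega), fourierCoeff_eq (by omega), show d * D * n = D * (d * n) by ring,
    hq.coef_fricke hk hm, hq.coef_mul hk hd0 hd]
  push_cast
  rw [Real.sqrt_mul (Nat.cast_nonneg D), Real.sqrt_mul (Nat.cast_nonneg d)]
  push_cast
  rw [mul_pow, mul_pow]
  field_simp

/-- The averaged formula for a finite orthogonal basis, without the constant of the harmonic
average. The parity condition on `χ` is not required: without it there are no nonzero forms. -/
theorem averaged_voronoi [NeZero D] (hk : 2 ≤ k) (hχ : χ.IsPrimitive)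
    {d m : ℕ} (hd0 : d ≠ 0) (hm0 : m ≠ 0) (hd : ∃ j, d ∣ D ^ j) (hm : m.Coprime D)
    {g : ℝ → ℂ} (hg : ContDiff ℝ ∞ g) (hgc : HasCompactSupport g)
    (hgs : tsupport g ⊆ Set.Ioi (0 : ℝ)) (hf : ∀ i, f i ∈ formSpace D k χ)
    (horth : Pairwise fun i j => peterssonInner D k (f i) (f j) = 0)
    (hf0 : ∀ i, f i ≠ 0)
    (hspan : ∀ H ∈ formSpace D k χ, ∃ c : ι → ℂ, H = ∑ i, c i • f i) :
    ∑ i, conj (fourierCoeff k (f i) (d * m)) * (∑' n : ℕ+, fourierCoeff k (f i) n * g n) /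
        (peterssonNormSq D k (f i) : ℂ) =
      Complex.I ^ k * χ (-1) * normGaussSum D χ / ((√(D : ℝ) : ℝ) : ℂ) * conj (χ m) *
        ∑ i, fourierCoeff k (f i) m * (∑' n : ℕ+, conj (fourierCoeff k (f i) (d * D * n)) *
          hankel k g ((n : ℝ) / D)) / (peterssonNormSq D k (f i) : ℂ) := by
  have hk1 : 1 ≤ k := by omega
  obtain ⟨q, hq, hqf⟩ := exists_isFrickeKernel hk hf horth hf0 hspan
  have hsq : ∀ {a : ℕ}, a ≠ 0 → (√(a : ℝ) : ℂ) ≠ 0 := fun {a} ha =>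
    Complex.ofReal_ne_zero.mpr (Real.sqrt_pos.mpr (by exact_mod_cast Nat.pos_of_ne_zero ha)).ne'
  have hs2 : (√(D : ℝ) : ℂ) * (√(D : ℝ) : ℂ) = D := by
    rw [← Complex.ofReal_mul, Real.mul_self_sqrt (Nat.cast_nonneg D), Complex.ofReal_natCast]
  have hsD := hsq (NeZero.ne D)
  have hsd := pow_ne_zero (k - 1) (hsq hd0)
  have hsm := pow_ne_zero (k - 1) (hsq hm0)
  -- Both sides become sums over the coefficients of `q (d * m)`, multiplied by constants.
  rw [sum_mul_tsum_fourierCoeff hk1 hf (mul_ne_zero hd0 hm0) (fun n => n) (fun n => g n)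
      fun i => summable_fourierCoeff_mul hgc (f i),
    sum_mul_tsum_conj_fourierCoeff hk1 hf hm0 (fun n => d * D * n)
      (fun n => hankel k g ((n : ℝ) / D))
      fun i => summable_fourierCoeff_mul_hankel hk1 hg hgc hgs (hf i) (d * D),
    ← hqf, ← hqf, voronoi hk1 hg hgc hgs (hq _).1]
  simp only [hq.fourierCoeff_fricke hk hd0 hd hm]
  have hχm : conj (χ m) * χ m = 1 := by
    have h := DirichletCharacter.unit_norm_eq_one χ (ZMod.unitOfCoprime m hm)
    rw [ZMod.coe_unitOfCoprime] at h
    rw [mul_comm, Complex.mul_conj', h]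
    simp
  have hG := gaussSum_mul_gaussSum_inv hχ
  have hconj : ∀ n : ℕ+, conj ((-1) ^ k * (D : ℂ) ^ (k - 2) *
      conj (χ m * gaussSum χ⁻¹ ZMod.stdAddChar) /
        ((√(d : ℝ) : ℂ) ^ (k - 1) * (√(D : ℝ) : ℂ) ^ (k - 1)) *
        fourierCoeff k (q (d * m)) n) * hankel k g ((n : ℝ) / D) =
      (-1) ^ k * (D : ℂ) ^ (k - 2) * (χ m * gaussSum χ⁻¹ ZMod.stdAddChar) /
        ((√(d : ℝ) : ℂ) ^ (k - 1) * (√(D : ℝ) : ℂ) ^ (k - 1)) *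
        (conj (fourierCoeff k (q (d * m)) n) * hankel k g ((n : ℝ) / D)) := fun n => by
    simp only [map_mul, map_div₀, map_pow, map_neg, map_one, Complex.conj_conj,
      Complex.conj_ofReal, map_natCast]
    ring
  simp only [hconj]
  rw [tsum_mul_left]
  generalize (∑' n : ℕ+, conj (fourierCoeff k (q (d * m)) n) * hankel k g ((n : ℝ) / D)) = S
  rw [normGaussSum, Nat.cast_mul, Real.sqrt_mul (Nat.cast_nonneg d), Complex.ofReal_mul, mul_pow,
    neg_pow, ← hs2]
  -- With `s = √D`, the constants are compared by means of `χ(-1) τ(χ) τ(χ̄) = s²`.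
  obtain ⟨j, rfl⟩ := Nat.exists_eq_add_of_le hk
  rw [← hs2] at hG
  rw [show 2 + j - 1 = j + 1 by omega, show 2 + j - 2 = j by omega] at *
  generalize (√(D : ℝ) : ℂ) = s at *
  generalize (√(d : ℝ) : ℂ) ^ (j + 1) = x at *
  generalize (√(m : ℝ) : ℂ) ^ (j + 1) = y at *
  generalize gaussSum χ⁻¹ ZMod.stdAddChar = τ' at *
  generalize gaussSum χ ZMod.stdAddChar = τ at *
  generalize χ (m : ZMod D) = v at *
  generalize χ (-1) = e at *
  field_simp
  linear_combination -(S * (s ^ 2) ^ j) * (hG + e * τ * τ' * hχm)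

end Basis

end

end AveragedVoronoi

end

open AveragedVoronoi in
theorem theorem1 (D k : ℕ) [NeZero D] (hD : 1 < D) (hk : 4 ≤ k)
    (χ : DirichletCharacter ℂ D) (hχ : χ.IsPrimitive) (hpar : χ (-1) = (-1) ^ k)
    -- `ℓ = ℓ₀ ℓ'` with `ℓ₀ ∣ D^∞` and `ℓ'` coprime to `D`, that is, `ℓ₀ = (ℓ, D^∞)`
    (ℓ ℓ₀ ℓ' : ℕ) (hℓ : 1 ≤ ℓ) (hfac : ℓ = ℓ₀ * ℓ') (hℓ₀ : ∃ j : ℕ, ℓ₀ ∣ D ^ j)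
    (hℓ' : Nat.Coprime ℓ' D)
    (g : ℝ → ℂ) (hg : ContDiff ℝ ∞ g) (hgc : HasCompactSupport g)
    (hgs : tsupport g ⊆ Set.Ioi (0 : ℝ))
    {ι : Type*} (B : Module.Basis ι ℂ (cuspForms D k χ))
    (hB : Pairwise fun i j => peterssonInner D k ⇑(B i).1 ⇑(B j).1 = 0) :
    Finite ι ∧
    (∀ i, Summable fun n : ℕ+ =>
      conj (fourierCoeff k ⇑(B i).1 (ℓ₀ * D * n)) * hankel k g ((n : ℝ) / D)) ∧
    harmonicSum D k (fun i => ⇑(B i).1) (fun i =>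
        conj (fourierCoeff k ⇑(B i).1 ℓ) * ∑' n : ℕ+, fourierCoeff k ⇑(B i).1 n * g n) =
      Complex.I ^ k * χ (-1) * normGaussSum D χ / ((√(D : ℝ) : ℝ) : ℂ) *
        harmonicSum D k (fun i => ⇑(B i).1) (fun i =>
          fourierCoeff k ⇑(B i).1 ℓ' * conj (χ (ℓ' : ZMod D)) *
            ∑' n : ℕ+, conj (fourierCoeff k ⇑(B i).1 (ℓ₀ * D * n)) *
              hankel k g ((n : ℝ) / D)) := by
  have hfd := finiteDimensional_cuspForms D k χ
  have hfin : Finite ι := Module.Finite.finite_basis B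
  have := Fintype.ofFinite ι
  have hf : ∀ i, ⇑(B i).1 ∈ formSpace D k χ := fun i => coe_mem_formSpace (B i).2
  refine ⟨hfin, fun i => summable_fourierCoeff_mul_hankel (by omega) hg hgc hgs (hf i) (ℓ₀ * D), ?_⟩
  let L : cuspForms D k χ →ₗ[ℂ] (ℍ → ℂ) :=
    { toFun := fun f => f.1
      map_add' := fun _ _ => rfl
      map_smul' := fun _ _ => rfl }
  have hf0 : ∀ i, (⇑(B i).1 : ℍ → ℂ) ≠ 0 := fun i h =>
    B.ne_zero i (Subtype.ext (DFunLike.coe_injective h))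
  have hspan : ∀ H ∈ formSpace D k χ, ∃ c : ι → ℂ, H = ∑ i, c i • ⇑(B i).1 := fun H hH => by
    obtain ⟨F, hF, rfl⟩ := exists_cuspForm_of_mem_formSpace hH
    refine ⟨fun i => B.repr ⟨F, hF⟩ i, ?_⟩
    have h := congrArg L (B.sum_repr ⟨F, hF⟩)
    rw [map_sum] at h
    simp only [map_smul] at h
    exact h.symm
  subst hfac
  have h0 : ℓ₀ ≠ 0 := by rintro rfl; simp at hℓ
  have h0' : ℓ' ≠ 0 := by rintro rfl; simp at hℓ
  have key := averaged_voronoi (by omega) hχ h0 h0' hℓ₀ hℓ' hg hgc hgs hf hB hf0 hspan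
  rw [harmonicSum, harmonicSum, finsum_eq_sum_of_fintype, finsum_eq_sum_of_fintype, key,
    mul_left_comm (Complex.I ^ k * χ (-1) * normGaussSum D χ / ((√(D : ℝ) : ℝ) : ℂ)),
    mul_assoc _ (conj (χ (ℓ' : ZMod D))), Finset.mul_sum]
  congr 2
  exact Finset.sum_congr rfl fun i _ => by ring
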